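/- Let $n\ge1$ and $s\in\mathbf R$. Conventions: $\hat\varphi(\xi)=\int_{\mathbf R^n}\varphi(x)e^{-ix\cdot\xi}\,dx$ for $\varphi$ in the Schwartz space $\mathcal S=\mathcal S(\mathbf R^n)$, extended to tempered distributions by duality; $D_j=-i\partial_j$; $\delta_0$ is the unit point mass at $0$. For real $d$, a "homogeneous polynomial of degree $d$" is a polynomial with complex coefficients all of whose monomials have total degree exactly $d$; in particular it is $0$ if $d$ is not a nonnegative integer. A cutoff function is a $\chi\in C_c^\infty(\mathbf R^n)$ with $0\le\chi\le1$ and $\chi=1$ in a neighbourhood of $0$; a patch function is $\theta=1-\chi$ with $\chi$ a cutoff function. A function $u\in C^\infty(\mathbf R^n\setminus\{0\})$ (complex-valued) is homogeneous of degree $s$ if $u(\lambda x)=\lambda^su(x)$ for all $x\ne0$, $\lambda>0$. A prolongation of such a $u$ is a tempered distribution $\dot u$ on $\mathbf R^n$ which equals $u$ on $\mathbf R^n\setminus\{0\}$ and such that for every $t>0$ the distribution $\dot u(t\,\cdot)-t^s\dot u$ is of the form $P(D)\delta_0$ with $P$ a homogeneous polynomial of degree $-n-s$ (so $\dot u$ is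 homogeneous of degree $s$ if $-n-s\notin\{0,1,2,\dots\}$). Let $\mathcal H_s$ be the space of all distributions $$\dot U_s+Q_s\log|\cdot|+P_{-n-s}(D)\delta_0,$$ where $\dot U_s$ is a prolongation of some $U_s\in C^\infty(\mathbf R^n\setminus\{0\})$ homogeneous of degree $s$, and $Q_s$, $P_{-n-s}$ are homogeneous polynomials of degrees $s$ and $-n-s$, respectively. For a cutoff or patch function $\psi$ put $\psi\mathcal H_s+\mathcal S=\{\psi v+g:\ v\in\mathcal H_s,\ g\in\mathcal S\}$. (i) Let $u\in C^\infty(\mathbf R^n\setminus\{0\})$ be homogeneous of degree $s$. Then $u$ has a prolongation. Let $Q$ be the homogeneous polynomial of degree $-n-s$ which is $0$ if $-n-s\notin\{0,1,2,\dots\}$ and is given by $$Q(\xi)=\int_{\mathbf S^{n-1}}\frac{(-ix\cdot\xi)^k\,u(x)}{k!}\,dx$$ (unnormalized surface measure) if $-n-s=k\in\{0,1,2,\dots\}$. For every prolongation $\dot u$ of $u$, $$\widehat{\dot u}=U-Q\log|\cdot|,$$ where $U$ is a homogeneous distribution on $\mathbf R^n$ of degree $-n-s$ which is smooth on $\mathbf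 R^n\setminus\{0\}$; and for every patch function $\theta$ and every cutoff function $\chi$ there is $g\in\mathcal S$ with $$\widehat{\theta u}=(U-Q\log|\cdot|)\,\chi+g.$$ (ii) For every patch function $\theta$ and every cutoff function $\chi$, the Fourier transform is a bijection of $\theta\mathcal H_s+\mathcal S$ onto $\chi\mathcal H_{-n-s}+\mathcal S$. Moreover, the sets $\theta\mathcal H_s+\mathcal S$ and $\chi\mathcal H_s+\mathcal S$ do not depend on the choice of $\theta$ and $\chi$. -/

import Mathlib

open MeasureTheory SchwartzMap LineDeriv FourierTransform
open scoped ContDiff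

noncomputable section

namespace HomogDistr

/-- Euclidean space `ℝⁿ`. -/
abbrev E (n : ℕ) := EuclideanSpace ℝ (Fin n)

variable {n : ℕ}

/-! ### Functions -/

/-- `u` is a smooth function on `ℝⁿ ∖ {0}` (the value `u 0` is irrelevant). -/
def SmoothOffZero (u : E n → ℂ) : Prop := ContDiffOn ℝ ∞ u {0}ᶜ

/-- `u (λ x) = λ ^ s u x` for all `x ≠ 0` and `λ > 0`. -/
def IsHomogFun (s : ℝ) (u : E n → ℂ) : Prop :=
  ∀ x : E n, x ≠ 0 → ∀ l : ℝ, 0 < l → u (l • x) = ((l ^ s : ℝ) : ℂ) * u x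

/-- Cutoff functions: `χ ∈ C_c^∞(ℝⁿ)`, `0 ≤ χ ≤ 1`, `χ = 1` in a neighbourhood of the origin. -/
structure IsCutoff (χ : E n → ℝ) : Prop where
  smooth : ContDiff ℝ ∞ χ
  compact : HasCompactSupport χ
  nonneg : ∀ x, 0 ≤ χ x
  le_one : ∀ x, χ x ≤ 1
  eq_one : ∀ᶠ x in nhds (0 : E n), χ x = 1

/-- Patch functions: `θ = 1 - χ` with `χ` a cutoff function. -/
def IsPatch (θ : E n → ℝ) : Prop := ∃ χ : E n → ℝ, IsCutoff χ ∧ ∀ x, θ x = 1 - χ x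

/-- The value at `x ∈ ℝⁿ` of a polynomial in `n` variables with complex coefficients. -/
def polyEval (Q : MvPolynomial (Fin n) ℂ) (x : E n) : ℂ :=
  MvPolynomial.eval (fun i => (x i : ℂ)) Q

/-- `Q` is a homogeneous polynomial of degree `s`, for real `s`: every monomial occurring in `Q`
has total degree `s`.  In particular `Q = 0` if `s` is not a nonnegative integer. -/
def IsHomogPoly (s : ℝ) (Q : MvPolynomial (Fin n) ℂ) : Prop :=
  ∀ α : Fin n →₀ ℕ, Q.coeff α ≠ 0 → ((α.degree : ℕ) : ℝ) = s

/-! ### Tempered distributions given by functions -/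

/-- `f` is integrable on `ℝⁿ` against some negative power of `1 + ‖x‖`. -/
def IsTemperedFun (f : E n → ℂ) : Prop :=
  ∃ N : ℕ, Integrable (fun x : E n => (((1 + ‖x‖) ^ (-(N : ℝ)) : ℝ) : ℂ) * f x)

theorem norm_mul_schwartz_le (f : E n → ℂ) (N : ℕ) (φ : 𝓢(E n, ℂ)) (x : E n) :
    ‖f x * φ x‖ ≤ ‖(((1 + ‖x‖) ^ (-(N : ℝ)) : ℝ) : ℂ) * f x‖ *
      (2 ^ N * ((Finset.Iic ((N, 0) : ℕ × ℕ)).sup (schwartzSeminormFamily ℂ (E n) ℂ)) φ) := by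
  have h := one_add_le_sup_seminorm_apply (𝕜 := ℂ) (m := (N, 0)) (k := N) (n := 0) le_rfl le_rfl
    φ x
  simp only [norm_iteratedFDeriv_zero] at h
  have hp : (0 : ℝ) < 1 + ‖x‖ := by positivity
  have hpN : (0 : ℝ) < (1 + ‖x‖) ^ N := by positivity
  rw [norm_mul, norm_mul, Complex.norm_real, Real.norm_of_nonneg (by positivity),
    Real.rpow_neg hp.le, Real.rpow_natCast]
  calc ‖f x‖ * ‖φ x‖ = ((1 + ‖x‖) ^ N)⁻¹ * ‖f x‖ * ((1 + ‖x‖) ^ N * ‖φ x‖) := by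
        field_simp
    _ ≤ _ := by
        exact mul_le_mul_of_nonneg_left h (by positivity)

theorem IsTemperedFun.integrable_mul {f : E n → ℂ} (hf : IsTemperedFun f) (φ : 𝓢(E n, ℂ)) :
    Integrable (fun x => f x * φ x) := by
  obtain ⟨N, hN⟩ := hf
  have hm : AEStronglyMeasurable f (volume : Measure (E n)) := by
    have h1 : Continuous fun x : E n => (((1 + ‖x‖) ^ (N : ℝ) : ℝ) : ℂ) := by
      refine Complex.continuous_ofReal.comp ?_
      exact (continuous_const.add continuous_norm).rpow_const fun x => Or.inr (by positivity)
    refine (h1.aestronglyMeasurable.mul hN.aestronglyMeasurable).congr (.of_forall fun x => ?_)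
    have hp : (0 : ℝ) < 1 + ‖x‖ := by positivity
    simp only [Pi.mul_apply, ← mul_assoc, ← Complex.ofReal_mul, ← Real.rpow_add hp]
    simp
  refine (hN.norm.mul_const _).mono' (hm.mul φ.continuous.aestronglyMeasurable)
    (.of_forall fun x => norm_mul_schwartz_le f N φ x)

/-- The tempered distribution `φ ↦ ∫ f φ` given by a function `f`. -/
def ofFun (f : E n → ℂ) (hf : IsTemperedFun f) : 𝓢'(E n, ℂ) :=
  ContinuousLinearMap.toPointwiseConvergenceCLM _ _ _ _ <|
    mkCLMtoNormedSpace (𝕜 := ℂ) (fun φ : 𝓢(E n, ℂ) => ∫ x, f x * φ x)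
      (fun φ ψ => by
        simp only [add_apply, mul_add]
        exact integral_add (hf.integrable_mul φ) (hf.integrable_mul ψ))
      (fun a φ => by
        simp only [smul_apply, smul_eq_mul, RingHom.id_apply, mul_left_comm _ a]
        exact integral_const_mul a _)
      (by
        obtain ⟨N, hN⟩ := id hf
        refine ⟨Finset.Iic ((N, 0) : ℕ × ℕ),
          (∫ x : E n, ‖(((1 + ‖x‖) ^ (-(N : ℝ)) : ℝ) : ℂ) * f x‖) * 2 ^ N, ?_, fun φ => ?_⟩
        · exact mul_nonneg (integral_nonneg fun x => norm_nonneg _) (by positivity)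
        · refine (norm_integral_le_integral_norm _).trans ?_
          refine (integral_mono (hf.integrable_mul φ).norm (hN.norm.mul_const _)
            fun x => norm_mul_schwartz_le f N φ x).trans ?_
          rw [integral_mul_const, mul_assoc])

theorem ofFun_apply (f : E n → ℂ) (hf : IsTemperedFun f) (φ : 𝓢(E n, ℂ)) :
    ofFun f hf φ = ∫ x, f x * φ x := rfl

/-- The tempered distribution given by a Schwartz function. -/
def ofSchwartz (g : 𝓢(E n, ℂ)) : 𝓢'(E n, ℂ) := toTemperedDistributionCLM (E n) ℂ volume g

theorem ofSchwartz_apply (g φ : 𝓢(E n, ℂ)) : ofSchwartz g φ = ∫ x, φ x * g x := by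
  simp [ofSchwartz]

/-- The function `log ‖x‖` is tempered. -/
theorem isTemperedFun_log : IsTemperedFun (fun x : E n => (Real.log ‖x‖ : ℂ)) := by
  rcases Nat.eq_zero_or_pos n with rfl | hn
  · refine ⟨0, (integrable_zero _ _ _).congr (.of_forall fun x => ?_)⟩
    rw [Subsingleton.elim x 0]
    simp
  have : Nonempty (Fin n) := ⟨⟨0, hn⟩⟩
  have : Nontrivial (E n) := inferInstance
  refine ⟨n + 2, ?_⟩
  have hb : IntegrableOn (fun x : E n => Real.log ‖x‖) (Metric.ball 0 1) := by
    rw [integrableOn_fun_norm_addHaar volume (f := Real.log)]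
    have h1 : IntegrableOn Real.log (Set.Ioc 0 1) :=
      (intervalIntegrable_iff_integrableOn_Ioc_of_le zero_le_one).1
        intervalIntegral.intervalIntegrable_log'
    refine Integrable.mono (h1.mono_set Set.Ioo_subset_Ioc_self) ?_ ?_
    · exact ((measurable_id.pow_const _).smul Real.measurable_log).aestronglyMeasurable
    · refine (ae_restrict_mem measurableSet_Ioo).mono fun y hy => ?_
      rw [norm_smul, norm_pow, Real.norm_of_nonneg hy.1.le]
      exact mul_le_of_le_one_left (norm_nonneg _) (pow_le_one₀ hy.1.le hy.2.le)
  have hj : Integrable (fun x : E n => (1 + ‖x‖) ^ (-((n : ℝ) + 1))) :=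
    integrable_one_add_norm (by simp)
  refine (((integrable_indicator_iff measurableSet_ball).2 hb.norm).add hj).mono' ?_
    (.of_forall fun x => ?_)
  · refine Measurable.aestronglyMeasurable ?_
    fun_prop
  have hp : (0 : ℝ) < 1 + ‖x‖ := by positivity
  rw [norm_mul, Complex.norm_real, Complex.norm_real, Real.norm_of_nonneg (by positivity)]
  by_cases hx : x ∈ Metric.ball (0 : E n) 1
  · simp only [Pi.add_apply, Set.indicator_of_mem hx]
    have h1 : (1 + ‖x‖) ^ (-((n + 2 : ℕ) : ℝ)) ≤ 1 :=
      Real.rpow_le_one_of_one_le_of_nonpos (by simp) (neg_nonpos.2 (Nat.cast_nonneg _))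
    have h2 : 0 ≤ (1 + ‖x‖) ^ (-((n : ℝ) + 1)) := by positivity
    exact (mul_le_of_le_one_left (norm_nonneg _) h1).trans (le_add_of_nonneg_right h2)
  · simp only [Pi.add_apply, Set.indicator_of_notMem hx, zero_add]
    have hx1 : 1 ≤ ‖x‖ := by simpa using hx
    have h3 : ‖Real.log ‖x‖‖ ≤ 1 + ‖x‖ := by
      rw [Real.norm_of_nonneg (Real.log_nonneg hx1)]
      linarith [Real.log_le_sub_one_of_pos (zero_lt_one.trans_le hx1)]
    calc (1 + ‖x‖) ^ (-((n + 2 : ℕ) : ℝ)) * ‖Real.log ‖x‖‖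
        ≤ (1 + ‖x‖) ^ (-((n + 2 : ℕ) : ℝ)) * (1 + ‖x‖) ^ (1 : ℝ) := by
          rw [Real.rpow_one]; gcongr
      _ = (1 + ‖x‖) ^ (-((n : ℝ) + 1)) := by
          rw [← Real.rpow_add hp]; congr 1; push_cast; ring

/-- The tempered distribution `log |·|`. -/
def logDist : 𝓢'(E n, ℂ) := ofFun _ isTemperedFun_log

/-- Multiplication of a tempered distribution by a smooth real function `χ` with all derivatives
of polynomial growth. -/
def mulDist (χ : E n → ℝ) (T : 𝓢'(E n, ℂ)) : 𝓢'(E n, ℂ) :=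
  TemperedDistribution.smulLeftCLM ℂ (fun x => (χ x : ℂ)) T

/-- The tempered distribution `Q log |·|` for a polynomial `Q`. -/
def polyLog (Q : MvPolynomial (Fin n) ℂ) : 𝓢'(E n, ℂ) :=
  TemperedDistribution.smulLeftCLM ℂ (polyEval Q) logDist

/-! ### Constant coefficient differential operators, dilations, Fourier transform -/

/-- `D_j = -i ∂_j` on tempered distributions. -/
def dOp (j : Fin n) (T : 𝓢'(E n, ℂ)) : 𝓢'(E n, ℂ) :=
  (-Complex.I) • ∂_{(EuclideanSpace.single j (1 : ℝ) : E n)} T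

/-- `D^α = D_1^{α_1} ⋯ D_n^{α_n}` on tempered distributions. -/
def dPow (α : Fin n →₀ ℕ) (T : 𝓢'(E n, ℂ)) : 𝓢'(E n, ℂ) :=
  (List.finRange n).foldr (fun j S => (dOp j)^[α j] S) T

/-- `P(D) δ₀ = ∑_α P_α D^α δ₀`. -/
def polyDelta (P : MvPolynomial (Fin n) ℂ) : 𝓢'(E n, ℂ) :=
  ∑ α ∈ P.support, P.coeff α • dPow α (TemperedDistribution.delta (0 : E n))

/-- `φ ↦ φ(t ·)` on Schwartz functions, for `t ≠ 0`. -/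
def dilS (t : ℝ) (ht : t ≠ 0) : 𝓢(E n, ℂ) →L[ℂ] 𝓢(E n, ℂ) :=
  compCLMOfContinuousLinearEquiv ℂ (ContinuousLinearEquiv.smulLeft (Units.mk0 t ht))

theorem dilS_apply (t : ℝ) (ht : t ≠ 0) (φ : 𝓢(E n, ℂ)) (x : E n) :
    dilS t ht φ x = φ (t • x) := rfl

/-- `T ↦ T(t ·)` on tempered distributions, for `t > 0`:
`⟨T(t ·), φ⟩ = t⁻ⁿ ⟨T, φ(t⁻¹ ·)⟩`. -/
def dil (t : ℝ) (ht : 0 < t) (T : 𝓢'(E n, ℂ)) : 𝓢'(E n, ℂ) :=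
  ((t ^ n : ℝ) : ℂ)⁻¹ • PointwiseConvergenceCLM.precomp ℂ (dilS t⁻¹ (inv_ne_zero ht.ne')) T

theorem dil_apply (t : ℝ) (ht : 0 < t) (T : 𝓢'(E n, ℂ)) (φ : 𝓢(E n, ℂ)) :
    dil t ht T φ = ((t ^ n : ℝ) : ℂ)⁻¹ * T (dilS t⁻¹ (inv_ne_zero ht.ne') φ) := rfl

/-- The Fourier transform `φ̂(ξ) = ∫ φ(x) exp(-i x·ξ) dx` on Schwartz functions. -/
def fourierS : 𝓢(E n, ℂ) →L[ℂ] 𝓢(E n, ℂ) :=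
  (dilS (2 * Real.pi)⁻¹ (by positivity)).comp (fourierCLM ℂ 𝓢(E n, ℂ))

theorem fourierS_apply (φ : 𝓢(E n, ℂ)) (ξ : E n) :
    fourierS φ ξ = ∫ x, φ x * Complex.exp (-Complex.I * (inner ℝ x ξ : ℝ)) := by
  have : fourierS φ ξ = 𝓕 (φ : E n → ℂ) ((2 * Real.pi)⁻¹ • ξ) := rfl
  rw [this, Real.fourier_eq']
  refine integral_congr_ae (.of_forall fun x => ?_)
  simp only [smul_eq_mul, inner_smul_right]
  rw [mul_comm]
  congr 2
  have : (Real.pi : ℂ) ≠ 0 := by exact_mod_cast Real.pi_ne_zero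
  push_cast
  field_simp

/-- The Fourier transform on tempered distributions, `⟨T̂, φ⟩ = ⟨T, φ̂⟩`. -/
def fourierD (T : 𝓢'(E n, ℂ)) : 𝓢'(E n, ℂ) := PointwiseConvergenceCLM.precomp ℂ fourierS T

theorem fourierD_apply (T : 𝓢'(E n, ℂ)) (φ : 𝓢(E n, ℂ)) : fourierD T φ = T (fourierS φ) := rfl

/-! ### Homogeneous distributions -/

/-- The restriction of the tempered distribution `T` to `ℝⁿ ∖ {0}` is the function `u`. -/
def AgreesOffZero (T : 𝓢'(E n, ℂ)) (u : E n → ℂ) : Prop :=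
  ∀ φ : 𝓢(E n, ℂ), HasCompactSupport φ → (0 : E n) ∉ tsupport φ → T φ = ∫ x, u x * φ x

/-- `T` is a homogeneous distribution on `ℝⁿ` of degree `s`. -/
def IsHomogDist (s : ℝ) (T : 𝓢'(E n, ℂ)) : Prop :=
  ∀ (t : ℝ) (ht : 0 < t), dil t ht T = ((t ^ s : ℝ) : ℂ) • T

/-- `T` is a prolongation to `ℝⁿ` of the function `u` on `ℝⁿ ∖ {0}`, homogeneous of degree `s`.
Its homogeneity on `ℝⁿ` may fail only by terms `P(D) δ₀` with `P` a homogeneous polynomial of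
degree `-n-s`: so `T` is homogeneous if `-n-s` is not a nonnegative integer, while for
`s = -n-k` logarithmic terms `t ^ s log t P(D) δ₀` may appear in `T(t ·) - t ^ s T`. -/
structure IsProlongation (s : ℝ) (u : E n → ℂ) (T : 𝓢'(E n, ℂ)) : Prop where
  agrees : AgreesOffZero T u
  homog : ∀ (t : ℝ) (ht : 0 < t), ∃ P : MvPolynomial (Fin n) ℂ,
    IsHomogPoly (-(n : ℝ) - s) P ∧ dil t ht T - ((t ^ s : ℝ) : ℂ) • T = polyDelta P

/-- The space `ℋ_s` of all distributions `U̇ + Q log |·| + P(D) δ₀` where `U̇` is a prolongation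
of a function `U ∈ C^∞(ℝⁿ ∖ {0})` homogeneous of degree `s`, and `Q`, `P` are homogeneous
polynomials of degrees `s` and `-n-s`, respectively. -/
def homogSpace (n : ℕ) (s : ℝ) : Set 𝓢'(E n, ℂ) :=
  {T | ∃ (U : E n → ℂ) (V : 𝓢'(E n, ℂ)) (Q P : MvPolynomial (Fin n) ℂ),
    SmoothOffZero U ∧ IsHomogFun s U ∧ IsProlongation s U V ∧
    IsHomogPoly s Q ∧ IsHomogPoly (-(n : ℝ) - s) P ∧ T = V + polyLog Q + polyDelta P}

/-- `χ ℋ_s + 𝒮 = {χ u + g : u ∈ ℋ_s, g ∈ 𝒮}`. -/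
def mulHomogSpace (n : ℕ) (χ : E n → ℝ) (s : ℝ) : Set 𝓢'(E n, ℂ) :=
  {T | ∃ u ∈ homogSpace n s, ∃ g : 𝓢(E n, ℂ), T = mulDist χ u + ofSchwartz g}

/-- `∫_{S^{n-1}} (-i x·ξ)^k u(x) / k! dx` with respect to the surface measure. -/
def sphereInt (k : ℕ) (u : E n → ℂ) (ξ : E n) : ℂ :=
  ∫ x : Metric.sphere (0 : E n) 1,
    (-Complex.I * (inner ℝ (x : E n) ξ : ℝ)) ^ k * u x / (k.factorial : ℂ)
    ∂(volume : Measure (E n)).toSphere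

end HomogDistr

end

open HomogDistr

/-! The space ℋ_s is characterised by its behaviour under dilations: it consists of the tempered
distributions T that are smooth off the origin and satisfy T(t ·) = t^s (T + log t (Q + P(D)δ₀)) for
all t > 0, with fixed homogeneous polynomials Q, P of degrees s and -n-s (`IsLogHomogDist`,
`mem_homogSpace_iff`). The Fourier transform turns dilation by t into dilation by 1/t and exchanges
polynomials with derivatives of δ₀, so it carries this law for s into the law for -n-s; as log (1/t)
= -log t, the new polynomial part is -P. Only smoothness of T̂ off the origin is not formal
(`IsLogHomogDist.exists_fourierD`).

For that smoothness, T is split into χT + θT. Off the origin T is a function w with w(tx) = t^s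
(w(x) + log t q(x)), and writing θ(x) as the integral over (0, 1) of the derivative of θ(λx)
exhibits θw as a superposition ∫ κ(λ) f(λx) dλ of dilates of test functions f vanishing near 0
(`IsPatch.mul_eq_integral`). Its Fourier transform is ∫ κ(λ) λ⁻ⁿ f̂(ξ/λ) dλ, and the rapid decay of
f̂ beats the singularity of κ at λ = 0: off the origin this is smooth and rapidly decreasing with
all derivatives (`IsPatch.exists_fourierD_eq`). The compactly supported part χT has a smooth Fourier
transform everywhere (`IsLogHomogDist.hasSmoothLocalFourier`), since T is built from locally
integrable functions by differentiation, up to a distribution supported at 0.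

Prolongations exist by Euler's relation div(xu) = (n+s)u, which reduces degree s to degree s+1 until
the function is locally integrable; at s = -n the factor vanishes and div(x u log|x|) = u is used
instead (`exists_isProlongation`). The homogeneity defect is found by testing it on
χ(x)(-ix·ξ)^k/k!: in polar coordinates a Frullani integral produces log t times the spherical
integral (`IsProlongation.polyEval_eq`). Adding Q log|·| to the Fourier transform of a prolongation
therefore removes its defect, which gives U.

Finally, the Fourier transform of θT differs from χT̂ by a Schwartz function
(`IsLogHomogDist.exists_fourierD_mulDist_eq`). Together with the invariance of the spaces ℋ and the
fact that the fourth power of the Fourier transform is a nonzero scalar, this gives the bijection.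
-/

noncomputable section

namespace HomogDistr

variable {n : ℕ}

/-! ### Multipliers -/

/-- Multiplication of a Schwartz function by a function of temperate growth. -/
abbrev mulS (g : E n → ℂ) : 𝓢(E n, ℂ) →L[ℂ] 𝓢(E n, ℂ) := SchwartzMap.smulLeftCLM ℂ g

theorem mulS_apply {g : E n → ℂ} (hg : g.HasTemperateGrowth) (φ : 𝓢(E n, ℂ)) (x : E n) :
    mulS g φ x = g x * φ x := by
  simp [smulLeftCLM_apply_apply hg]

theorem hasTemperateGrowth_coord (j : Fin n) :
    (fun x : E n => (x j : ℂ)).HasTemperateGrowth := by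
  have : (fun x : E n => (x j : ℂ)) =
      (Complex.ofRealCLM.comp (EuclideanSpace.proj (𝕜 := ℝ) j : E n →L[ℝ] ℝ)) := by
    ext x; simp
  rw [this]
  exact ContinuousLinearMap.hasTemperateGrowth _

theorem hasTemperateGrowth_polyEval (Q : MvPolynomial (Fin n) ℂ) :
    (polyEval Q).HasTemperateGrowth := by
  induction Q using MvPolynomial.induction_on with
  | C a =>
    have : (polyEval (MvPolynomial.C a) : E n → ℂ) = fun _ => a := by ext; simp [polyEval]
    rw [this]; exact Function.HasTemperateGrowth.const a
  | add p q hp hq =>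
    have : (polyEval (p + q) : E n → ℂ) = polyEval p + polyEval q := by ext; simp [polyEval]
    rw [this]; exact hp.add hq
  | mul_X p i hp =>
    have : (polyEval (p * MvPolynomial.X i) : E n → ℂ) = polyEval p * fun x => (x i : ℂ) := by
      ext; simp [polyEval]
    rw [this]; exact hp.mul (hasTemperateGrowth_coord i)

theorem IsCutoff.ofReal_smooth {χ : E n → ℝ} (hχ : IsCutoff χ) :
    ContDiff ℝ ∞ (fun x => (χ x : ℂ)) :=
  Complex.ofRealCLM.contDiff.comp hχ.smooth

theorem IsCutoff.ofReal_compact {χ : E n → ℝ} (hχ : IsCutoff χ) :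
    HasCompactSupport (fun x => (χ x : ℂ)) :=
  hχ.compact.comp_left (g := fun r : ℝ => (r : ℂ)) Complex.ofReal_zero

theorem IsCutoff.temperate {χ : E n → ℝ} (hχ : IsCutoff χ) :
    (fun x => (χ x : ℂ)).HasTemperateGrowth :=
  hχ.ofReal_compact.hasTemperateGrowth hχ.ofReal_smooth

theorem IsPatch.temperate {θ : E n → ℝ} (hθ : IsPatch θ) :
    (fun x => (θ x : ℂ)).HasTemperateGrowth := by
  obtain ⟨χ, hχ, h⟩ := hθ
  have : (fun x => (θ x : ℂ)) = (fun _ => (1 : ℂ)) - fun x => (χ x : ℂ) := by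
    ext x; simp [h]
  rw [this]
  exact (Function.HasTemperateGrowth.const _).sub hχ.temperate

theorem mulDist_apply (χ : E n → ℝ) (T : 𝓢'(E n, ℂ)) (φ : 𝓢(E n, ℂ)) :
    mulDist χ T φ = T (mulS (fun x => (χ x : ℂ)) φ) := rfl

theorem polyLog_apply (Q : MvPolynomial (Fin n) ℂ) (φ : 𝓢(E n, ℂ)) :
    polyLog Q φ = ∫ x : E n, (polyEval Q x * Real.log ‖x‖) * φ x := by
  change logDist (mulS (polyEval Q) φ) = _
  rw [logDist, ofFun_apply]
  refine integral_congr_ae (.of_forall fun x => ?_)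
  simp only [mulS_apply (hasTemperateGrowth_polyEval Q)]
  ring

theorem dist_add_apply (S T : 𝓢'(E n, ℂ)) (φ : 𝓢(E n, ℂ)) : (S + T) φ = S φ + T φ := rfl
theorem dist_sub_apply (S T : 𝓢'(E n, ℂ)) (φ : 𝓢(E n, ℂ)) : (S - T) φ = S φ - T φ := rfl
theorem dist_smul_apply (c : ℂ) (T : 𝓢'(E n, ℂ)) (φ : 𝓢(E n, ℂ)) : (c • T) φ = c * T φ := rfl
theorem dist_zero_apply (φ : 𝓢(E n, ℂ)) : (0 : 𝓢'(E n, ℂ)) φ = 0 := rfl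

theorem dist_sum_apply {ι : Type*} (s : Finset ι) (T : ι → 𝓢'(E n, ℂ)) (φ : 𝓢(E n, ℂ)) :
    (∑ i ∈ s, T i) φ = ∑ i ∈ s, T i φ := by
  classical
  induction s using Finset.induction_on with
  | empty => simp
  | insert a s ha ih => simp [Finset.sum_insert ha, ih]

theorem dist_ext {S T : 𝓢'(E n, ℂ)} (h : ∀ φ, S φ = T φ) : S = T := by
  ext φ; exact h φ

theorem mulDist_add (χ : E n → ℝ) (S T : 𝓢'(E n, ℂ)) :
    mulDist χ (S + T) = mulDist χ S + mulDist χ T := map_add _ _ _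
theorem mulDist_smul (χ : E n → ℝ) (c : ℂ) (T : 𝓢'(E n, ℂ)) :
    mulDist χ (c • T) = c • mulDist χ T := map_smul _ _ _

/-! ### Dilations and the Fourier transform -/

theorem fourierD_add (S T : 𝓢'(E n, ℂ)) : fourierD (S + T) = fourierD S + fourierD T := rfl
theorem fourierD_smul (c : ℂ) (T : 𝓢'(E n, ℂ)) : fourierD (c • T) = c • fourierD T := rfl
theorem fourierD_zero : fourierD (0 : 𝓢'(E n, ℂ)) = 0 := rfl

theorem fourierD_sum {ι : Type*} (s : Finset ι) (T : ι → 𝓢'(E n, ℂ)) :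
    fourierD (∑ i ∈ s, T i) = ∑ i ∈ s, fourierD (T i) := by
  refine dist_ext fun φ => ?_
  simp only [fourierD_apply, dist_sum_apply]

theorem dil_add (t : ℝ) (ht : 0 < t) (S T : 𝓢'(E n, ℂ)) :
    dil t ht (S + T) = dil t ht S + dil t ht T := by
  refine dist_ext fun φ => ?_
  simp only [dil_apply, dist_add_apply, mul_add]

theorem dil_sub (t : ℝ) (ht : 0 < t) (S T : 𝓢'(E n, ℂ)) :
    dil t ht (S - T) = dil t ht S - dil t ht T := by
  refine dist_ext fun φ => ?_
  simp only [dil_apply, dist_sub_apply, mul_sub]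

theorem dil_smul (t : ℝ) (ht : 0 < t) (c : ℂ) (T : 𝓢'(E n, ℂ)) :
    dil t ht (c • T) = c • dil t ht T := by
  refine dist_ext fun φ => ?_
  simp only [dil_apply, dist_smul_apply]; ring

theorem dil_sum {ι : Type*} (t : ℝ) (ht : 0 < t) (s : Finset ι) (T : ι → 𝓢'(E n, ℂ)) :
    dil t ht (∑ i ∈ s, T i) = ∑ i ∈ s, dil t ht (T i) := by
  refine dist_ext fun φ => ?_
  simp only [dil_apply, dist_sum_apply, Finset.mul_sum]

theorem integral_comp_smul_E {F : Type*} [NormedAddCommGroup F] [NormedSpace ℝ F] (f : E n → F)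
    {t : ℝ} (ht : 0 < t) : ∫ x, f (t • x) = (t ^ n)⁻¹ • ∫ x, f x := by
  rw [Measure.integral_comp_smul]
  simp [abs_of_pos ht]

theorem fourierS_eq (φ : 𝓢(E n, ℂ)) (ξ : E n) :
    fourierS φ ξ = 𝓕 φ ((2 * Real.pi)⁻¹ • ξ) := rfl

theorem fourierS_dilS (t : ℝ) (ht : 0 < t) (φ : 𝓢(E n, ℂ)) :
    fourierS (dilS t ht.ne' φ) =
      ((t ^ n : ℝ) : ℂ)⁻¹ • dilS t⁻¹ (inv_ne_zero ht.ne') (fourierS φ) := by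
  ext ξ
  rw [smul_apply, dilS_apply, fourierS_apply, fourierS_apply]
  have h := integral_comp_smul_E
    (fun x => φ x * Complex.exp (-Complex.I * (inner ℝ x (t⁻¹ • ξ) : ℝ))) ht
  simp only [inner_smul_left, inner_smul_right] at h ⊢
  rw [smul_eq_mul, ← Complex.ofReal_inv]
  rw [Complex.real_smul] at h
  rw [← h]
  refine integral_congr_ae (.of_forall fun x => ?_)
  simp [dilS_apply, ht.ne']

/-- Fourier inversion in the present normalisation: the scaling by (2π)⁻¹ inside `fourierS` is
commuted past the second transform by `fourierS_dilS`, which produces the factor (2π)ⁿ. -/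
theorem fourierS_fourierS (φ : 𝓢(E n, ℂ)) :
    fourierS (fourierS φ) =
      (((2 * Real.pi) ^ n : ℝ) : ℂ) • dilS (-1) (by norm_num) φ := by
  ext ξ
  have hpi : 0 < (2 * Real.pi)⁻¹ := by positivity
  have h := congrArg (fun f => f ξ) (fourierS_dilS _ hpi (𝓕 φ))
  have h0 : fourierS φ = dilS (2 * Real.pi)⁻¹ hpi.ne' (𝓕 φ) := rfl
  rw [h0]
  refine h.trans ?_
  simp only [smul_apply, dilS_apply, fourierS_eq, inv_pow, smul_eq_mul, inv_inv,
    Complex.ofReal_inv]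
  rw [smul_smul, inv_mul_cancel₀ (by positivity), one_smul]
  congr 1
  have h1 : (𝓕⁻ (𝓕 φ) : 𝓢(E n, ℂ)) (-ξ) = φ (-ξ) := by simp
  rw [SchwartzMap.fourierInv_apply_eq] at h1
  simpa using h1

theorem dilS_dilS (a b : ℝ) (ha : a ≠ 0) (hb : b ≠ 0) (φ : 𝓢(E n, ℂ)) :
    dilS a ha (dilS b hb φ) = dilS (b * a) (mul_ne_zero hb ha) φ := by
  ext x; simp [dilS_apply, smul_smul]

theorem fourierD_fourierD_apply (T : 𝓢'(E n, ℂ)) (φ : 𝓢(E n, ℂ)) :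
    fourierD (fourierD T) φ =
      (((2 * Real.pi) ^ n : ℝ) : ℂ) * T (dilS (-1) (by norm_num) φ) := by
  rw [fourierD_apply, fourierD_apply, fourierS_fourierS, map_smul, smul_eq_mul]

theorem fourierD_four (T : 𝓢'(E n, ℂ)) :
    fourierD (fourierD (fourierD (fourierD T))) =
      ((((2 * Real.pi) ^ n : ℝ) : ℂ) ^ 2) • T := by
  refine dist_ext fun φ => ?_
  rw [fourierD_fourierD_apply, fourierD_fourierD_apply, dilS_dilS, dist_smul_apply, sq, mul_assoc]
  congr 3
  ext x; simp [dilS_apply]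

theorem two_pi_pow_ne_zero : (((2 * Real.pi) ^ n : ℝ) : ℂ) ≠ 0 := by
  have : (2 * Real.pi) ^ n ≠ 0 := by positivity
  exact_mod_cast this

theorem fourierD_injective : Function.Injective (fourierD : 𝓢'(E n, ℂ) → 𝓢'(E n, ℂ)) := by
  intro S T h
  have h4 := fourierD_four S
  rw [h, fourierD_four] at h4
  exact (smul_right_injective _ (pow_ne_zero 2 two_pi_pow_ne_zero) h4).symm

theorem integral_fourierS_mul (f g : 𝓢(E n, ℂ)) :
    ∫ x, fourierS f x * g x = ∫ x, f x * fourierS g x := by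
  have hpi : 0 < (2 * Real.pi)⁻¹ := by positivity
  have h1 : (𝓕 (dilS (2 * Real.pi) (by positivity) g) : 𝓢(E n, ℂ)) =
      (((2 * Real.pi) ^ n : ℝ) : ℂ)⁻¹ • fourierS g := by
    have h2 : (𝓕 (dilS (2 * Real.pi) (by positivity) g) : 𝓢(E n, ℂ)) =
      dilS (2 * Real.pi) (by positivity) (fourierS (dilS (2 * Real.pi) (by positivity) g)) := by
      ext ξ
      rw [dilS_apply, fourierS_eq, smul_smul, inv_mul_cancel₀ (by positivity), one_smul]
    rw [h2, fourierS_dilS _ (by positivity), map_smul, dilS_dilS]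
    congr 1
    ext x
    rw [dilS_apply, inv_mul_cancel₀ (by positivity), one_smul]
  have h3 := SchwartzMap.integral_fourier_mul_eq f (dilS (2 * Real.pi) (by positivity) g)
  rw [h1] at h3
  have h4 := integral_comp_smul_E
    (fun x => (𝓕 f : 𝓢(E n, ℂ)) x * (dilS (2 * Real.pi) (by positivity) g) x) hpi
  rw [h3] at h4
  have h5 : ∫ x, fourierS f x * g x = ∫ x : E n, (𝓕 f : 𝓢(E n, ℂ)) ((2 * Real.pi)⁻¹ • x) *
      (dilS (2 * Real.pi) (by positivity) g) ((2 * Real.pi)⁻¹ • x) := by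
    refine integral_congr_ae (.of_forall fun x => ?_)
    simp only [dilS_apply, fourierS_eq, smul_smul]
    rw [mul_inv_cancel₀ (by positivity), one_smul]
  rw [h5, h4]
  simp only [smul_apply, smul_eq_mul, mul_left_comm _ (((2 * Real.pi) ^ n : ℝ) : ℂ)⁻¹]
  rw [integral_const_mul, Complex.real_smul, ← mul_assoc]
  have : (((2 * Real.pi)⁻¹ ^ n)⁻¹ : ℝ) = (2 * Real.pi) ^ n := by rw [inv_pow, inv_inv]
  rw [this, mul_inv_cancel₀ two_pi_pow_ne_zero, one_mul]

theorem fourierD_ofSchwartz (g : 𝓢(E n, ℂ)) :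
    fourierD (ofSchwartz g) = ofSchwartz (fourierS g) := by
  refine dist_ext fun φ => ?_
  rw [fourierD_apply, ofSchwartz_apply, ofSchwartz_apply, integral_fourierS_mul]

theorem dil_fourierD (t : ℝ) (ht : 0 < t) (T : 𝓢'(E n, ℂ)) :
    dil t ht (fourierD T) = ((t ^ n : ℝ) : ℂ)⁻¹ • fourierD (dil t⁻¹ (inv_pos.2 ht) T) := by
  refine dist_ext fun φ => ?_
  rw [dist_smul_apply, dil_apply, fourierD_apply, fourierD_apply, dil_apply]
  have h := fourierS_dilS t⁻¹ (inv_pos.2 ht) φ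
  rw [h, map_smul, smul_eq_mul]

/-! ### Derivatives -/

theorem dOp_apply (j : Fin n) (T : 𝓢'(E n, ℂ)) (φ : 𝓢(E n, ℂ)) :
    dOp j T φ = Complex.I * T (∂_{(EuclideanSpace.single j (1 : ℝ) : E n)} φ) := by
  rw [dOp, dist_smul_apply, TemperedDistribution.lineDerivOp_apply_apply]
  simp

theorem lineDerivOp_fourierS (j : Fin n) (φ : 𝓢(E n, ℂ)) :
    ∂_{(EuclideanSpace.single j (1 : ℝ) : E n)} (fourierS φ) =
      (-Complex.I) • fourierS (mulS (fun x => (x j : ℂ)) φ) := by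
  ext ξ
  have h1 : ∂_{(EuclideanSpace.single j (1 : ℝ) : E n)} (fourierS φ) ξ =
      (2 * Real.pi : ℂ)⁻¹ * (∂_{(EuclideanSpace.single j (1 : ℝ) : E n)} (𝓕 φ))
        ((2 * Real.pi)⁻¹ • ξ) := by
    rw [lineDerivOp_apply_eq_fderiv, lineDerivOp_apply_eq_fderiv]
    have : (fourierS φ : E n → ℂ) = fun x => (𝓕 φ : 𝓢(E n, ℂ)) ((2 * Real.pi)⁻¹ • x) := rfl
    rw [this, fderiv_comp_smul]
    simp
  rw [h1, SchwartzMap.lineDerivOp_fourier_eq, smul_apply, fourierS_eq, FourierTransform.fourier_smul,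
    smul_apply]
  have h2 : smulLeftCLM ℂ (fun x : E n => inner ℝ x (EuclideanSpace.single j (1 : ℝ))) φ =
      mulS (fun x => (x j : ℂ)) φ := by
    ext x
    rw [mulS_apply (hasTemperateGrowth_coord j), smulLeftCLM_apply_apply (by fun_prop)]
    simp [EuclideanSpace.inner_single_right]
  rw [h2]
  have : (Real.pi : ℂ) ≠ 0 := by exact_mod_cast Real.pi_ne_zero
  simp only [smul_eq_mul]
  field_simp

theorem fourierD_dOp (j : Fin n) (T : 𝓢'(E n, ℂ)) (φ : 𝓢(E n, ℂ)) :
    fourierD (dOp j T) φ = fourierD T (mulS (fun x => (x j : ℂ)) φ) := by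
  rw [fourierD_apply, dOp_apply, lineDerivOp_fourierS, map_smul, fourierD_apply, smul_eq_mul,
    ← mul_assoc]
  simp

theorem fourierD_delta (φ : 𝓢(E n, ℂ)) :
    fourierD (TemperedDistribution.delta (0 : E n)) φ = ∫ x, φ x := by
  rw [fourierD_apply, TemperedDistribution.delta_apply, fourierS_apply]
  simp

/-- A tempered distribution whose Fourier transform is multiplication by the polynomial `Q`. -/
theorem fourierD_dOp_iterate (j : Fin n) (m : ℕ) {T : 𝓢'(E n, ℂ)} {q : E n → ℂ}
    (hT : ∀ φ, fourierD T φ = ∫ x, q x * φ x) (φ : 𝓢(E n, ℂ)) :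
    fourierD ((dOp j)^[m] T) φ = ∫ x, ((x j : ℂ) ^ m * q x) * φ x := by
  induction m generalizing φ with
  | zero => simp [hT]
  | succ m ih =>
    rw [Function.iterate_succ_apply', fourierD_dOp, ih]
    refine integral_congr_ae (.of_forall fun x => ?_)
    simp only [mulS_apply (hasTemperateGrowth_coord j)]
    ring

theorem fourierD_dPow_delta (α : Fin n →₀ ℕ) (φ : 𝓢(E n, ℂ)) :
    fourierD (dPow α (TemperedDistribution.delta (0 : E n))) φ =
      ∫ x, (∏ i, (x i : ℂ) ^ α i) * φ x := by
  have key : ∀ (l : List (Fin n)) (φ : 𝓢(E n, ℂ)),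
      fourierD (l.foldr (fun j S => (dOp j)^[α j] S) (TemperedDistribution.delta (0 : E n))) φ =
        ∫ x, (l.map fun i => (x i : ℂ) ^ α i).prod * φ x := by
    intro l
    induction l with
    | nil => intro φ; simp [fourierD_delta]
    | cons j l ih =>
      intro φ
      rw [List.foldr_cons, fourierD_dOp_iterate j _ ih]
      simp
  rw [dPow, key]
  simp only [List.prod_ofFn, ← List.ofFn_eq_map]

theorem integrable_polyEval_mul (Q : MvPolynomial (Fin n) ℂ) (φ : 𝓢(E n, ℂ)) :
    Integrable (fun x => polyEval Q x * φ x) := by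
  refine (mulS (polyEval Q) φ).integrable.congr (.of_forall fun x => ?_)
  simp [mulS_apply (hasTemperateGrowth_polyEval Q)]

/-- Each D_j becomes multiplication by x_j, and the transform of δ₀ is 1. As `fourierD` is
injective, identities among the distributions P(D)δ₀ can be checked as identities of polynomials. -/
theorem fourierD_polyDelta (P : MvPolynomial (Fin n) ℂ) (φ : 𝓢(E n, ℂ)) :
    fourierD (polyDelta P) φ = ∫ x, polyEval P x * φ x := by
  have hmon : ∀ α : Fin n →₀ ℕ, ∀ x : E n,
      polyEval (MvPolynomial.monomial α 1) x = ∏ i, (x i : ℂ) ^ α i := by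
    intro α x; simp [polyEval, MvPolynomial.eval_monomial, Finsupp.prod_fintype]
  rw [polyDelta, fourierD_sum, dist_sum_apply]
  simp only [fourierD_smul, dist_smul_apply, fourierD_dPow_delta, ← hmon]
  simp only [← integral_const_mul]
  rw [← integral_finsetSum _ fun α _ => (integrable_polyEval_mul _ φ).const_mul _]
  refine integral_congr_ae (.of_forall fun x => ?_)
  simp only [← mul_assoc, ← Finset.sum_mul]
  congr 1
  rw [polyEval, MvPolynomial.eval_eq']
  refine Finset.sum_congr rfl fun α _ => ?_
  rw [hmon]

/-- The tempered distribution given by the polynomial `Q`. -/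
def polyDist (Q : MvPolynomial (Fin n) ℂ) : 𝓢'(E n, ℂ) := fourierD (polyDelta Q)

theorem polyDist_apply (Q : MvPolynomial (Fin n) ℂ) (φ : 𝓢(E n, ℂ)) :
    polyDist Q φ = ∫ x, polyEval Q x * φ x := fourierD_polyDelta Q φ

theorem polyDelta_congr {P Q : MvPolynomial (Fin n) ℂ} (h : ∀ x : E n, polyEval P x = polyEval Q x) :
    polyDelta P = polyDelta Q := by
  refine fourierD_injective (dist_ext fun φ => ?_)
  simp only [fourierD_polyDelta, h]

theorem polyDelta_zero : polyDelta (0 : MvPolynomial (Fin n) ℂ) = 0 := by simp [polyDelta]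

theorem polyDelta_add (P Q : MvPolynomial (Fin n) ℂ) :
    polyDelta (P + Q) = polyDelta P + polyDelta Q := by
  refine fourierD_injective (dist_ext fun φ => ?_)
  rw [fourierD_add, dist_add_apply]
  simp only [fourierD_polyDelta]
  rw [← integral_add (integrable_polyEval_mul _ _) (integrable_polyEval_mul _ _)]
  simp [polyEval, add_mul]

theorem polyDelta_smul (c : ℂ) (P : MvPolynomial (Fin n) ℂ) :
    polyDelta (c • P) = c • polyDelta P := by
  refine fourierD_injective (dist_ext fun φ => ?_)
  rw [fourierD_smul, dist_smul_apply]
  simp only [fourierD_polyDelta]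
  rw [← integral_const_mul]
  simp [polyEval, mul_assoc]

theorem polyDelta_sum {ι : Type*} (s : Finset ι) (P : ι → MvPolynomial (Fin n) ℂ) :
    polyDelta (∑ i ∈ s, P i) = ∑ i ∈ s, polyDelta (P i) := by
  classical
  induction s using Finset.induction_on with
  | empty => simp [polyDelta_zero]
  | insert a s ha ih => simp [Finset.sum_insert ha, polyDelta_add, ih]

theorem dOp_polyDelta (j : Fin n) (P : MvPolynomial (Fin n) ℂ) :
    dOp j (polyDelta P) = polyDelta (MvPolynomial.X j * P) := by
  refine fourierD_injective (dist_ext fun φ => ?_)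
  rw [fourierD_dOp]
  simp only [fourierD_polyDelta]
  refine integral_congr_ae (.of_forall fun x => ?_)
  simp only [mulS_apply (hasTemperateGrowth_coord j)]
  simp [polyEval]
  ring

theorem polyDist_add (P Q : MvPolynomial (Fin n) ℂ) :
    polyDist (P + Q) = polyDist P + polyDist Q := by
  rw [polyDist, polyDelta_add, fourierD_add]; rfl

theorem polyDist_smul (c : ℂ) (P : MvPolynomial (Fin n) ℂ) :
    polyDist (c • P) = c • polyDist P := by
  rw [polyDist, polyDelta_smul, fourierD_smul]; rfl

/-! ### Homogeneous polynomials -/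

theorem IsHomogPoly.zero (s : ℝ) : IsHomogPoly s (0 : MvPolynomial (Fin n) ℂ) := by
  intro α h; simp at h

theorem IsHomogPoly.add {s : ℝ} {P Q : MvPolynomial (Fin n) ℂ} (hP : IsHomogPoly s P)
    (hQ : IsHomogPoly s Q) : IsHomogPoly s (P + Q) := by
  intro α h
  by_cases hp : P.coeff α = 0
  · exact hQ α fun hq => h (by simp [hp, hq])
  · exact hP α hp

theorem IsHomogPoly.smul {s : ℝ} {P : MvPolynomial (Fin n) ℂ} (hP : IsHomogPoly s P) (c : ℂ) :
    IsHomogPoly s (c • P) := by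
  intro α h
  exact hP α fun hp => h (by simp [hp])

theorem IsHomogPoly.sum {ι : Type*} {s : ℝ} (t : Finset ι) {P : ι → MvPolynomial (Fin n) ℂ}
    (hP : ∀ i ∈ t, IsHomogPoly s (P i)) : IsHomogPoly s (∑ i ∈ t, P i) := by
  classical
  induction t using Finset.induction_on with
  | empty => simpa using IsHomogPoly.zero s
  | insert a t ha ih =>
    rw [Finset.sum_insert ha]
    exact (hP a (by simp)).add (ih fun i hi => hP i (by simp [hi]))

theorem IsHomogPoly.X_mul {s : ℝ} {P : MvPolynomial (Fin n) ℂ} (hP : IsHomogPoly s P)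
    (j : Fin n) : IsHomogPoly (s + 1) (MvPolynomial.X j * P) := by
  intro α h
  rw [MvPolynomial.coeff_X_mul'] at h
  split_ifs at h with hj
  · have h1 := hP _ h
    have h2 : α = α - Finsupp.single j 1 + Finsupp.single j 1 := by
      refine (tsub_add_cancel_of_le ?_).symm
      rw [Finsupp.single_le_iff]
      exact Nat.one_le_iff_ne_zero.2 (Finsupp.mem_support_iff.1 hj)
    rw [h2, map_add, Finsupp.degree_single]
    push_cast
    rw [h1]
  · exact absurd rfl h

theorem IsHomogPoly.C (c : ℂ) : IsHomogPoly 0 (MvPolynomial.C c : MvPolynomial (Fin n) ℂ) := by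
  classical
  intro α h
  rw [MvPolynomial.coeff_C] at h
  split_ifs at h with hj
  · simp [← hj]
  · exact absurd rfl h

theorem polyDelta_C (c : ℂ) : polyDelta (MvPolynomial.C c : MvPolynomial (Fin n) ℂ) =
    c • TemperedDistribution.delta (0 : E n) := by
  refine fourierD_injective (dist_ext fun φ => ?_)
  rw [fourierD_smul, dist_smul_apply, fourierD_polyDelta, fourierD_delta, ← integral_const_mul]
  simp [polyEval]

theorem IsHomogPoly.eq_zero {s : ℝ} {P : MvPolynomial (Fin n) ℂ} (hP : IsHomogPoly s P)
    (hs : ∀ k : ℕ, (k : ℝ) ≠ s) : P = 0 := by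
  ext α
  by_contra h
  exact hs _ (hP α h)

/-- No sign condition on t is needed: on every monomial that occurs, s is a natural number and the
real power is an ordinary one. -/
theorem IsHomogPoly.polyEval_smul {s : ℝ} {P : MvPolynomial (Fin n) ℂ} (hP : IsHomogPoly s P)
    (t : ℝ) (x : E n) :
    polyEval P (t • x) = ((t ^ s : ℝ) : ℂ) * polyEval P x := by
  rw [polyEval, polyEval, MvPolynomial.eval_eq', MvPolynomial.eval_eq', Finset.mul_sum]
  refine Finset.sum_congr rfl fun α hα => ?_
  have h := hP α (MvPolynomial.mem_support_iff.1 hα)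
  rw [← h, Real.rpow_natCast]
  simp only [PiLp.smul_apply, smul_eq_mul, Complex.ofReal_mul, mul_pow, Finset.prod_mul_distrib,
    Finset.prod_pow_eq_pow_sum]
  rw [Finsupp.degree_eq_sum]
  push_cast
  ring

theorem IsHomogPoly.polyEval_neg {k : ℕ} {P : MvPolynomial (Fin n) ℂ} (hP : IsHomogPoly k P)
    (x : E n) : polyEval P (-x) = (-1) ^ k * polyEval P x := by
  rw [polyEval, polyEval, MvPolynomial.eval_eq', MvPolynomial.eval_eq', Finset.mul_sum]
  refine Finset.sum_congr rfl fun α hα => ?_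
  have h : α.degree = k := by exact_mod_cast hP α (MvPolynomial.mem_support_iff.1 hα)
  rw [← h, Finsupp.degree_eq_sum]
  have : ∀ i, ((-x : E n) i : ℂ) ^ α i = (-1) ^ α i * (x i : ℂ) ^ α i := by
    intro i; rw [← mul_pow]; simp
  simp only [this, Finset.prod_mul_distrib, Finset.prod_pow_eq_pow_sum]
  ring

theorem dil_polyDist {s : ℝ} {Q : MvPolynomial (Fin n) ℂ} (hQ : IsHomogPoly s Q) (t : ℝ)
    (ht : 0 < t) : dil t ht (polyDist Q) = ((t ^ s : ℝ) : ℂ) • polyDist Q := by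
  refine dist_ext fun φ => ?_
  rw [dil_apply, dist_smul_apply, polyDist_apply, polyDist_apply]
  have h := integral_comp_smul_E
    (fun x => polyEval Q x * dilS t⁻¹ (inv_ne_zero ht.ne') φ x) ht
  rw [Complex.real_smul, Complex.ofReal_inv] at h
  rw [← h, ← integral_const_mul]
  refine integral_congr_ae (.of_forall fun x => ?_)
  simp only [dilS_apply, hQ.polyEval_smul t, smul_smul, inv_mul_cancel₀ ht.ne', one_smul]
  ring

theorem rpow_neg_sub_mul {t : ℝ} (ht : 0 < t) (s : ℝ) :
    ((t ^ n : ℝ) : ℂ)⁻¹ * (((t⁻¹) ^ s : ℝ) : ℂ) = ((t ^ (-(n : ℝ) - s) : ℝ) : ℂ) := by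
  rw [Real.inv_rpow ht.le, ← Real.rpow_neg ht.le, ← Complex.ofReal_inv, ← Real.rpow_natCast,
    ← Real.rpow_neg ht.le, ← Complex.ofReal_mul, ← Real.rpow_add ht]
  rfl

/-- Transported from `dil_polyDist` by the Fourier transform, which replaces t by 1/t and
contributes the factor tⁿ. -/
theorem dil_polyDelta {s : ℝ} {P : MvPolynomial (Fin n) ℂ} (hP : IsHomogPoly (-(n : ℝ) - s) P)
    (t : ℝ) (ht : 0 < t) : dil t ht (polyDelta P) = ((t ^ s : ℝ) : ℂ) • polyDelta P := by
  refine fourierD_injective ?_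
  have h := dil_fourierD t⁻¹ (inv_pos.2 ht) (polyDelta P)
  have h1 := dil_polyDist hP t⁻¹ (inv_pos.2 ht)
  rw [polyDist, h] at h1
  simp only [inv_inv] at h1
  rw [fourierD_smul]
  have hne : ((t⁻¹ ^ n : ℝ) : ℂ) ≠ 0 := by
    have : t⁻¹ ^ n ≠ 0 := by positivity
    exact_mod_cast this
  have h2 : ∀ c : ℂ, ((t⁻¹ ^ n : ℝ) : ℂ)⁻¹ • fourierD (dil t ht (polyDelta P)) =
      c • fourierD (polyDelta P) → fourierD (dil t ht (polyDelta P)) =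
      (((t⁻¹ ^ n : ℝ) : ℂ) * c) • fourierD (polyDelta P) := by
    intro c hc
    rw [← smul_smul, ← hc, smul_smul, mul_inv_cancel₀ hne, one_smul]
  rw [h2 _ h1]
  congr 1
  rw [← Complex.ofReal_mul, ← Real.rpow_natCast, ← Real.rpow_add (inv_pos.2 ht),
    Real.inv_rpow ht.le, ← Real.rpow_neg ht.le]
  congr 2
  ring

/-- Both sides have the same Fourier transform: applying the transform twice is reflection up to
(2π)ⁿ, and a polynomial of degree k has parity (-1)^k. The value of the constant is never needed
later. -/
theorem fourierD_polyDist {s : ℝ} {Q : MvPolynomial (Fin n) ℂ} (hQ : IsHomogPoly s Q) :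
    ∃ c : ℂ, fourierD (polyDist Q) = c • polyDelta Q := by
  by_cases hk : ∃ k : ℕ, (k : ℝ) = s
  · obtain ⟨k, rfl⟩ := hk
    refine ⟨(((2 * Real.pi) ^ n : ℝ) : ℂ) * (-1) ^ k, fourierD_injective (dist_ext fun φ => ?_)⟩
    rw [polyDist, fourierD_fourierD_apply, fourierD_smul, dist_smul_apply, ← polyDist,
      polyDist_apply, polyDist_apply, mul_assoc]
    congr 1
    rw [← integral_const_mul]
    rw [← integral_neg_eq_self (fun x => polyEval Q x * dilS (-1) (by norm_num) φ x)]
    refine integral_congr_ae (.of_forall fun x => ?_)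
    simp only [hQ.polyEval_neg, dilS_apply]
    simp [mul_assoc]
  · push Not at hk
    refine ⟨0, ?_⟩
    rw [hQ.eq_zero hk, polyDist, polyDelta_zero, fourierD_zero, fourierD_zero]
    exact dist_ext fun φ => by rw [dist_smul_apply, zero_mul, dist_zero_apply]

theorem dil_polyLog {s : ℝ} (hn : 1 ≤ n) {Q : MvPolynomial (Fin n) ℂ} (hQ : IsHomogPoly s Q)
    (t : ℝ) (ht : 0 < t) : dil t ht (polyLog Q) =
      ((t ^ s : ℝ) : ℂ) • (polyLog Q + ((Real.log t : ℝ) : ℂ) • polyDist Q) := by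
  have : Nonempty (Fin n) := ⟨⟨0, hn⟩⟩
  refine dist_ext fun φ => ?_
  rw [dil_apply, dist_smul_apply, dist_add_apply, dist_smul_apply, polyDist_apply, polyLog_apply,
    polyLog_apply]
  have h := integral_comp_smul_E
    (fun x => (polyEval Q x * Real.log ‖x‖) * dilS t⁻¹ (inv_ne_zero ht.ne') φ x) ht
  rw [Complex.real_smul, Complex.ofReal_inv] at h
  have hi : Integrable fun x : E n => polyEval Q x * (Real.log ‖x‖ : ℂ) * φ x := by
    refine (isTemperedFun_log.integrable_mul (mulS (polyEval Q) φ)).congr (.of_forall fun x => ?_)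
    simp only [mulS_apply (hasTemperateGrowth_polyEval Q)]
    ring
  rw [← h, ← integral_const_mul, ← integral_add hi ((integrable_polyEval_mul Q φ).const_mul _),
    ← integral_const_mul]
  refine integral_congr_ae ?_
  have h0 : ∀ᵐ x : E n, x ≠ 0 := by
    simp [ae_iff]
  filter_upwards [h0] with x hx
  simp only [dilS_apply, hQ.polyEval_smul t, smul_smul, inv_mul_cancel₀ ht.ne', one_smul,
    norm_smul, Real.norm_of_nonneg ht.le]
  rw [Real.log_mul ht.ne' (norm_ne_zero_iff.2 hx)]
  push_cast
  ring

/-! ### Cutoff functions and localization -/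

theorem exists_isCutoff (n : ℕ) : ∃ χ : E n → ℝ, IsCutoff χ := by
  let b : ContDiffBump (0 : E n) := ⟨1, 2, one_pos, one_lt_two⟩
  exact ⟨b, b.contDiff, b.hasCompactSupport, fun x => b.nonneg, fun x => b.le_one,
    b.eventuallyEq_one⟩

/-- A cutoff function as a Schwartz function. -/
def IsCutoff.toS {χ : E n → ℝ} (hχ : IsCutoff χ) : 𝓢(E n, ℂ) :=
  hχ.ofReal_compact.toSchwartzMap hχ.ofReal_smooth

theorem IsCutoff.toS_apply {χ : E n → ℝ} (hχ : IsCutoff χ) (x : E n) : hχ.toS x = χ x := rfl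

theorem zero_notMem_tsupport_iff (φ : E n → ℂ) :
    (0 : E n) ∉ tsupport φ ↔ ∀ᶠ x in nhds (0 : E n), φ x = 0 :=
  notMem_tsupport_iff_eventuallyEq

theorem coe_mulS {g : E n → ℂ} (hg : g.HasTemperateGrowth) (φ : 𝓢(E n, ℂ)) :
    (mulS g φ : E n → ℂ) = fun x => g x * φ x := funext (mulS_apply hg φ)

/-! ### Seminorm estimates and approximation by dilated cutoffs. -/

theorem exists_seminorm_mulS_le (φ : 𝓢(E n, ℂ)) (k l m : ℕ) :
    ∃ C : ℝ, 0 ≤ C ∧ ∀ (B : ℝ) (g : E n → ℂ), 0 ≤ B → g.HasTemperateGrowth →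
      (∀ j ≤ l, ∀ x, ‖iteratedFDeriv ℝ j g x‖ ≤ B * (1 + ‖x‖) ^ m) →
      SchwartzMap.seminorm ℂ k l (mulS g φ) ≤ C * B := by
  set S : ℝ := 2 ^ (k + m) *
    ((Finset.Iic ((k + m, l) : ℕ × ℕ)).sup (schwartzSeminormFamily ℂ (E n) ℂ)) φ with hS
  have hSn : 0 ≤ S := mul_nonneg (by positivity) (apply_nonneg _ _)
  have hb : ∀ j ≤ l, ∀ x, (1 + ‖x‖) ^ (k + m) * ‖iteratedFDeriv ℝ j φ x‖ ≤ S := fun j hj x =>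
    one_add_le_sup_seminorm_apply (𝕜 := ℂ) (m := (k + m, l)) le_rfl hj φ x
  refine ⟨2 ^ l * S, by positivity, fun B g hB hg hgb => ?_⟩
  refine seminorm_le_bound ℂ k l _ (by positivity) fun x => ?_
  rw [coe_mulS hg]
  have h1 := norm_iteratedFDeriv_mul_le hg.1 (φ.smooth ⊤) x (n := l) (by exact_mod_cast le_top)
  calc ‖x‖ ^ k * ‖iteratedFDeriv ℝ l (fun y => g y * φ y) x‖
      ≤ (1 + ‖x‖) ^ k * ∑ i ∈ Finset.range (l + 1), (l.choose i : ℝ) *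
          ‖iteratedFDeriv ℝ i g x‖ * ‖iteratedFDeriv ℝ (l - i) φ x‖ := by
        gcongr
        linarith
    _ ≤ ∑ i ∈ Finset.range (l + 1), (l.choose i : ℝ) * (S * B) := by
        rw [Finset.mul_sum]
        refine Finset.sum_le_sum fun i hi => ?_
        have hi' : i ≤ l := Nat.lt_succ_iff.1 (Finset.mem_range.1 hi)
        have h2 := hgb i hi' x
        have h3 := hb (l - i) (Nat.sub_le _ _) x
        calc (1 + ‖x‖) ^ k * ((l.choose i : ℝ) * ‖iteratedFDeriv ℝ i g x‖ *
              ‖iteratedFDeriv ℝ (l - i) φ x‖)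
            ≤ (1 + ‖x‖) ^ k * ((l.choose i : ℝ) * (B * (1 + ‖x‖) ^ m) *
              ‖iteratedFDeriv ℝ (l - i) φ x‖) := by gcongr
          _ = (l.choose i : ℝ) * (((1 + ‖x‖) ^ (k + m) * ‖iteratedFDeriv ℝ (l - i) φ x‖) * B) := by
            rw [pow_add]; ring
          _ ≤ _ := by gcongr
    _ = 2 ^ l * S * B := by
        rw [← Finset.sum_mul, ← Nat.cast_sum, Nat.sum_range_choose]
        push_cast; ring

theorem tendsto_of_seminorm {f : ℕ → 𝓢(E n, ℂ)}
    (h : ∀ k l, Filter.Tendsto (fun m => SchwartzMap.seminorm ℂ k l (f m)) Filter.atTop (nhds 0)) :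
    Filter.Tendsto f Filter.atTop (nhds 0) := by
  rw [(schwartz_withSeminorms ℂ (E n) ℂ).tendsto_nhds]
  intro i ε hε
  simp only [sub_zero]
  exact (h i.1 i.2).eventually_lt_const hε

theorem dist_tendsto_zero (T : 𝓢'(E n, ℂ)) {f : ℕ → 𝓢(E n, ℂ)}
    (h : ∀ k l, Filter.Tendsto (fun m => SchwartzMap.seminorm ℂ k l (f m)) Filter.atTop (nhds 0)) :
    Filter.Tendsto (fun m => T (f m)) Filter.atTop (nhds 0) := by
  have := ((map_continuous T).tendsto 0).comp (tendsto_of_seminorm h)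
  rwa [map_zero] at this

theorem IsCutoff.bounded_iteratedFDeriv {χ : E n → ℝ} (hχ : IsCutoff χ) (j : ℕ) :
    ∃ C : ℝ, 0 ≤ C ∧ ∀ x, ‖iteratedFDeriv ℝ j (fun x => (χ x : ℂ) - 1) x‖ ≤ C := by
  rcases j with _ | j
  · refine ⟨2, by norm_num, fun x => ?_⟩
    rw [norm_iteratedFDeriv_zero]
    refine (norm_sub_le _ _).trans ?_
    rw [Complex.norm_real, Real.norm_of_nonneg (hχ.nonneg x)]
    have := hχ.le_one x
    norm_num; linarith
  · refine ⟨SchwartzMap.seminorm ℂ 0 (j + 1) hχ.toS, apply_nonneg _ _, fun x => ?_⟩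
    refine le_trans (le_of_eq ?_) (norm_iteratedFDeriv_le_seminorm ℂ hχ.toS (j + 1) x)
    rw [← norm_iteratedFDeriv_fderiv, ← norm_iteratedFDeriv_fderiv]
    congr 2
    ext1 y
    exact fderiv_sub_const _

theorem IsCutoff.sub_one_smooth {χ : E n → ℝ} (hχ : IsCutoff χ) :
    ContDiff ℝ ∞ (fun x => (χ x : ℂ) - 1) := hχ.ofReal_smooth.sub contDiff_const

theorem IsCutoff.comp_smul_temperate {χ : E n → ℝ} (hχ : IsCutoff χ) {ε : ℝ} (hε : ε ≠ 0) :
    (fun x => (χ (ε • x) : ℂ)).HasTemperateGrowth :=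
  (hχ.ofReal_compact.comp_smul hε).hasTemperateGrowth
    (hχ.ofReal_smooth.comp (contDiff_const_smul ε))

theorem IsCutoff.zero_eq_one {χ : E n → ℝ} (hχ : IsCutoff χ) : χ 0 = 1 := hχ.eq_one.self_of_nhds

/-- For order zero, the mean value inequality starting from χ(0) = 1 gives a bound by ε‖x‖; each
derivative of order j ≥ 1 brings ε^j ≤ ε by the chain rule. The price is a single power of the
weight 1 + ‖x‖. -/
theorem IsCutoff.exists_bound_dil {χ : E n → ℝ} (hχ : IsCutoff χ) (l : ℕ) :
    ∃ C : ℝ, 0 ≤ C ∧ ∀ ε : ℝ, 0 < ε → ε ≤ 1 → ∀ j ≤ l, ∀ x,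
      ‖iteratedFDeriv ℝ j (fun x => (χ (ε • x) : ℂ) - 1) x‖ ≤ (C * ε) * (1 + ‖x‖) ^ 1 := by
  choose C hC0 hC using hχ.bounded_iteratedFDeriv
  have hsum : 0 ≤ ∑ i ∈ Finset.range (l + 1), C i := Finset.sum_nonneg fun i _ => hC0 i
  refine ⟨C 1 + ∑ i ∈ Finset.range (l + 1), C i, add_nonneg (hC0 1) hsum,
    fun ε hε hε1 j hj x => ?_⟩
  have h1 : iteratedFDeriv ℝ j (fun x => (χ (ε • x) : ℂ) - 1) x =
      ε ^ j • iteratedFDeriv ℝ j (fun x => (χ x : ℂ) - 1) (ε • x) :=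
    congrFun (iteratedFDeriv_comp_const_smul (i := j) (f := fun x : E n => (χ x : ℂ) - 1) ε
      (hχ.sub_one_smooth.of_le (by exact_mod_cast le_top))) x
  rw [h1, norm_smul, norm_pow, Real.norm_of_nonneg hε.le, pow_one]
  rcases j with _ | j
  · rw [norm_iteratedFDeriv_zero, pow_zero, one_mul]
    have h2 : ‖((χ (ε • x) : ℂ) - 1) - ((χ 0 : ℂ) - 1)‖ ≤ C 1 * ‖ε • x - 0‖ := by
      refine Convex.norm_image_sub_le_of_norm_fderiv_le (𝕜 := ℝ)
        (f := fun x : E n => (χ x : ℂ) - 1) (s := Set.univ) (fun y _ => ?_) (fun y _ => ?_) convex_univ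
        (Set.mem_univ _) (Set.mem_univ _)
      · exact (hχ.sub_one_smooth.differentiable (by simp)) y
      · rw [← norm_iteratedFDeriv_one]; exact hC 1 y
    rw [hχ.zero_eq_one] at h2
    simp only [Complex.ofReal_one, sub_self, sub_zero, norm_smul, Real.norm_of_nonneg hε.le] at h2
    refine h2.trans ?_
    nlinarith [hC0 1, norm_nonneg x, mul_nonneg (hC0 1) hε.le, mul_nonneg hsum hε.le,
      mul_nonneg (mul_nonneg hsum hε.le) (norm_nonneg x)]
  · have h3 : C (j + 1) ≤ ∑ i ∈ Finset.range (l + 1), C i :=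
      Finset.single_le_sum (f := C) (fun i _ => hC0 i) (Finset.mem_range.2 (Nat.lt_succ_iff.2 hj))
    have h4 : ε ^ (j + 1) ≤ ε := pow_le_of_le_one hε.le hε1 (by simp)
    calc ε ^ (j + 1) * ‖iteratedFDeriv ℝ (j + 1) (fun x => (χ x : ℂ) - 1) (ε • x)‖
        ≤ ε * ∑ i ∈ Finset.range (l + 1), C i := by
          gcongr
          exact (hC _ _).trans h3
      _ ≤ _ := by
        nlinarith [hC0 1, norm_nonneg x, mul_nonneg (hC0 1) hε.le, mul_nonneg hsum hε.le,
          mul_nonneg (mul_nonneg hsum hε.le) (norm_nonneg x),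
          mul_nonneg (mul_nonneg (hC0 1) hε.le) (norm_nonneg x)]

/-- The error is the product of φ with χ(εx) - 1, a multiplier of size O(ε) up to weights. This
extends statements from compactly supported test functions to all Schwartz functions. -/
theorem IsCutoff.tendsto_mulS {χ : E n → ℝ} (hχ : IsCutoff χ) (φ : 𝓢(E n, ℂ)) :
    Filter.Tendsto (fun m : ℕ => mulS (fun x => (χ (((m : ℝ) + 1)⁻¹ • x) : ℂ)) φ) Filter.atTop
      (nhds φ) := by
  have hpos : ∀ m : ℕ, 0 < ((m : ℝ) + 1)⁻¹ := fun m => by positivity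
  have hsub : ∀ m : ℕ, mulS (fun x => (χ (((m : ℝ) + 1)⁻¹ • x) : ℂ)) φ - φ =
      mulS (fun x => (χ (((m : ℝ) + 1)⁻¹ • x) : ℂ) - 1) φ := by
    intro m
    ext x
    have h1 := hχ.comp_smul_temperate (hpos m).ne'
    have h2 : (fun x : E n => (χ (((m : ℝ) + 1)⁻¹ • x) : ℂ) - 1).HasTemperateGrowth :=
      h1.sub (Function.HasTemperateGrowth.const 1)
    rw [mulS_apply h2, sub_apply, mulS_apply h1]
    ring
  rw [← tendsto_sub_nhds_zero_iff]
  simp only [hsub]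
  refine tendsto_of_seminorm fun k l => ?_
  obtain ⟨C, hC0, hC⟩ := exists_seminorm_mulS_le φ k l 1
  obtain ⟨D, hD0, hD⟩ := hχ.exists_bound_dil l
  have hlim : Filter.Tendsto (fun m : ℕ => C * (D * ((m : ℝ) + 1)⁻¹)) Filter.atTop (nhds 0) := by
    have := (tendsto_one_div_add_atTop_nhds_zero_nat (𝕜 := ℝ)).const_mul (C * D)
    simpa [mul_assoc] using this
  refine squeeze_zero (fun m => apply_nonneg _ _) (fun m => ?_) hlim
  have h1 := hχ.comp_smul_temperate (hpos m).ne'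
  refine hC _ _ (mul_nonneg hD0 (hpos m).le) (h1.sub (Function.HasTemperateGrowth.const 1)) ?_
  exact hD _ (hpos m) (inv_le_one_of_one_le₀ (by linarith [Nat.cast_nonneg (α := ℝ) m]))

/-- A distribution that restricts to the function `w` off the origin acts by integration against
`w` on every Schwartz function that vanishes near the origin, if the integral exists. -/
theorem AgreesOffZero.apply_eq {T : 𝓢'(E n, ℂ)} {w : E n → ℂ} (hT : AgreesOffZero T w)
    {φ : 𝓢(E n, ℂ)} (h0 : ∀ᶠ x in nhds (0 : E n), φ x = 0)
    (hi : Integrable (fun x => w x * φ x)) : T φ = ∫ x, w x * φ x := by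
  obtain ⟨χ, hχ⟩ := exists_isCutoff n
  have hpos : ∀ m : ℕ, 0 < ((m : ℝ) + 1)⁻¹ := fun m => by positivity
  have h1 := ((map_continuous T).tendsto φ).comp (hχ.tendsto_mulS φ)
  have hval : ∀ m : ℕ, T (mulS (fun x => (χ (((m : ℝ) + 1)⁻¹ • x) : ℂ)) φ) =
      ∫ x, (χ (((m : ℝ) + 1)⁻¹ • x) : ℂ) * (w x * φ x) := by
    intro m
    have ht := hχ.comp_smul_temperate (hpos m).ne'
    rw [hT]
    · refine integral_congr_ae (.of_forall fun x => ?_)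
      simp only [mulS_apply ht]; ring
    · rw [coe_mulS ht]
      exact (hχ.ofReal_compact.comp_smul (hpos m).ne').mul_right
    · rw [zero_notMem_tsupport_iff]
      filter_upwards [h0] with x hx
      rw [mulS_apply ht, hx, mul_zero]
  -- The values on the truncated functions converge to T φ by continuity of T, and to the integral
  -- by dominated convergence.
  refine tendsto_nhds_unique h1 ?_
  simp only [Function.comp_def, hval]
  refine tendsto_integral_of_dominated_convergence (fun x => ‖w x * φ x‖) (fun m => ?_) hi.norm
    (fun m => .of_forall fun x => ?_) (.of_forall fun x => ?_)
  · exact (hχ.comp_smul_temperate (hpos m).ne').1.continuous.aestronglyMeasurable.mul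
      hi.aestronglyMeasurable
  · rw [norm_mul, Complex.norm_real, Real.norm_of_nonneg (hχ.nonneg _)]
    exact mul_le_of_le_one_left (norm_nonneg _) (hχ.le_one _)
  · have h2 : Filter.Tendsto (fun m : ℕ => ((m : ℝ) + 1)⁻¹ • x) Filter.atTop (nhds 0) := by
      have := (tendsto_one_div_add_atTop_nhds_zero_nat (𝕜 := ℝ)).smul_const x
      simpa using this
    have h3 := (hχ.ofReal_smooth.continuous.tendsto 0).comp h2
    rw [hχ.zero_eq_one] at h3
    simpa using h3.mul_const (w x * φ x)

/-! ### Homogeneous distributions supported at the origin -/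

/-- Taylor's estimate by descending order: the derivative of order N is bounded, and each step down
gains a factor ‖y‖ from the mean value inequality on the ball of radius ‖y‖, because the lower
derivative vanishes at 0. -/
theorem exists_norm_iteratedFDeriv_le_pow (φ : 𝓢(E n, ℂ)) (N : ℕ)
    (hφ : ∀ j < N, iteratedFDeriv ℝ j φ 0 = 0) (i : ℕ) (hi : i ≤ N) :
    ∃ C : ℝ, 0 ≤ C ∧ ∀ y, ‖iteratedFDeriv ℝ (N - i) φ y‖ ≤ C * ‖y‖ ^ i := by
  induction i with
  | zero =>
    refine ⟨SchwartzMap.seminorm ℂ 0 N φ, apply_nonneg _ _, fun y => ?_⟩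
    simpa using norm_iteratedFDeriv_le_seminorm ℂ φ N y
  | succ i ih =>
    obtain ⟨C, hC0, hC⟩ := ih (by omega)
    refine ⟨C, hC0, fun y => ?_⟩
    have hd : Differentiable ℝ (iteratedFDeriv ℝ (N - (i + 1)) φ) :=
      (φ.smooth ⊤).differentiable_iteratedFDeriv (WithTop.coe_lt_coe.2 (ENat.natCast_lt_top _))
    have h := (convex_closedBall (0 : E n) ‖y‖).norm_image_sub_le_of_norm_fderiv_le (𝕜 := ℝ)
      (f := iteratedFDeriv ℝ (N - (i + 1)) φ) (C := C * ‖y‖ ^ i) (x := 0) (y := y)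
      (fun z _ => hd z) (fun z hz => ?_) (by simp) (by simp)
    · rw [hφ _ (by omega), sub_zero, sub_zero, mul_assoc, ← pow_succ] at h
      exact h
    · rw [norm_fderiv_iteratedFDeriv, show N - (i + 1) + 1 = N - i by omega]
      refine (hC z).trans ?_
      gcongr
      simpa using hz

/-- The chain rule gives t^(-j), which suffices when j ≥ N; when j < N, the vanishing of φ at 0
supplies the missing t^(-(N-j)), at the cost of the weight. -/
theorem exists_norm_iteratedFDeriv_dilS_le (φ : 𝓢(E n, ℂ)) (N l : ℕ)
    (hφ : ∀ j < N, iteratedFDeriv ℝ j φ 0 = 0) :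
    ∃ C : ℝ, 0 ≤ C ∧ ∀ (t : ℝ) (ht : 1 ≤ t), ∀ j ≤ l, ∀ x,
      ‖iteratedFDeriv ℝ j (dilS t⁻¹ (inv_ne_zero (zero_lt_one.trans_le ht).ne') φ) x‖ ≤
        (C * t⁻¹ ^ N) * (1 + ‖x‖) ^ N := by
  have hj : ∀ j : ℕ, ∃ C : ℝ, 0 ≤ C ∧ ∀ (t : ℝ) (ht : 1 ≤ t), ∀ x : E n,
      t⁻¹ ^ j * ‖iteratedFDeriv ℝ j φ (t⁻¹ • x)‖ ≤ (C * t⁻¹ ^ N) * (1 + ‖x‖) ^ N := by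
    intro j
    rcases le_or_gt N j with hNj | hNj
    · refine ⟨SchwartzMap.seminorm ℂ 0 j φ, apply_nonneg _ _, fun t ht x => ?_⟩
      have ht0 : 0 < t := zero_lt_one.trans_le ht
      have h1 := norm_iteratedFDeriv_le_seminorm ℂ φ j (t⁻¹ • x)
      have h2 : t⁻¹ ^ j ≤ t⁻¹ ^ N := pow_le_pow_of_le_one (by positivity)
        (inv_le_one_of_one_le₀ ht) hNj
      have h3 : (1 : ℝ) ≤ (1 + ‖x‖) ^ N := one_le_pow₀ (by linarith [norm_nonneg x])
      calc t⁻¹ ^ j * ‖iteratedFDeriv ℝ j φ (t⁻¹ • x)‖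
          ≤ t⁻¹ ^ N * SchwartzMap.seminorm ℂ 0 j φ := by gcongr
        _ ≤ _ := by
          rw [mul_comm]
          exact le_mul_of_one_le_right (mul_nonneg (apply_nonneg _ _) (by positivity)) h3
    · obtain ⟨C, hC0, hC⟩ := exists_norm_iteratedFDeriv_le_pow φ N hφ (N - j) (Nat.sub_le _ _)
      refine ⟨C, hC0, fun t ht x => ?_⟩
      have ht0 : 0 < t := zero_lt_one.trans_le ht
      have h1 := hC (t⁻¹ • x)
      rw [show N - (N - j) = j by omega, norm_smul, Real.norm_of_nonneg (by positivity),
        mul_pow] at h1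
      have h3 : ‖x‖ ^ (N - j) ≤ (1 + ‖x‖) ^ N :=
        (pow_le_pow_left₀ (norm_nonneg x) (by linarith) _).trans
          (pow_le_pow_right₀ (by linarith [norm_nonneg x]) (Nat.sub_le _ _))
      calc t⁻¹ ^ j * ‖iteratedFDeriv ℝ j φ (t⁻¹ • x)‖
          ≤ t⁻¹ ^ j * (C * (t⁻¹ ^ (N - j) * ‖x‖ ^ (N - j))) := by gcongr
        _ = C * t⁻¹ ^ (j + (N - j)) * ‖x‖ ^ (N - j) := by rw [pow_add]; ring
        _ ≤ _ := by
          rw [show j + (N - j) = N by omega]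
          gcongr
  choose C hC0 hC using hj
  refine ⟨∑ i ∈ Finset.range (l + 1), C i, Finset.sum_nonneg fun i _ => hC0 i,
    fun t ht j hjl x => ?_⟩
  have ht0 : 0 < t := zero_lt_one.trans_le ht
  have h1 : iteratedFDeriv ℝ j (dilS t⁻¹ (inv_ne_zero (zero_lt_one.trans_le ht).ne') φ) x =
      t⁻¹ ^ j • iteratedFDeriv ℝ j φ (t⁻¹ • x) :=
    congrFun (iteratedFDeriv_comp_const_smul (i := j) (f := φ) t⁻¹
      ((φ.smooth ⊤).of_le (by exact_mod_cast le_top))) x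
  rw [h1, norm_smul, norm_pow, Real.norm_of_nonneg (by positivity)]
  refine (hC j t ht x).trans ?_
  gcongr
  exact Finset.single_le_sum (f := C) (fun i _ => hC0 i) (Finset.mem_range.2 (Nat.lt_succ_iff.2 hjl))

theorem dilS_eventually_zero {φ : 𝓢(E n, ℂ)} (h0 : ∀ᶠ x in nhds (0 : E n), φ x = 0) (t : ℝ)
    (ht : t ≠ 0) : ∀ᶠ x in nhds (0 : E n), dilS t ht φ x = 0 := by
  have : Filter.Tendsto (fun x : E n => t • x) (nhds 0) (nhds 0) := by
    have := (continuous_const_smul t).tendsto (0 : E n)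
    rwa [smul_zero] at this
  exact this.eventually h0

/-- A homogeneous distribution of degree `s` supported at the origin vanishes on every Schwartz
function that vanishes at the origin to an order larger than `-n-s`. -/
theorem apply_eq_zero_of_isHomogDist {T : 𝓢'(E n, ℂ)} {s : ℝ} (hT : AgreesOffZero T 0)
    (hs : IsHomogDist s T) (N : ℕ) (hN : -(n : ℝ) - s < N) (φ : 𝓢(E n, ℂ))
    (hφ : ∀ j < N, iteratedFDeriv ℝ j φ 0 = 0) : T φ = 0 := by
  obtain ⟨χ, hχ⟩ := exists_isCutoff n
  have ht1 : ∀ m : ℕ, (1 : ℝ) ≤ (m : ℝ) + 1 := fun m => by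
    linarith [Nat.cast_nonneg (α := ℝ) m]
  have ht0 : ∀ m : ℕ, (0 : ℝ) < (m : ℝ) + 1 := fun m => by positivity
  let ψ : ℕ → 𝓢(E n, ℂ) := fun m => dilS ((m : ℝ) + 1)⁻¹ (inv_ne_zero (ht0 m).ne') φ
  -- With t = m + 1, homogeneity gives T φ = t^(-s-n) T(φ(·/t)), and a factor χ may be inserted
  -- because T is supported at 0. The seminorms of χ φ(·/t) are O(t^(-N)), so T φ = O(t^(-s-n-N)),
  -- which tends to 0.
  let c : ℕ → ℝ := fun m => ((m : ℝ) + 1) ^ (-s - n)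
  have hc0 : ∀ m, 0 < c m := fun m => Real.rpow_pos_of_pos (ht0 m) _
  have hval : ∀ m, T φ = T ((c m : ℂ) • mulS (ψ m) hχ.toS) := by
    intro m
    have h1 : T (mulS (ψ m) hχ.toS) = T (ψ m) := by
      have h2 : T (ψ m - mulS (ψ m) hχ.toS) = ∫ x, (0 : E n → ℂ) x * (ψ m - mulS (ψ m) hχ.toS) x := by
        refine hT.apply_eq ?_ ?_
        · filter_upwards [hχ.eq_one] with x hx
          rw [sub_apply, mulS_apply (ψ m).hasTemperateGrowth, hχ.toS_apply, hx]
          simp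
        · simp
      rw [map_sub] at h2
      simp only [Pi.zero_apply, zero_mul, integral_zero] at h2
      exact (sub_eq_zero.1 h2).symm
    have h3 := congrArg (fun S : 𝓢'(E n, ℂ) => S φ) (hs ((m : ℝ) + 1) (ht0 m))
    simp only [dil_apply, dist_smul_apply] at h3
    rw [map_smul, smul_eq_mul, h1]
    have h4 : (c m : ℂ) = ((((m : ℝ) + 1) ^ s : ℝ) : ℂ)⁻¹ * ((((m : ℝ) + 1) ^ n : ℝ) : ℂ)⁻¹ := by
      rw [← Complex.ofReal_inv, ← Complex.ofReal_inv, ← Complex.ofReal_mul]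
      congr 1
      rw [← Real.rpow_neg (ht0 m).le, ← Real.rpow_natCast, ← Real.rpow_neg (ht0 m).le,
        ← Real.rpow_add (ht0 m)]
      rfl
    rw [h4, mul_assoc, h3, ← mul_assoc, inv_mul_cancel₀, one_mul]
    exact_mod_cast (Real.rpow_pos_of_pos (ht0 m) s).ne'
  have hlim : Filter.Tendsto (fun m => T ((c m : ℂ) • mulS (ψ m) hχ.toS)) Filter.atTop (nhds 0) := by
    refine dist_tendsto_zero T fun k l => ?_
    obtain ⟨C, hC0, hC⟩ := exists_seminorm_mulS_le hχ.toS k l N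
    obtain ⟨D, hD0, hD⟩ := exists_norm_iteratedFDeriv_dilS_le φ N l hφ
    have hlim2 : Filter.Tendsto (fun m : ℕ => C * D * ((m : ℝ) + 1) ^ (-(s + n + N))) Filter.atTop
        (nhds 0) := by
      have h1 := (tendsto_rpow_neg_atTop (y := s + n + N) (by linarith)).comp
        (Filter.tendsto_atTop_add_const_right Filter.atTop (1 : ℝ) tendsto_natCast_atTop_atTop)
      simpa using h1.const_mul (C * D)
    refine squeeze_zero (fun m => apply_nonneg _ _) (fun m => ?_) hlim2
    rw [map_smul_eq_mul, Complex.norm_real, Real.norm_of_nonneg (hc0 m).le]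
    have h5 := hC (D * ((m : ℝ) + 1)⁻¹ ^ N) (ψ m)
      (mul_nonneg hD0 (pow_nonneg (inv_pos.2 (ht0 m)).le _)) (ψ m).hasTemperateGrowth
      (hD _ (ht1 m))
    calc c m * SchwartzMap.seminorm ℂ k l (mulS (ψ m) hχ.toS)
        ≤ c m * (C * (D * ((m : ℝ) + 1)⁻¹ ^ N)) := mul_le_mul_of_nonneg_left h5 (hc0 m).le
      _ = C * D * (c m * ((m : ℝ) + 1)⁻¹ ^ N) := by ring
      _ = _ := by
        congr 1
        rw [inv_pow, ← Real.rpow_natCast, ← Real.rpow_neg (ht0 m).le, ← Real.rpow_add (ht0 m)]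
        congr 1
        ring
  simp only [← hval] at hlim
  exact tendsto_nhds_unique tendsto_const_nhds hlim

/-- In degree -n, vanishing at the origin to first order already suffices, and φ - φ(0)χ has it. -/
theorem eq_smul_delta_of_isHomogDist {T : 𝓢'(E n, ℂ)} (hT : AgreesOffZero T 0)
    (hs : IsHomogDist (-(n : ℝ)) T) :
    ∃ c : ℂ, T = c • TemperedDistribution.delta (0 : E n) := by
  obtain ⟨χ, hχ⟩ := exists_isCutoff n
  refine ⟨T hχ.toS, dist_ext fun φ => ?_⟩
  have h := apply_eq_zero_of_isHomogDist hT hs 1 (by simp) (φ - φ 0 • hχ.toS) ?_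
  · rw [map_sub, map_smul, sub_eq_zero] at h
    rw [h, dist_smul_apply, TemperedDistribution.delta_apply, smul_eq_mul, mul_comm]
  · intro j hj
    have : j = 0 := by omega
    subst this
    ext v
    simp [hχ.toS_apply, hχ.zero_eq_one]

/-! ### Functions that are homogeneous up to a logarithm -/

/-- `w (t x) = t ^ s (w x + log t q x)` for `x ≠ 0` and `t > 0`. -/
def IsLogHomogFun (s : ℝ) (w q : E n → ℂ) : Prop :=
  ∀ x : E n, x ≠ 0 → ∀ t : ℝ, 0 < t →
    w (t • x) = ((t ^ s : ℝ) : ℂ) * (w x + (Real.log t : ℂ) * q x)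

theorem IsHomogFun.isLogHomogFun {s : ℝ} {u : E n → ℂ} (hu : IsHomogFun s u) :
    IsLogHomogFun s u 0 := by
  intro x hx t ht
  simp [hu x hx t ht]

theorem IsHomogFun.mul_log {s : ℝ} {u : E n → ℂ} (hu : IsHomogFun s u) :
    IsLogHomogFun s (fun x => u x * (Real.log ‖x‖ : ℂ)) u := by
  intro x hx t ht
  simp only [hu x hx t ht, norm_smul, Real.norm_of_nonneg ht.le]
  rw [Real.log_mul ht.ne' (norm_ne_zero_iff.2 hx)]
  push_cast
  ring

theorem IsHomogFun.coord_mul {s : ℝ} {u : E n → ℂ} (hu : IsHomogFun s u) (j : Fin n) :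
    IsHomogFun (s + 1) (fun x => (x j : ℂ) * u x) := by
  intro x hx t ht
  simp only [hu x hx t ht, Real.rpow_add ht, Real.rpow_one, PiLp.smul_apply, smul_eq_mul]
  push_cast
  ring

theorem SmoothOffZero.contDiffAt {w : E n → ℂ} (hw : SmoothOffZero w) {x : E n} (hx : x ≠ 0) :
    ContDiffAt ℝ ∞ w x :=
  ContDiffOn.contDiffAt hw (isOpen_compl_singleton.mem_nhds hx)

theorem smoothOffZero_of_contDiffAt {w : E n → ℂ} (hw : ∀ x, x ≠ 0 → ContDiffAt ℝ ∞ w x) :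
    SmoothOffZero w := fun x hx => (hw x hx).contDiffWithinAt

theorem SmoothOffZero.mul {v w : E n → ℂ} (hv : SmoothOffZero v) (hw : SmoothOffZero w) :
    SmoothOffZero (fun x => v x * w x) := ContDiffOn.mul hv hw

theorem SmoothOffZero.add {v w : E n → ℂ} (hv : SmoothOffZero v) (hw : SmoothOffZero w) :
    SmoothOffZero (fun x => v x + w x) := ContDiffOn.add hv hw

theorem SmoothOffZero.sub {v w : E n → ℂ} (hv : SmoothOffZero v) (hw : SmoothOffZero w) :
    SmoothOffZero (fun x => v x - w x) := ContDiffOn.sub hv hw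

theorem smoothOffZero_of_contDiff {v : E n → ℂ} (hv : ContDiff ℝ ∞ v) : SmoothOffZero v :=
  hv.contDiffOn

theorem smoothOffZero_log : SmoothOffZero (fun x : E n => (Real.log ‖x‖ : ℂ)) := by
  refine smoothOffZero_of_contDiffAt fun x hx => ?_
  have h1 : ContDiffAt ℝ ∞ (fun x : E n => Real.log ‖x‖) x :=
    (contDiffAt_norm ℝ hx).log (norm_ne_zero_iff.2 hx)
  exact Complex.ofRealCLM.contDiff.contDiffAt.comp x h1

theorem contDiff_coord (j : Fin n) : ContDiff ℝ ∞ (fun x : E n => (x j : ℂ)) :=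
  (hasTemperateGrowth_coord j).1

theorem contDiff_mul_of_eventually_zero {f w : E n → ℂ} (hf : ContDiff ℝ ∞ f)
    (h0 : ∀ᶠ x in nhds (0 : E n), f x = 0) (hw : SmoothOffZero w) :
    ContDiff ℝ ∞ (fun x => f x * w x) := by
  rw [contDiff_iff_contDiffAt]
  intro x
  by_cases hx : x = 0
  · subst hx
    have : (fun x => f x * w x) =ᶠ[nhds 0] fun _ => 0 := by
      filter_upwards [h0] with x hx
      simp [hx]
    exact contDiffAt_const.congr_of_eventuallyEq this
  · exact hf.contDiffAt.mul (hw.contDiffAt hx)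

/-- By scaling, everything reduces to the unit sphere, where w and q are bounded; the logarithm is
absorbed by |log r| ≤ (r^ε + r^(-ε))/ε. -/
theorem IsLogHomogFun.exists_bound {s : ℝ} {w q : E n → ℂ} (h : IsLogHomogFun s w q)
    (hw : SmoothOffZero w) (hq : SmoothOffZero q) {ε : ℝ} (hε : 0 < ε) :
    ∃ C : ℝ, 0 ≤ C ∧ ∀ x, x ≠ 0 → ‖w x‖ ≤ C * (‖x‖ ^ (s - ε) + ‖x‖ ^ (s + ε)) := by
  have hsub : Metric.sphere (0 : E n) 1 ⊆ {0}ᶜ := fun x hx h0 => by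
    rw [Set.mem_singleton_iff.1 h0] at hx; simp at hx
  have hK := isCompact_sphere (0 : E n) 1
  obtain ⟨A, hA⟩ := hK.exists_bound_of_continuousOn (hw.continuousOn.mono hsub)
  obtain ⟨B, hB⟩ := hK.exists_bound_of_continuousOn (hq.continuousOn.mono hsub)
  refine ⟨|A| + |B| / ε, by positivity, fun x hx => ?_⟩
  have hr : 0 < ‖x‖ := norm_pos_iff.2 hx
  set r := ‖x‖ with hrdef
  have hmem : r⁻¹ • x ∈ Metric.sphere (0 : E n) 1 := by
    simp [norm_smul, ← hrdef, hr.ne', abs_of_pos hr]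
  have hx' : r • (r⁻¹ • x) = x := by rw [smul_smul, mul_inv_cancel₀ hr.ne', one_smul]
  have hval := h (r⁻¹ • x) (hsub hmem) r hr
  rw [hx'] at hval
  have hlog : |Real.log r| ≤ (r ^ ε + r ^ (-ε)) / ε := by
    rw [abs_le']
    have h1 := Real.log_le_rpow_div hr.le hε
    have h2 := Real.log_le_rpow_div (inv_pos.2 hr).le hε
    rw [Real.log_inv, Real.inv_rpow hr.le, ← Real.rpow_neg hr.le] at h2
    have h3 : 0 < r ^ ε := Real.rpow_pos_of_pos hr _
    have h4 : 0 < r ^ (-ε) := Real.rpow_pos_of_pos hr _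
    constructor
    · refine h1.trans ?_; gcongr; linarith
    · refine h2.trans ?_; gcongr; linarith
  have hone : 1 ≤ r ^ ε + r ^ (-ε) := by
    have h3 : 0 < r ^ ε := Real.rpow_pos_of_pos hr _
    rw [Real.rpow_neg hr.le]
    rcases le_total 1 (r ^ ε) with h | h
    · have : 0 ≤ (r ^ ε)⁻¹ := by positivity
      linarith
    · have := (one_le_inv₀ h3).2 h
      linarith
  have hA' : ‖w (r⁻¹ • x)‖ ≤ |A| := (hA _ hmem).trans (le_abs_self A)
  have hB' : ‖q (r⁻¹ • x)‖ ≤ |B| := (hB _ hmem).trans (le_abs_self B)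
  have hrs : 0 < r ^ s := Real.rpow_pos_of_pos hr _
  calc ‖w x‖ = r ^ s * ‖w (r⁻¹ • x) + (Real.log r : ℂ) * q (r⁻¹ • x)‖ := by
        rw [hval, norm_mul, Complex.norm_real, Real.norm_of_nonneg hrs.le]
    _ ≤ r ^ s * (|A| + (r ^ ε + r ^ (-ε)) / ε * |B|) := by
        gcongr
        refine (norm_add_le _ _).trans ?_
        rw [norm_mul, Complex.norm_real, Real.norm_eq_abs]
        gcongr
    _ ≤ r ^ s * (|A| * (r ^ ε + r ^ (-ε)) + (r ^ ε + r ^ (-ε)) / ε * |B|) := by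
        gcongr
        exact le_mul_of_one_le_right (abs_nonneg _) hone
    _ = (|A| + |B| / ε) * (r ^ (s - ε) + r ^ (s + ε)) := by
        rw [sub_eq_add_neg, Real.rpow_add hr, Real.rpow_add hr]
        ring

theorem SmoothOffZero.aestronglyMeasurable (hn : 1 ≤ n) {w : E n → ℂ} (hw : SmoothOffZero w) :
    AEStronglyMeasurable w (volume : Measure (E n)) := by
  have : Nonempty (Fin n) := ⟨⟨0, hn⟩⟩
  have h1 := hw.continuousOn.aestronglyMeasurable (μ := (volume : Measure (E n)))
    (measurableSet_singleton (0 : E n)).compl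
  have h2 : (volume : Measure (E n)).restrict {0}ᶜ = volume := by
    rw [Measure.restrict_eq_self_of_ae_mem]
    simp [ae_iff]
  rwa [h2] at h1

theorem ae_ne_zero (hn : 1 ≤ n) : ∀ᵐ x : E n, x ≠ 0 := by
  have : Nonempty (Fin n) := ⟨⟨0, hn⟩⟩
  simp [ae_iff]

theorem isTemperedFun_of_bound (hn : 1 ≤ n) {w : E n → ℂ}
    (hm : AEStronglyMeasurable w (volume : Measure (E n))) {C a : ℝ} {M : ℕ} (hC : 0 ≤ C)
    (ha : -(n : ℝ) < a) (hw : ∀ x, x ≠ 0 → ‖w x‖ ≤ C * (‖x‖ ^ a + (1 + ‖x‖) ^ M))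
    (haM : a ≤ M) : IsTemperedFun w := by
  have : Nonempty (Fin n) := ⟨⟨0, hn⟩⟩
  have : Nontrivial (E n) := inferInstance
  -- The exponent leaves the integrable weight (1 + ‖x‖)^(-n-1) after the growth of order M has been
  -- absorbed; near the origin, integrability comes from a > -n.
  refine ⟨n + 1 + M, ?_⟩
  have hb : IntegrableOn (fun x : E n => ‖x‖ ^ a) (Metric.ball 0 1) := by
    rw [integrableOn_fun_norm_addHaar volume (f := fun r => r ^ a)]
    have h1 : IntegrableOn (fun r : ℝ => r ^ ((n : ℝ) - 1 + a)) (Set.Ioo 0 1) :=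
      ((intervalIntegral.intervalIntegrable_rpow' (a := 0) (b := 1) (by linarith)).1).mono_set
        Set.Ioo_subset_Ioc_self
    refine h1.congr_fun (fun r hr => ?_) measurableSet_Ioo
    simp only [finrank_euclideanSpace, Fintype.card_fin, smul_eq_mul]
    rw [Real.rpow_add hr.1, ← Real.rpow_natCast, Nat.cast_sub hn, Nat.cast_one]
  have hj : Integrable (fun x : E n => (1 + ‖x‖) ^ (-((n : ℝ) + 1))) :=
    integrable_one_add_norm (by simp)
  have hcont : Continuous fun x : E n => (((1 + ‖x‖) ^ (-((n + 1 + M : ℕ) : ℝ)) : ℝ) : ℂ) := by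
    refine Complex.continuous_ofReal.comp ?_
    exact (continuous_const.add continuous_norm).rpow_const fun x =>
      Or.inl (add_pos_of_pos_of_nonneg one_pos (norm_nonneg x)).ne'
  refine ((((integrable_indicator_iff measurableSet_ball).2 hb).const_mul C).add
    (hj.const_mul (2 * C))).mono' (hcont.aestronglyMeasurable.mul hm) ?_
  filter_upwards [ae_ne_zero hn] with x hx
  have hp : (0 : ℝ) < 1 + ‖x‖ := by positivity
  have hx0 : 0 < ‖x‖ := norm_pos_iff.2 hx
  rw [norm_mul, Complex.norm_real, Real.norm_of_nonneg (by positivity)]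
  have h1 : (1 + ‖x‖) ^ (-((n + 1 + M : ℕ) : ℝ)) ≤ 1 :=
    Real.rpow_le_one_of_one_le_of_nonpos (by simp) (neg_nonpos.2 (Nat.cast_nonneg _))
  have h2 : (1 + ‖x‖) ^ (-((n + 1 + M : ℕ) : ℝ)) * (1 + ‖x‖) ^ M =
      (1 + ‖x‖) ^ (-((n : ℝ) + 1)) := by
    rw [← Real.rpow_natCast, ← Real.rpow_add hp]; congr 1; push_cast; ring
  have hpos : 0 ≤ (1 + ‖x‖) ^ (-((n + 1 + M : ℕ) : ℝ)) := by positivity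
  have ha0 : 0 ≤ ‖x‖ ^ a := by positivity
  have h4 : 0 ≤ (1 + ‖x‖) ^ (-((n : ℝ) + 1)) := by positivity
  have h5 : (1 + ‖x‖) ^ (-((n + 1 + M : ℕ) : ℝ)) * ‖w x‖ ≤
      C * ((1 + ‖x‖) ^ (-((n + 1 + M : ℕ) : ℝ)) * ‖x‖ ^ a) + C * (1 + ‖x‖) ^ (-((n : ℝ) + 1)) := by
    rw [← h2]
    calc _ ≤ (1 + ‖x‖) ^ (-((n + 1 + M : ℕ) : ℝ)) * (C * (‖x‖ ^ a + (1 + ‖x‖) ^ M)) := by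
          gcongr; exact hw x hx
      _ = _ := by ring
  refine h5.trans ?_
  simp only [Pi.add_apply]
  by_cases hxb : x ∈ Metric.ball (0 : E n) 1
  · rw [Set.indicator_of_mem hxb]
    nlinarith [mul_nonneg hC h4, mul_nonneg hC ha0, mul_le_mul_of_nonneg_left
      (mul_le_of_le_one_left ha0 h1) hC]
  · rw [Set.indicator_of_notMem hxb]
    have hx1 : 1 ≤ ‖x‖ := by simpa using hxb
    have h6 : ‖x‖ ^ a ≤ (1 + ‖x‖) ^ M := by
      rw [← Real.rpow_natCast]
      exact (Real.rpow_le_rpow_of_exponent_le hx1 haM).trans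
        (Real.rpow_le_rpow hx0.le (by linarith) (Nat.cast_nonneg _))
    have h7 : C * ((1 + ‖x‖) ^ (-((n + 1 + M : ℕ) : ℝ)) * ‖x‖ ^ a) ≤
        C * (1 + ‖x‖) ^ (-((n : ℝ) + 1)) := by
      rw [← h2]; gcongr
    linarith

theorem rpow_le_of_le {δ r a : ℝ} {M : ℕ} (hδ : 0 < δ) (hr : δ ≤ r) (ha : a ≤ M) :
    r ^ a ≤ δ ^ (a - M) * r ^ M := by
  have hr0 : 0 < r := hδ.trans_le hr
  have h1 : r ^ (a - M) ≤ δ ^ (a - M) :=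
    Real.rpow_le_rpow_of_nonpos hδ hr (by linarith)
  calc r ^ a = r ^ (a - M) * r ^ M := by
        rw [← Real.rpow_natCast, ← Real.rpow_add hr0]; simp
    _ ≤ _ := by gcongr

/-- Polynomial growth away from the origin. -/
theorem IsLogHomogFun.exists_bound_off_ball {s : ℝ} {w q : E n → ℂ} (h : IsLogHomogFun s w q)
    (hw : SmoothOffZero w) (hq : SmoothOffZero q) {δ : ℝ} (hδ : 0 < δ) :
    ∃ (C : ℝ) (M : ℕ), 0 ≤ C ∧ ∀ x, δ ≤ ‖x‖ → ‖w x‖ ≤ C * ‖x‖ ^ M := by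
  obtain ⟨C, hC0, hC⟩ := h.exists_bound hw hq one_pos
  obtain ⟨M, hM⟩ := exists_nat_ge (s + 1)
  refine ⟨C * (δ ^ (s - 1 - M) + δ ^ (s + 1 - M)), M, by positivity, fun x hx => ?_⟩
  have hx0 : x ≠ 0 := norm_pos_iff.1 (hδ.trans_le hx)
  calc ‖w x‖ ≤ C * (‖x‖ ^ (s - 1) + ‖x‖ ^ (s + 1)) := hC x hx0
    _ ≤ C * (δ ^ (s - 1 - M) * ‖x‖ ^ M + δ ^ (s + 1 - M) * ‖x‖ ^ M) := by
        gcongr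
        · exact rpow_le_of_le hδ hx (by linarith)
        · exact rpow_le_of_le hδ hx (by linarith)
    _ = _ := by ring

theorem IsLogHomogFun.isTemperedFun (hn : 1 ≤ n) {s : ℝ} (hs : -(n : ℝ) < s) {w q : E n → ℂ}
    (h : IsLogHomogFun s w q) (hw : SmoothOffZero w) (hq : SmoothOffZero q) :
    IsTemperedFun w := by
  -- Half the distance from s to the critical degree, so that s - ε is still larger than -n.
  set ε : ℝ := (s + n) / 2 with hε
  have hε0 : 0 < ε := by rw [hε]; linarith
  obtain ⟨C, hC0, hC⟩ := h.exists_bound hw hq hε0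
  obtain ⟨M, hM⟩ := exists_nat_ge (max (s + ε) 0)
  refine isTemperedFun_of_bound hn (hw.aestronglyMeasurable hn) (C := 2 * C) (a := s - ε) (M := M)
    (by positivity) (by rw [hε]; linarith) (fun x hx => (hC x hx).trans ?_)
    (by linarith [le_max_left (s + ε) 0])
  have hx0 : 0 < ‖x‖ := norm_pos_iff.2 hx
  have h1 : ‖x‖ ^ (s + ε) ≤ ‖x‖ ^ (s - ε) + (1 + ‖x‖) ^ M := by
    rcases le_total ‖x‖ 1 with h1 | h1
    · have := Real.rpow_le_rpow_of_exponent_ge hx0 h1 (show s - ε ≤ s + ε by linarith)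
      have : 0 ≤ (1 + ‖x‖) ^ M := by positivity
      linarith
    · have h2 : ‖x‖ ^ (s + ε) ≤ (1 + ‖x‖) ^ M := by
        rw [← Real.rpow_natCast]
        exact (Real.rpow_le_rpow_of_exponent_le h1 ((le_max_left _ _).trans hM)).trans
          (Real.rpow_le_rpow hx0.le (by linarith) (Nat.cast_nonneg _))
      have : 0 ≤ ‖x‖ ^ (s - ε) := by positivity
      linarith
  have h2 : 0 ≤ (1 + ‖x‖) ^ M := by positivity
  nlinarith [mul_le_mul_of_nonneg_left h1 hC0, mul_nonneg hC0 h2]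

theorem IsPatch.eventually_zero {θ : E n → ℝ} (hθ : IsPatch θ) :
    ∀ᶠ x in nhds (0 : E n), θ x = 0 := by
  obtain ⟨χ, hχ, h⟩ := hθ
  filter_upwards [hχ.eq_one] with x hx
  rw [h, hx, sub_self]

theorem IsPatch.abs_le_one {θ : E n → ℝ} (hθ : IsPatch θ) (x : E n) : |θ x| ≤ 1 := by
  obtain ⟨χ, hχ, h⟩ := hθ
  rw [h, abs_le]
  have := hχ.nonneg x
  have := hχ.le_one x
  constructor <;> linarith

theorem IsPatch.ofReal_smooth {θ : E n → ℝ} (hθ : IsPatch θ) :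
    ContDiff ℝ ∞ (fun x => (θ x : ℂ)) := hθ.temperate.1

theorem IsPatch.smooth {θ : E n → ℝ} (hθ : IsPatch θ) : ContDiff ℝ ∞ θ := by
  obtain ⟨χ, hχ, h⟩ := hθ
  rw [show θ = fun x => 1 - χ x from funext h]
  exact contDiff_const.sub hχ.smooth

theorem IsPatch.isTemperedFun_mul (hn : 1 ≤ n) {θ : E n → ℝ} (hθ : IsPatch θ) {s : ℝ}
    {w q : E n → ℂ} (h : IsLogHomogFun s w q) (hw : SmoothOffZero w) (hq : SmoothOffZero q) :
    IsTemperedFun (fun x => (θ x : ℂ) * w x) := by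
  obtain ⟨δ, hδ, hball⟩ := Metric.eventually_nhds_iff.1 hθ.eventually_zero
  obtain ⟨C, M, hC, hb⟩ := h.exists_bound_off_ball hw hq hδ
  refine isTemperedFun_of_bound hn (C := C) (a := 0) (M := M) ?_ hC (by simp; omega)
    (fun x hx => ?_) (Nat.cast_nonneg M)
  · exact (contDiff_mul_of_eventually_zero hθ.ofReal_smooth (by
      filter_upwards [hθ.eventually_zero] with x hx; simp [hx]) hw).continuous.aestronglyMeasurable
  · rcases lt_or_ge ‖x‖ δ with h1 | h1
    · rw [hball (by simpa using h1)]
      simp only [Complex.ofReal_zero, zero_mul, norm_zero]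
      positivity
    · rw [norm_mul, Complex.norm_real, Real.norm_eq_abs]
      calc |θ x| * ‖w x‖ ≤ 1 * (C * ‖x‖ ^ M) := by
            gcongr
            · exact hθ.abs_le_one x
            · exact hb x h1
        _ ≤ C * (‖x‖ ^ (0 : ℝ) + (1 + ‖x‖) ^ M) := by
            rw [one_mul]
            gcongr
            have h2 : ‖x‖ ^ M ≤ (1 + ‖x‖) ^ M := by gcongr; linarith
            have h3 : 0 ≤ ‖x‖ ^ (0 : ℝ) := by positivity
            exact h2.trans (le_add_of_nonneg_left h3)

/-! ### Products with functions vanishing near the origin -/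

theorem AgreesOffZero.mulDist_patch {T : 𝓢'(E n, ℂ)} {w : E n → ℂ} (hT : AgreesOffZero T w)
    {θ : E n → ℝ} (hθ : IsPatch θ) (ht : IsTemperedFun (fun x => (θ x : ℂ) * w x)) :
    mulDist θ T = ofFun _ ht := by
  refine dist_ext fun φ => ?_
  have h1 : (fun x => w x * mulS (fun x => (θ x : ℂ)) φ x) = fun x => (θ x : ℂ) * w x * φ x := by
    ext x
    rw [mulS_apply hθ.temperate]; ring
  rw [mulDist_apply, hT.apply_eq, ofFun_apply, h1]
  · filter_upwards [hθ.eventually_zero] with x hx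
    rw [mulS_apply hθ.temperate, hx]; simp
  · rw [h1]; exact ht.integrable_mul φ

/-- Such products see only the smooth function w on an annular region. They arise as differences of
two cutoffs and as derivatives of one, so all such changes cost only a Schwartz function. -/
theorem AgreesOffZero.mulDist_compact {T : 𝓢'(E n, ℂ)} {w : E n → ℂ} (hT : AgreesOffZero T w)
    (hw : SmoothOffZero w) {η : E n → ℝ} (hη : ContDiff ℝ ∞ η) (hc : HasCompactSupport η)
    (h0 : ∀ᶠ x in nhds (0 : E n), η x = 0) :
    ∃ g : 𝓢(E n, ℂ), mulDist η T = ofSchwartz g := by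
  have hs : ContDiff ℝ ∞ (fun x => (η x : ℂ)) := Complex.ofRealCLM.contDiff.comp hη
  have hcs : HasCompactSupport (fun x => (η x : ℂ)) :=
    hc.comp_left (g := fun r : ℝ => (r : ℂ)) Complex.ofReal_zero
  have ht : (fun x => (η x : ℂ)).HasTemperateGrowth := hcs.hasTemperateGrowth hs
  have h0' : ∀ᶠ x in nhds (0 : E n), (η x : ℂ) = 0 := by
    filter_upwards [h0] with x hx; simp [hx]
  let g : 𝓢(E n, ℂ) := HasCompactSupport.toSchwartzMap (f := fun x => (η x : ℂ) * w x)
    hcs.mul_right (contDiff_mul_of_eventually_zero hs h0' hw)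
  refine ⟨g, dist_ext fun φ => ?_⟩
  rw [mulDist_apply, ofSchwartz_apply, hT]
  · refine integral_congr_ae (.of_forall fun x => ?_)
    simp only [mulS_apply ht]
    change _ = φ x * ((η x : ℂ) * w x)
    ring
  · rw [coe_mulS ht]; exact hcs.mul_right
  · rw [zero_notMem_tsupport_iff]
    filter_upwards [h0'] with x hx
    rw [mulS_apply ht, hx, zero_mul]

theorem SmoothOffZero.integrable_mul {w : E n → ℂ} (hw : SmoothOffZero w) {φ : E n → ℂ}
    (hφ : ContDiff ℝ ∞ φ) (hc : HasCompactSupport φ) (h0 : (0 : E n) ∉ tsupport φ) :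
    Integrable (fun x => w x * φ x) := by
  simp only [mul_comm (w _)]
  exact (contDiff_mul_of_eventually_zero hφ ((zero_notMem_tsupport_iff φ).1 h0)
    hw).continuous.integrable_of_hasCompactSupport hc.mul_right

theorem SmoothOffZero.fderiv_apply {w : E n → ℂ} (hw : SmoothOffZero w) (v : E n) :
    SmoothOffZero (fun x => fderiv ℝ w x v) := by
  refine smoothOffZero_of_contDiffAt fun x hx => ?_
  exact ((hw.contDiffAt hx).fderiv_right (m := ∞) le_rfl).clm_apply contDiffAt_const

theorem AgreesOffZero.lineDerivOp {T : 𝓢'(E n, ℂ)} {w : E n → ℂ} (hT : AgreesOffZero T w)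
    (hw : SmoothOffZero w) (v : E n) :
    AgreesOffZero (∂_{v} T) (fun x => fderiv ℝ w x v) := by
  intro φ hc h0
  rw [TemperedDistribution.lineDerivOp_apply_apply]
  have hsub : tsupport (∂_{v} φ : 𝓢(E n, ℂ)) ⊆ tsupport φ := tsupport_lineDerivOp_subset v φ
  have hc' : HasCompactSupport (∂_{v} φ : 𝓢(E n, ℂ)) := hc.of_isClosed_subset (isClosed_tsupport _) hsub
  have h0' : (0 : E n) ∉ tsupport (∂_{v} φ : 𝓢(E n, ℂ)) := fun h => h0 (hsub h)
  have h1 := integral_mul_fderiv_eq_neg_fderiv_mul_of_integrable (μ := (volume : Measure (E n)))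
    (f := w) (g := φ) (v := v)
    ((hw.fderiv_apply v).integrable_mul (φ.smooth ⊤) hc h0)
    (hw.integrable_mul ((∂_{v} φ : 𝓢(E n, ℂ)).smooth ⊤) hc' h0') (hw.integrable_mul (φ.smooth ⊤) hc h0)
    (fun x hx => (hw.contDiffAt fun h => h0 (h ▸ hx)).differentiableAt (by simp))
    (fun x _ => φ.differentiableAt)
  rw [map_neg, hT _ hc' h0']
  exact neg_eq_iff_eq_neg.2 h1

/-- Euler's relation: the scaling law is differentiated in t at t = 1, where the logarithm
contributes q. -/
theorem IsLogHomogFun.fderiv_self {s : ℝ} {w q : E n → ℂ} (h : IsLogHomogFun s w q)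
    (hw : SmoothOffZero w) {x : E n} (hx : x ≠ 0) : fderiv ℝ w x x = s * w x + q x := by
  have h1 : HasDerivAt (fun t : ℝ => w (t • x)) (fderiv ℝ w x x) 1 := by
    have hd : HasFDerivAt w (fderiv ℝ w x) ((1 : ℝ) • x) := by
      rw [one_smul]
      exact ((hw.contDiffAt hx).differentiableAt (by simp)).hasFDerivAt
    have := hd.comp_hasDerivAt (1 : ℝ) ((hasDerivAt_id (1 : ℝ)).smul_const x)
    simpa [Function.comp_def] using this
  have h2 : HasDerivAt (fun t : ℝ => ((t ^ s : ℝ) : ℂ) * (w x + (Real.log t : ℂ) * q x))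
      (s * w x + q x) 1 := by
    have ha : HasDerivAt (fun t : ℝ => ((t ^ s : ℝ) : ℂ)) (s : ℂ) 1 := by
      have := (Real.hasDerivAt_rpow_const (x := 1) (p := s) (Or.inl one_ne_zero)).ofReal_comp
      simpa using this
    have hb : HasDerivAt (fun t : ℝ => w x + (Real.log t : ℂ) * q x) (q x) 1 := by
      have := ((Real.hasDerivAt_log one_ne_zero).ofReal_comp.mul_const (q x)).const_add (w x)
      simpa using this
    have := ha.fun_mul hb
    simpa using this
  refine h1.unique (h2.congr_of_eventuallyEq ?_)
  filter_upwards [lt_mem_nhds (zero_lt_one (α := ℝ))] with t ht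
  exact h x hx t ht

theorem sum_smul_single (x : E n) :
    ∑ j, x j • (EuclideanSpace.single j (1 : ℝ) : E n) = x := by
  ext i
  simp [Finset.sum_apply, Pi.single_apply]

/-- Euler's relation in divergence form. -/
theorem IsLogHomogFun.sum_fderiv_coord_mul {s : ℝ} {w q : E n → ℂ} (h : IsLogHomogFun s w q)
    (hw : SmoothOffZero w) {x : E n} (hx : x ≠ 0) :
    ∑ j, fderiv ℝ (fun y => (y j : ℂ) * w y) x (EuclideanSpace.single j (1 : ℝ)) =
      (n + s : ℝ) * w x + q x := by
  have hd := (hw.contDiffAt hx).differentiableAt (by simp)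
  have h1 : ∀ j : Fin n, fderiv ℝ (fun y => (y j : ℂ) * w y) x (EuclideanSpace.single j (1 : ℝ)) =
      (x j : ℂ) * fderiv ℝ w x (EuclideanSpace.single j (1 : ℝ)) + w x := by
    intro j
    have hc : HasFDerivAt (fun y : E n => (y j : ℂ))
        (Complex.ofRealCLM.comp (EuclideanSpace.proj (𝕜 := ℝ) j : E n →L[ℝ] ℝ)) x :=
      (Complex.ofRealCLM.comp (EuclideanSpace.proj (𝕜 := ℝ) j : E n →L[ℝ] ℝ)).hasFDerivAt
    rw [(hc.fun_mul hd.hasFDerivAt).fderiv]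
    simp
  have h2 : ∑ j, (x j : ℂ) * fderiv ℝ w x (EuclideanSpace.single j (1 : ℝ)) = fderiv ℝ w x x := by
    conv_rhs => rw [← sum_smul_single x]
    simp only [map_sum, map_smul, Complex.real_smul]
    rw [sum_smul_single x]
  simp only [h1, Finset.sum_add_distrib, h2, h.fderiv_self hw hx]
  simp
  ring

/-! ### Superpositions of dilations -/

/-- A measurable function on `(0, 1)` that is bounded by a negative power. -/
structure IsKernel (κ : ℝ → ℝ) : Prop where
  meas : Measurable κ
  bound : ∃ (C : ℝ) (M : ℕ), 0 ≤ C ∧ ∀ l ∈ Set.Ioo (0 : ℝ) 1, |κ l| ≤ C * l⁻¹ ^ M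

theorem IsKernel.mul_inv {κ : ℝ → ℝ} (hκ : IsKernel κ) : IsKernel (fun l => κ l * l⁻¹) := by
  obtain ⟨C, M, hC, h⟩ := hκ.bound
  refine ⟨hκ.meas.mul measurable_inv, C, M + 1, hC, fun l hl => ?_⟩
  have h1 : 0 < l⁻¹ := inv_pos.2 hl.1
  rw [abs_mul, abs_of_pos h1, pow_succ, ← mul_assoc]
  exact mul_le_mul_of_nonneg_right (h l hl) h1.le

theorem IsKernel.mul_inv_pow {κ : ℝ → ℝ} (hκ : IsKernel κ) (m : ℕ) :
    IsKernel (fun l => κ l * (l ^ m)⁻¹) := by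
  induction m with
  | zero => simpa using hκ
  | succ m ih =>
    have h : (fun l : ℝ => κ l * (l ^ (m + 1))⁻¹) = fun l => κ l * (l ^ m)⁻¹ * l⁻¹ := by
      ext l; rw [pow_succ, _root_.mul_inv, mul_assoc]
    rw [h]
    exact ih.mul_inv

theorem isKernel_rpow (a : ℝ) : IsKernel (fun l => l ^ a) := by
  obtain ⟨M, hM⟩ := exists_nat_ge (-a)
  refine ⟨by fun_prop, 1, M, zero_le_one, fun l hl => ?_⟩
  rw [abs_of_pos (Real.rpow_pos_of_pos hl.1 _), one_mul, inv_pow, ← Real.rpow_natCast,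
    ← Real.rpow_neg hl.1.le]
  exact Real.rpow_le_rpow_of_exponent_ge hl.1 hl.2.le (by linarith)

theorem IsKernel.mul_log {κ : ℝ → ℝ} (hκ : IsKernel κ) : IsKernel (fun l => κ l * Real.log l) := by
  obtain ⟨C, M, hC, h⟩ := hκ.bound
  refine ⟨hκ.meas.mul Real.measurable_log, C, M + 1, hC, fun l hl => ?_⟩
  have h1 : 0 < l⁻¹ := inv_pos.2 hl.1
  have h2 : |Real.log l| ≤ l⁻¹ := by
    rw [abs_of_neg (Real.log_neg hl.1 hl.2), ← Real.log_inv]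
    linarith [Real.log_le_sub_one_of_pos h1]
  rw [abs_mul, pow_succ, ← mul_assoc]
  exact mul_le_mul (h l hl) h2 (abs_nonneg _) (by positivity)

theorem IsKernel.neg {κ : ℝ → ℝ} (hκ : IsKernel κ) : IsKernel (fun l => -κ l) := by
  obtain ⟨C, M, hC, h⟩ := hκ.bound
  exact ⟨hκ.meas.neg, C, M, hC, fun l hl => by rw [abs_neg]; exact h l hl⟩

/-- `ξ ↦ ∫₀¹ κ(λ) h(ξ / λ) dλ`. -/
def radialInt {F : Type} [NormedAddCommGroup F] [NormedSpace ℝ F] (κ : ℝ → ℝ) (h : E n → F)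
    (ξ : E n) : F := ∫ l in Set.Ioo (0 : ℝ) 1, κ l • h (l⁻¹ • ξ)

section

variable {F : Type} [NormedAddCommGroup F] [NormedSpace ℝ F]

/-- Rapid decay makes h(ξ/λ) of size (λ/‖ξ‖)^(M+k), which cancels the singularity λ^(-M) of the
kernel and leaves k extra powers of decay in ξ. -/
theorem IsKernel.exists_norm_le {κ : ℝ → ℝ} (hκ : IsKernel κ) (h : 𝓢(E n, F)) :
    ∃ (C : ℕ → ℝ) (M : ℕ), (∀ k, 0 ≤ C k) ∧ ∀ k, ∀ l ∈ Set.Ioo (0 : ℝ) 1, ∀ ξ : E n, ξ ≠ 0 →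
      ‖κ l • h (l⁻¹ • ξ)‖ ≤ C k * ‖ξ‖⁻¹ ^ (M + k) := by
  obtain ⟨C, M, hC, hb⟩ := hκ.bound
  refine ⟨fun k => C * SchwartzMap.seminorm ℝ (M + k) 0 h, M,
    fun k => mul_nonneg hC (apply_nonneg _ _), fun k l hl ξ hξ => ?_⟩
  have hl0 : 0 < l⁻¹ := inv_pos.2 hl.1
  have hξ0 : 0 < ‖ξ‖ := norm_pos_iff.2 hξ
  have h1 := SchwartzMap.norm_pow_mul_le_seminorm ℝ h (M + k) (l⁻¹ • ξ)
  rw [norm_smul, Real.norm_of_nonneg hl0.le, mul_pow] at h1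
  have h2 : l⁻¹ ^ M ≤ l⁻¹ ^ (M + k) :=
    pow_le_pow_right₀ ((one_le_inv₀ hl.1).2 hl.2.le) (Nat.le_add_right _ _)
  rw [norm_smul, Real.norm_eq_abs]
  calc |κ l| * ‖h (l⁻¹ • ξ)‖ ≤ C * l⁻¹ ^ (M + k) * ‖h (l⁻¹ • ξ)‖ := by
        gcongr
        exact (hb l hl).trans (by gcongr)
    _ = C * (l⁻¹ ^ (M + k) * ‖ξ‖ ^ (M + k) * ‖h (l⁻¹ • ξ)‖) * ‖ξ‖⁻¹ ^ (M + k) := by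
        rw [inv_pow ‖ξ‖]
        field_simp
    _ ≤ C * SchwartzMap.seminorm ℝ (M + k) 0 h * ‖ξ‖⁻¹ ^ (M + k) := by gcongr

theorem IsKernel.aestronglyMeasurable {κ : ℝ → ℝ} (hκ : IsKernel κ) (h : 𝓢(E n, F)) (ξ : E n) :
    AEStronglyMeasurable (fun l => κ l • h (l⁻¹ • ξ)) (volume.restrict (Set.Ioo (0 : ℝ) 1)) := by
  refine hκ.meas.aestronglyMeasurable.smul ?_
  refine ContinuousOn.aestronglyMeasurable ?_ measurableSet_Ioo
  exact h.continuous.comp_continuousOn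
    ((continuousOn_inv₀.mono fun l hl => (Set.mem_Ioo.1 hl).1.ne').smul continuousOn_const)

theorem IsKernel.integrable {κ : ℝ → ℝ} (hκ : IsKernel κ) (h : 𝓢(E n, F)) {ξ : E n} (hξ : ξ ≠ 0) :
    IntegrableOn (fun l => κ l • h (l⁻¹ • ξ)) (Set.Ioo (0 : ℝ) 1) := by
  obtain ⟨C, M, hC, hb⟩ := hκ.exists_norm_le h
  have hfin : IntegrableOn (fun _ : ℝ => C 0 * ‖ξ‖⁻¹ ^ (M + 0)) (Set.Ioo (0 : ℝ) 1) :=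
    integrableOn_const (by simp)
  refine Integrable.mono' hfin (hκ.aestronglyMeasurable h ξ) ?_
  filter_upwards [ae_restrict_mem measurableSet_Ioo] with l hl
  exact hb 0 l hl ξ hξ

/-- Differentiation under the integral produces an integral of the same kind, with kernel κ/λ and
with the derivative of h. Hence F is general and kernels may have any negative power: induction on
the order of differentiation stays inside the class. -/
theorem IsKernel.hasFDerivAt_radialInt {κ : ℝ → ℝ} (hκ : IsKernel κ) (h : 𝓢(E n, F)) {ξ : E n}
    (hξ : ξ ≠ 0) : HasFDerivAt (radialInt κ h)
      (radialInt (fun l => κ l * l⁻¹) (fderivCLM ℝ (E n) F h) ξ) ξ := by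
  obtain ⟨C, M, hC, hb⟩ := hκ.mul_inv.exists_norm_le (fderivCLM ℝ (E n) F h)
  have hξ0 : 0 < ‖ξ‖ := norm_pos_iff.2 hξ
  have hball : ∀ x ∈ Metric.ball ξ (‖ξ‖ / 2), ‖ξ‖ / 2 ≤ ‖x‖ := by
    intro x hx
    rw [Metric.mem_ball, dist_eq_norm] at hx
    have := norm_sub_norm_le ξ x
    rw [norm_sub_rev] at this
    linarith
  refine hasFDerivAt_integral_of_dominated_of_fderiv_le
    (F := fun ξ l => κ l • h (l⁻¹ • ξ))
    (F' := fun ξ l => (κ l * l⁻¹) • fderivCLM ℝ (E n) F h (l⁻¹ • ξ))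
    (bound := fun _ => C 0 * (‖ξ‖ / 2)⁻¹ ^ (M + 0))
    (Metric.ball_mem_nhds ξ (half_pos hξ0)) (.of_forall fun x => hκ.aestronglyMeasurable h x)
    (hκ.integrable h hξ) (hκ.mul_inv.aestronglyMeasurable _ ξ) ?_ ?_ ?_
  · filter_upwards [ae_restrict_mem measurableSet_Ioo] with l hl x hx
    have h1 := hball x hx
    have hx0 : 0 < ‖x‖ := (half_pos hξ0).trans_le h1
    refine (hb 0 l hl x (norm_pos_iff.1 hx0)).trans ?_
    have := hC 0
    gcongr
  · exact integrableOn_const (by simp)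
  · filter_upwards with l x _
    have h1 : HasFDerivAt (fun y : E n => l⁻¹ • y) (l⁻¹ • ContinuousLinearMap.id ℝ (E n)) x :=
      (hasFDerivAt_id x).fun_const_smul _
    have h2 := ((h.hasFDerivAt (l⁻¹ • x)).comp x h1).const_smul (κ l)
    refine h2.congr_fderiv ?_
    ext v
    simp [smul_smul]

end

theorem IsKernel.contDiffOn_radialInt (m : ℕ) {F : Type} [NormedAddCommGroup F] [NormedSpace ℝ F]
    {κ : ℝ → ℝ} (hκ : IsKernel κ) (h : 𝓢(E n, F)) : ContDiffOn ℝ m (radialInt κ h) {0}ᶜ := by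
  induction m generalizing F κ with
  | zero =>
    exact contDiffOn_zero.2 fun ξ hξ =>
      (hκ.hasFDerivAt_radialInt h hξ).continuousAt.continuousWithinAt
  | succ m ih =>
    push_cast
    rw [contDiffOn_succ_iff_fderiv_of_isOpen isOpen_compl_singleton]
    refine ⟨fun ξ hξ => (hκ.hasFDerivAt_radialInt h hξ).differentiableAt.differentiableWithinAt,
      by simp, (ih hκ.mul_inv (fderivCLM ℝ (E n) F h)).congr fun ξ hξ =>
        (hκ.hasFDerivAt_radialInt h hξ).fderiv⟩

theorem IsKernel.exists_decay_radialInt (m : ℕ) {F : Type} [NormedAddCommGroup F]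
    [NormedSpace ℝ F] {κ : ℝ → ℝ} (hκ : IsKernel κ) (h : 𝓢(E n, F)) (k : ℕ) {δ : ℝ} (hδ : 0 < δ) :
    ∃ C : ℝ, 0 ≤ C ∧ ∀ ξ, δ ≤ ‖ξ‖ → ‖ξ‖ ^ k * ‖iteratedFDeriv ℝ m (radialInt κ h) ξ‖ ≤ C := by
  induction m generalizing F κ with
  | zero =>
    obtain ⟨C, M, hC, hb⟩ := hκ.exists_norm_le h
    refine ⟨C k * δ⁻¹ ^ M, mul_nonneg (hC k) (by positivity), fun ξ hξ => ?_⟩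
    have hξ0 : 0 < ‖ξ‖ := hδ.trans_le hξ
    rw [norm_iteratedFDeriv_zero]
    have h1 : ‖radialInt κ h ξ‖ ≤ C k * ‖ξ‖⁻¹ ^ (M + k) := by
      have := norm_setIntegral_le_of_norm_le_const (μ := volume) (s := Set.Ioo (0 : ℝ) 1)
        (f := fun l => κ l • h (l⁻¹ • ξ)) (by simp)
        (fun l hl => hb k l hl ξ (norm_pos_iff.1 hξ0))
      simpa [radialInt] using this
    calc ‖ξ‖ ^ k * ‖radialInt κ h ξ‖ ≤ ‖ξ‖ ^ k * (C k * ‖ξ‖⁻¹ ^ (M + k)) := by gcongr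
      _ = C k * ‖ξ‖⁻¹ ^ M := by
        rw [pow_add, inv_pow, inv_pow]; field_simp
      _ ≤ _ := by
        have := hC k
        gcongr
  | succ m ih =>
    obtain ⟨C, hC, hb⟩ := ih hκ.mul_inv (fderivCLM ℝ (E n) F h)
    refine ⟨C, hC, fun ξ hξ => ?_⟩
    have hξ0 : ξ ≠ 0 := norm_pos_iff.1 (hδ.trans_le hξ)
    rw [← norm_iteratedFDeriv_fderiv]
    have h1 : fderiv ℝ (radialInt κ h) =ᶠ[nhds ξ]
        radialInt (fun l => κ l * l⁻¹) (fderivCLM ℝ (E n) F h) := by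
      filter_upwards [isOpen_compl_singleton.mem_nhds hξ0] with x hx
      exact (hκ.hasFDerivAt_radialInt h hx).fderiv
    rw [Filter.EventuallyEq.eq_of_nhds (h1.iteratedFDeriv ℝ m)]
    exact hb ξ hξ

theorem IsKernel.smoothOffZero_radialInt {κ : ℝ → ℝ} (hκ : IsKernel κ) (h : 𝓢(E n, ℂ)) :
    SmoothOffZero (radialInt κ h) :=
  contDiffOn_infty.2 fun m => hκ.contDiffOn_radialInt m h

/-! ### From rapid decay off the origin to Schwartz functions, and transforms of superpositions. -/

theorem IsPatch.bounded_iteratedFDeriv {θ : E n → ℝ} (hθ : IsPatch θ) (j : ℕ) :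
    ∃ C : ℝ, 0 ≤ C ∧ ∀ x, ‖iteratedFDeriv ℝ j (fun x => (θ x : ℂ)) x‖ ≤ C := by
  obtain ⟨χ, hχ, h⟩ := hθ
  obtain ⟨C, hC, hb⟩ := hχ.bounded_iteratedFDeriv j
  refine ⟨C, hC, fun x => ?_⟩
  have : (fun x => (θ x : ℂ)) = -fun x => (χ x : ℂ) - 1 := by
    ext x; simp [h]
  rw [this, iteratedFDeriv_neg, Pi.neg_apply, norm_neg]
  exact hb x

/-- A function that is smooth and rapidly decreasing off the origin becomes a Schwartz function
after multiplication with a patch function. -/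
theorem IsPatch.exists_schwartz {θ : E n → ℝ} (hθ : IsPatch θ) {v : E n → ℂ}
    (hv : SmoothOffZero v)
    (hd : ∀ (k m : ℕ) (δ : ℝ), 0 < δ →
      ∃ C : ℝ, 0 ≤ C ∧ ∀ ξ, δ ≤ ‖ξ‖ → ‖ξ‖ ^ k * ‖iteratedFDeriv ℝ m v ξ‖ ≤ C) :
    ∃ g : 𝓢(E n, ℂ), ∀ ξ, g ξ = θ ξ * v ξ := by
  have h0 : ∀ᶠ x in nhds (0 : E n), (θ x : ℂ) = 0 := by
    filter_upwards [hθ.eventually_zero] with x hx; simp [hx]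
  have hsm := contDiff_mul_of_eventually_zero hθ.ofReal_smooth h0 hv
  obtain ⟨δ, hδ, hball⟩ := Metric.eventually_nhds_iff.1 h0
  refine ⟨⟨fun ξ => θ ξ * v ξ, hsm, fun k m => ?_⟩, fun ξ => rfl⟩
  choose A hA0 hA using hθ.bounded_iteratedFDeriv
  choose B hB0 hB using fun j => hd k j δ hδ
  refine ⟨∑ i ∈ Finset.range (m + 1), (m.choose i : ℝ) * (A i * B (m - i)), fun ξ => ?_⟩
  rcases lt_or_ge ‖ξ‖ δ with h1 | h1
  · have h2 : (fun ξ => (θ ξ : ℂ) * v ξ) =ᶠ[nhds ξ] fun _ => 0 := by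
      filter_upwards [Metric.isOpen_ball.mem_nhds (show ξ ∈ Metric.ball (0 : E n) δ by simpa using h1)]
        with x hx
      rw [hball hx, zero_mul]
    rw [Filter.EventuallyEq.eq_of_nhds (h2.iteratedFDeriv ℝ m)]
    have : iteratedFDeriv ℝ m (fun _ : E n => (0 : ℂ)) ξ = 0 := by
      simp [iteratedFDeriv_fun_zero]
    rw [this, norm_zero, mul_zero]
    exact Finset.sum_nonneg fun i _ => by have := hA0 i; have := hB0 (m - i); positivity
  · have hξ : ξ ∈ ({0}ᶜ : Set (E n)) := norm_pos_iff.1 (hδ.trans_le h1)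
    have ho : IsOpen ({0}ᶜ : Set (E n)) := isOpen_compl_singleton
    have h2 := norm_iteratedFDerivWithin_mul_le (n := m) (N := ∞)
      hθ.ofReal_smooth.contDiffOn hv ho.uniqueDiffOn hξ (by exact_mod_cast le_top)
    rw [iteratedFDerivWithin_of_isOpen m ho hξ] at h2
    refine (mul_le_mul_of_nonneg_left h2 (by positivity)).trans ?_
    rw [Finset.mul_sum]
    refine Finset.sum_le_sum fun i _ => ?_
    rw [iteratedFDerivWithin_of_isOpen i ho hξ, iteratedFDerivWithin_of_isOpen (m - i) ho hξ]
    calc _ = (m.choose i : ℝ) * (‖iteratedFDeriv ℝ i (fun x => (θ x : ℂ)) ξ‖ *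
          (‖ξ‖ ^ k * ‖iteratedFDeriv ℝ (m - i) v ξ‖)) := by ring
      _ ≤ _ := by
        have := hA0 i
        gcongr
        · exact hA i ξ
        · exact hB (m - i) ξ h1

theorem exists_norm_le_pow {f : 𝓢(E n, ℂ)} (h0 : ∀ᶠ x in nhds (0 : E n), f x = 0) (k : ℕ) :
    ∃ C : ℝ, 0 ≤ C ∧ ∀ x, ‖f x‖ ≤ C * ‖x‖ ^ k := by
  obtain ⟨δ, hδ, hball⟩ := Metric.eventually_nhds_iff.1 h0
  refine ⟨SchwartzMap.seminorm ℂ 0 0 f * δ⁻¹ ^ k, mul_nonneg (apply_nonneg _ _) (by positivity),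
    fun x => ?_⟩
  have hs : 0 ≤ SchwartzMap.seminorm ℂ 0 0 f := apply_nonneg _ _
  rcases lt_or_ge ‖x‖ δ with h1 | h1
  · rw [hball (by simpa using h1), norm_zero]
    positivity
  · have h2 : 1 ≤ δ⁻¹ ^ k * ‖x‖ ^ k := by
      rw [← mul_pow]
      refine one_le_pow₀ ?_
      rw [inv_mul_eq_div]
      exact (one_le_div hδ).2 h1
    rw [mul_assoc]
    exact (norm_le_seminorm ℂ f x).trans (le_mul_of_one_le_right hs h2)

/-- For each λ this is self-adjointness of the Fourier transform applied to the dilate f(λ ·), and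
Fubini on both sides integrates it in λ. Absolute convergence at λ = 0 comes on the left from the
vanishing of f near 0, on the right from that of ψ. -/
theorem IsKernel.integral_mul_fourierS {κ : ℝ → ℝ} (hκ : IsKernel κ) {f ψ : 𝓢(E n, ℂ)}
    (hf : ∀ᶠ x in nhds (0 : E n), f x = 0) (hψ : ∀ᶠ x in nhds (0 : E n), ψ x = 0) :
    Integrable (fun x => (∫ l in Set.Ioo (0 : ℝ) 1, κ l • f (l • x)) * fourierS ψ x) ∧
    Integrable (fun ξ => radialInt (fun l => κ l * (l ^ n)⁻¹) (fourierS f) ξ * ψ ξ) ∧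
    ∫ x, (∫ l in Set.Ioo (0 : ℝ) 1, κ l • f (l • x)) * fourierS ψ x =
      ∫ ξ, radialInt (fun l => κ l * (l ^ n)⁻¹) (fourierS f) ξ * ψ ξ := by
  set ν : Measure ℝ := volume.restrict (Set.Ioo (0 : ℝ) 1) with hν
  have hae : ∀ᵐ p : E n × ℝ ∂((volume : Measure (E n)).prod ν), p.2 ∈ Set.Ioo (0 : ℝ) 1 := by
    have : (volume : Measure (E n)).prod ν =
        ((volume : Measure (E n)).prod volume).restrict (Set.univ ×ˢ Set.Ioo (0 : ℝ) 1) := by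
      rw [← Measure.prod_restrict, Measure.restrict_univ]
    rw [this]
    filter_upwards [ae_restrict_mem (MeasurableSet.univ.prod measurableSet_Ioo)] with p hp
    exact hp.2
  have h1 : Integrable (fun p : E n × ℝ => κ p.2 • f (p.2 • p.1) * fourierS ψ p.1)
      ((volume : Measure (E n)).prod ν) := by
    obtain ⟨C, M, hC, hb⟩ := hκ.bound
    obtain ⟨D, hD, hfb⟩ := exists_norm_le_pow hf M
    have hi := (((fourierS ψ).integrable_pow_mul (volume : Measure (E n)) M).const_mul (C * D)).mul_prod
      (integrable_const (1 : ℝ) : Integrable (fun _ : ℝ => (1 : ℝ)) ν)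
    refine hi.mono' ?_ ?_
    · refine Measurable.aestronglyMeasurable ?_
      have := f.continuous.measurable
      have := (fourierS ψ).continuous.measurable
      have := hκ.meas
      fun_prop
    · filter_upwards [hae] with p hp
      have hl := hp.1
      have h2 := hfb (p.2 • p.1)
      rw [norm_smul, Real.norm_of_nonneg hl.le, mul_pow] at h2
      rw [norm_mul, norm_smul, Real.norm_eq_abs, mul_one]
      calc |κ p.2| * ‖f (p.2 • p.1)‖ * ‖fourierS ψ p.1‖
          ≤ (C * p.2⁻¹ ^ M) * (D * (p.2 ^ M * ‖p.1‖ ^ M)) * ‖fourierS ψ p.1‖ := by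
            gcongr
            exact hb _ hp
        _ = C * D * (‖p.1‖ ^ M * ‖fourierS ψ p.1‖) := by
            rw [inv_pow]; field_simp
  have h2 : Integrable (fun p : E n × ℝ =>
      (κ p.2 * (p.2 ^ n)⁻¹) • fourierS f (p.2⁻¹ • p.1) * ψ p.1)
      ((volume : Measure (E n)).prod ν) := by
    obtain ⟨δ, hδ, hball⟩ := Metric.eventually_nhds_iff.1 hψ
    obtain ⟨C, M, hC, hb⟩ := (hκ.mul_inv_pow n).exists_norm_le (fourierS f)
    have hi := ((ψ.integrable (μ := (volume : Measure (E n)))).norm.const_mul (C 0 * δ⁻¹ ^ (M + 0))).mul_prod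
      (integrable_const (1 : ℝ) : Integrable (fun _ : ℝ => (1 : ℝ)) ν)
    refine hi.mono' ?_ ?_
    · refine Measurable.aestronglyMeasurable ?_
      have := ψ.continuous.measurable
      have := (fourierS f).continuous.measurable
      have := hκ.meas
      fun_prop
    · filter_upwards [hae] with p hp
      rw [mul_one]
      rcases lt_or_ge ‖p.1‖ δ with h3 | h3
      · rw [hball (by simpa using h3)]
        simp
      · rw [norm_mul]
        refine mul_le_mul_of_nonneg_right ?_ (norm_nonneg _)
        refine (hb 0 p.2 hp p.1 (norm_pos_iff.1 (hδ.trans_le h3))).trans ?_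
        have := hC 0
        gcongr
  have e1 : ∀ x, (∫ l, κ l • f (l • x) ∂ν) * fourierS ψ x =
      ∫ l, κ l • f (l • x) * fourierS ψ x ∂ν := fun x => (integral_mul_const _ _).symm
  have e2 : ∀ ξ, radialInt (fun l => κ l * (l ^ n)⁻¹) (fourierS f) ξ * ψ ξ =
      ∫ l, (κ l * (l ^ n)⁻¹) • fourierS f (l⁻¹ • ξ) * ψ ξ ∂ν :=
    fun x => (integral_mul_const _ _).symm
  simp only [e1, e2]
  refine ⟨h1.integral_prod_left, h2.integral_prod_left, ?_⟩
  refine (integral_integral_swap h1).trans (Eq.trans ?_ (integral_integral_swap h2).symm)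
  refine integral_congr_ae ?_
  filter_upwards [ae_restrict_mem measurableSet_Ioo] with l hl
  have h3 := integral_fourierS_mul (dilS l hl.1.ne' f) ψ
  rw [fourierS_dilS l hl.1] at h3
  simp only [smul_mul_assoc, integral_smul, smul_apply, dilS_apply] at h3 ⊢
  rw [← h3, mul_smul]
  congr 1
  rw [← Complex.ofReal_inv]
  rfl

/-! ### The Fourier transform of a log-homogeneous function cut off near the origin -/

/-- The radial derivative `x · ∇θ`. -/
def radialDeriv (θ : E n → ℝ) (x : E n) : ℝ := fderiv ℝ θ x x

theorem IsPatch.radialDeriv_smooth {θ : E n → ℝ} (hθ : IsPatch θ) :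
    ContDiff ℝ ∞ (radialDeriv θ) :=
  (hθ.smooth.fderiv_right (m := ∞) le_rfl).clm_apply contDiff_id

theorem IsPatch.fderiv_eq {θ : E n → ℝ} (hθ : IsPatch θ) :
    ∃ χ : E n → ℝ, IsCutoff χ ∧ fderiv ℝ θ = -fderiv ℝ χ := by
  obtain ⟨χ, hχ, h⟩ := hθ
  refine ⟨χ, hχ, ?_⟩
  rw [show θ = fun x => 1 - χ x from funext h]
  ext1 x
  exact fderiv_const_sub 1

theorem IsPatch.radialDeriv_compact {θ : E n → ℝ} (hθ : IsPatch θ) :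
    HasCompactSupport (radialDeriv θ) := by
  obtain ⟨χ, hχ, h⟩ := hθ.fderiv_eq
  have h1 : HasCompactSupport (fderiv ℝ χ) := hχ.compact.fderiv (𝕜 := ℝ)
  refine h1.mono fun x hx => ?_
  rw [Function.mem_support] at hx ⊢
  intro h0
  exact hx (by simp [radialDeriv, h, h0])

theorem IsPatch.radialDeriv_eventually_zero {θ : E n → ℝ} (hθ : IsPatch θ) :
    ∀ᶠ x in nhds (0 : E n), radialDeriv θ x = 0 := by
  have h1 : θ =ᶠ[nhds 0] fun _ => (0 : ℝ) := hθ.eventually_zero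
  filter_upwards [h1.fderiv (𝕜 := ℝ)] with x hx
  rw [radialDeriv, hx]
  simp

/-- The product of the radial derivative of a patch function and a function that is smooth off the
origin, as a Schwartz function. -/
def IsPatch.radialS {θ : E n → ℝ} (hθ : IsPatch θ) {w : E n → ℂ} (hw : SmoothOffZero w) :
    𝓢(E n, ℂ) :=
  HasCompactSupport.toSchwartzMap (f := fun x => (radialDeriv θ x : ℂ) * w x)
    (HasCompactSupport.mul_right
      (hθ.radialDeriv_compact.comp_left (g := fun r : ℝ => (r : ℂ)) Complex.ofReal_zero))
    (contDiff_mul_of_eventually_zero (Complex.ofRealCLM.contDiff.comp hθ.radialDeriv_smooth)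
      (hθ.radialDeriv_eventually_zero.mono fun x hx => by simp [hx]) hw)

theorem IsPatch.radialS_apply {θ : E n → ℝ} (hθ : IsPatch θ) {w : E n → ℂ} (hw : SmoothOffZero w)
    (x : E n) : hθ.radialS hw x = radialDeriv θ x * w x := rfl

theorem IsPatch.radialS_eventually_zero {θ : E n → ℝ} (hθ : IsPatch θ) {w : E n → ℂ}
    (hw : SmoothOffZero w) : ∀ᶠ x in nhds (0 : E n), hθ.radialS hw x = 0 := by
  filter_upwards [hθ.radialDeriv_eventually_zero] with x hx
  simp [hθ.radialS_apply, hx]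

theorem IsKernel.integrableOn_dilation {κ : ℝ → ℝ} (hκ : IsKernel κ) {f : 𝓢(E n, ℂ)}
    (hf : ∀ᶠ x in nhds (0 : E n), f x = 0) (x : E n) :
    IntegrableOn (fun l => κ l • f (l • x)) (Set.Ioo (0 : ℝ) 1) := by
  obtain ⟨C, M, hC, hb⟩ := hκ.bound
  obtain ⟨D, hD, hfb⟩ := exists_norm_le_pow hf M
  have hfin : IntegrableOn (fun _ : ℝ => C * (D * ‖x‖ ^ M)) (Set.Ioo (0 : ℝ) 1) :=
    integrableOn_const (by simp)
  refine Integrable.mono' hfin ?_ ?_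
  · have := f.continuous.measurable
    have := hκ.meas
    refine Measurable.aestronglyMeasurable ?_
    fun_prop
  · filter_upwards [ae_restrict_mem measurableSet_Ioo] with l hl
    have h2 := hfb (l • x)
    have hl0 := hl.1
    rw [norm_smul, Real.norm_of_nonneg hl.1.le, mul_pow] at h2
    rw [norm_smul, Real.norm_eq_abs]
    calc |κ l| * ‖f (l • x)‖ ≤ (C * l⁻¹ ^ M) * (D * (l ^ M * ‖x‖ ^ M)) := by
          gcongr
          exact hb l hl
      _ = _ := by
          rw [inv_pow]; field_simp

theorem IsPatch.integral_fderiv {θ : E n → ℝ} (hθ : IsPatch θ) (x : E n) :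
    ∫ l in Set.Ioo (0 : ℝ) 1, fderiv ℝ θ (l • x) x = θ x := by
  rw [← integral_Ioc_eq_integral_Ioo, ← intervalIntegral.integral_of_le zero_le_one]
  have hd : ∀ l ∈ Set.uIcc (0 : ℝ) 1, HasDerivAt (fun l : ℝ => θ (l • x)) (fderiv ℝ θ (l • x) x) l := by
    intro l _
    have h1 := (hθ.smooth.differentiable (by simp) (l • x)).hasFDerivAt
    have := h1.comp_hasDerivAt l ((hasDerivAt_id l).smul_const x)
    simpa [Function.comp_def] using this
  rw [intervalIntegral.integral_eq_sub_of_hasDerivAt hd]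
  · rw [one_smul, zero_smul, hθ.eventually_zero.self_of_nhds, sub_zero]
  · refine Continuous.intervalIntegrable ?_ _ _
    exact ((hθ.smooth.continuous_fderiv (by simp)).comp (by fun_prop)).clm_apply continuous_const

/-- A log-homogeneous function that is cut off near the origin is a superposition of dilations of
two test functions. -/
theorem IsPatch.mul_eq_integral {θ : E n → ℝ} (hθ : IsPatch θ) {s : ℝ} {w q : E n → ℂ}
    (h : IsLogHomogFun s w q) (hq' : IsHomogFun s q) (hw : SmoothOffZero w) (hq : SmoothOffZero q)
    {x : E n} (hx : x ≠ 0) :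
    (θ x : ℂ) * w x = (∫ l in Set.Ioo (0 : ℝ) 1, (l ^ (-s - 1)) • hθ.radialS hw (l • x)) +
      ∫ l in Set.Ioo (0 : ℝ) 1, (-(l ^ (-s - 1) * Real.log l)) • hθ.radialS hq (l • x) := by
  rw [← integral_add ((isKernel_rpow _).integrableOn_dilation (hθ.radialS_eventually_zero hw) x)
    ((isKernel_rpow _).mul_log.neg.integrableOn_dilation (hθ.radialS_eventually_zero hq) x)]
  -- Here θ(x) is the integral over (0, 1) of d/dλ θ(λx), because θ(0) = 0. The scaling law rewrites
  -- w(x) through w(λx), and the term with q removes the logarithm this creates.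
  rw [← hθ.integral_fderiv x, ← integral_complex_ofReal, ← integral_mul_const]
  refine setIntegral_congr_fun measurableSet_Ioo fun l hl => ?_
  simp only [hθ.radialS_apply, radialDeriv, h x hx l hl.1, hq' x hx l hl.1, map_smul,
    Complex.real_smul, smul_eq_mul]
  have h1 : ((l ^ (-s - 1) : ℝ) : ℂ) * ((l : ℂ) * ((l ^ s : ℝ) : ℂ)) = 1 := by
    have h2 : l * l ^ s = l ^ (1 + s) := by rw [Real.rpow_add hl.1, Real.rpow_one]
    rw [← Complex.ofReal_mul, ← Complex.ofReal_mul, h2, ← Real.rpow_add hl.1,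
      show -s - 1 + (1 + s) = 0 by ring, Real.rpow_zero, Complex.ofReal_one]
  push_cast
  linear_combination (-(fderiv ℝ θ (l • x) x : ℂ) * w x) * h1

/-- The Fourier transform of `θ w`, for `w` log-homogeneous and `θ` a patch function, is off the
origin a smooth function which is rapidly decreasing with all derivatives. -/
theorem IsPatch.exists_fourierD_eq (hn : 1 ≤ n) {θ : E n → ℝ} (hθ : IsPatch θ) {s : ℝ}
    {w q : E n → ℂ} (h : IsLogHomogFun s w q) (hq' : IsHomogFun s q) (hw : SmoothOffZero w)
    (hq : SmoothOffZero q) (ht : IsTemperedFun (fun x => (θ x : ℂ) * w x)) :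
    ∃ v : E n → ℂ, SmoothOffZero v ∧
      (∀ η : E n → ℝ, IsPatch η → ∃ g : 𝓢(E n, ℂ), ∀ ξ, g ξ = η ξ * v ξ) ∧
      ∀ ψ : 𝓢(E n, ℂ), (∀ᶠ x in nhds (0 : E n), ψ x = 0) →
        Integrable (fun ξ => v ξ * ψ ξ) ∧ fourierD (ofFun _ ht) ψ = ∫ ξ, v ξ * ψ ξ := by
  have k1 : IsKernel (fun l => l ^ (-s - 1)) := isKernel_rpow _
  have k2 : IsKernel (fun l => -(l ^ (-s - 1) * Real.log l)) := k1.mul_log.neg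
  refine ⟨fun ξ => radialInt (fun l => l ^ (-s - 1) * (l ^ n)⁻¹) (fourierS (hθ.radialS hw)) ξ +
    radialInt (fun l => -(l ^ (-s - 1) * Real.log l) * (l ^ n)⁻¹) (fourierS (hθ.radialS hq)) ξ,
    ((k1.mul_inv_pow n).smoothOffZero_radialInt _).add
      ((k2.mul_inv_pow n).smoothOffZero_radialInt _), fun η hη => ?_, fun ψ hψ => ?_⟩
  · obtain ⟨g1, hg1⟩ := hη.exists_schwartz ((k1.mul_inv_pow n).smoothOffZero_radialInt
      (fourierS (hθ.radialS hw))) fun k m δ hδ => (k1.mul_inv_pow n).exists_decay_radialInt m _ k hδ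
    obtain ⟨g2, hg2⟩ := hη.exists_schwartz ((k2.mul_inv_pow n).smoothOffZero_radialInt
      (fourierS (hθ.radialS hq))) fun k m δ hδ => (k2.mul_inv_pow n).exists_decay_radialInt m _ k hδ
    refine ⟨g1 + g2, fun ξ => ?_⟩
    rw [add_apply, hg1, hg2, mul_add]
  · obtain ⟨a1, b1, c1⟩ := k1.integral_mul_fourierS (hθ.radialS_eventually_zero hw) hψ
    obtain ⟨a2, b2, c2⟩ := k2.integral_mul_fourierS (hθ.radialS_eventually_zero hq) hψ
    have e1 : (fun ξ => (radialInt (fun l => l ^ (-s - 1) * (l ^ n)⁻¹) (fourierS (hθ.radialS hw)) ξ +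
        radialInt (fun l => -(l ^ (-s - 1) * Real.log l) * (l ^ n)⁻¹)
          (fourierS (hθ.radialS hq)) ξ) * ψ ξ) = fun ξ =>
        radialInt (fun l => l ^ (-s - 1) * (l ^ n)⁻¹) (fourierS (hθ.radialS hw)) ξ * ψ ξ +
        radialInt (fun l => -(l ^ (-s - 1) * Real.log l) * (l ^ n)⁻¹)
          (fourierS (hθ.radialS hq)) ξ * ψ ξ := by
      ext ξ; ring
    rw [e1]
    refine ⟨b1.add b2, ?_⟩
    rw [integral_add b1 b2, ← c1, ← c2, ← integral_add a1 a2, fourierD_apply, ofFun_apply]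
    refine integral_congr_ae ?_
    filter_upwards [ae_ne_zero hn] with x hx
    rw [hθ.mul_eq_integral h hq' hw hq hx]
    ring

/-! ### Distributions with smooth Fourier transform -/

/-- The Fourier transform of `T` is a smooth function. -/
def HasSmoothFourier (T : 𝓢'(E n, ℂ)) : Prop :=
  ∃ v : E n → ℂ, ContDiff ℝ ∞ v ∧
    ∀ φ : 𝓢(E n, ℂ), HasCompactSupport φ → fourierD T φ = ∫ ξ, v ξ * φ ξ

theorem integrable_smooth_mul {v : E n → ℂ} (hv : ContDiff ℝ ∞ v) {φ : 𝓢(E n, ℂ)}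
    (hφ : HasCompactSupport φ) : Integrable (fun ξ => v ξ * φ ξ) :=
  (hv.continuous.mul φ.continuous).integrable_of_hasCompactSupport hφ.mul_left

theorem HasSmoothFourier.add {S T : 𝓢'(E n, ℂ)} (hS : HasSmoothFourier S)
    (hT : HasSmoothFourier T) : HasSmoothFourier (S + T) := by
  obtain ⟨v, hv, h⟩ := hS
  obtain ⟨w, hw, h'⟩ := hT
  refine ⟨fun x => v x + w x, hv.add hw, fun φ hφ => ?_⟩
  rw [fourierD_add, dist_add_apply, h φ hφ, h' φ hφ,
    ← integral_add (integrable_smooth_mul hv hφ) (integrable_smooth_mul hw hφ)]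
  simp only [add_mul]

theorem HasSmoothFourier.smul {T : 𝓢'(E n, ℂ)} (hT : HasSmoothFourier T) (c : ℂ) :
    HasSmoothFourier (c • T) := by
  obtain ⟨v, hv, h⟩ := hT
  refine ⟨fun x => c * v x, contDiff_const.mul hv, fun φ hφ => ?_⟩
  rw [fourierD_smul, dist_smul_apply, h φ hφ, ← integral_const_mul]
  simp only [mul_assoc]

theorem hasSmoothFourier_zero : HasSmoothFourier (0 : 𝓢'(E n, ℂ)) :=
  ⟨fun _ => 0, contDiff_const, fun φ _ => by simp [fourierD_zero]⟩

theorem hasSmoothFourier_ofSchwartz (g : 𝓢(E n, ℂ)) : HasSmoothFourier (ofSchwartz g) := by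
  refine ⟨fourierS g, (fourierS g).smooth ⊤, fun φ _ => ?_⟩
  rw [fourierD_ofSchwartz, ofSchwartz_apply]
  simp only [mul_comm]

theorem HasSmoothFourier.dOp {T : 𝓢'(E n, ℂ)} (hT : HasSmoothFourier T) (j : Fin n) :
    HasSmoothFourier (dOp j T) := by
  obtain ⟨v, hv, h⟩ := hT
  refine ⟨fun x => (x j : ℂ) * v x, (contDiff_coord j).mul hv, fun φ hφ => ?_⟩
  rw [fourierD_dOp, h]
  · refine integral_congr_ae (.of_forall fun x => ?_)
    simp only [mulS_apply (hasTemperateGrowth_coord j)]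
    ring
  · rw [coe_mulS (hasTemperateGrowth_coord j)]
    exact hφ.mul_left

/-- Every localization of `T` by a cutoff function has smooth Fourier transform. -/
def HasSmoothLocalFourier (T : 𝓢'(E n, ℂ)) : Prop :=
  ∀ χ : E n → ℝ, IsCutoff χ → HasSmoothFourier (mulDist χ T)

theorem HasSmoothLocalFourier.add {S T : 𝓢'(E n, ℂ)} (hS : HasSmoothLocalFourier S)
    (hT : HasSmoothLocalFourier T) : HasSmoothLocalFourier (S + T) := fun χ hχ => by
  rw [mulDist_add]; exact (hS χ hχ).add (hT χ hχ)

theorem HasSmoothLocalFourier.smul {T : 𝓢'(E n, ℂ)} (hT : HasSmoothLocalFourier T) (c : ℂ) :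
    HasSmoothLocalFourier (c • T) := fun χ hχ => by
  rw [mulDist_smul]; exact (hT χ hχ).smul c

theorem hasSmoothLocalFourier_zero : HasSmoothLocalFourier (0 : 𝓢'(E n, ℂ)) := fun χ _ => by
  rw [mulDist, map_zero]; exact hasSmoothFourier_zero

theorem hasSmoothLocalFourier_sum {ι : Type*} (s : Finset ι) {T : ι → 𝓢'(E n, ℂ)}
    (hT : ∀ i ∈ s, HasSmoothLocalFourier (T i)) : HasSmoothLocalFourier (∑ i ∈ s, T i) := by
  classical
  induction s using Finset.induction_on with
  | empty => simpa using hasSmoothLocalFourier_zero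
  | insert a s ha ih =>
    rw [Finset.sum_insert ha]
    exact (hT a (by simp)).add (ih fun i hi => hT i (by simp [hi]))

/-- By the product rule, χ D_j T = D_j(χT) + i(∂_jχ)T, and ∂_jχ vanishes near the origin, so the
last term is a test function. -/
theorem HasSmoothLocalFourier.dOp {T : 𝓢'(E n, ℂ)} (hT : HasSmoothLocalFourier T)
    {w : E n → ℂ} (hw : SmoothOffZero w) (hTw : AgreesOffZero T w) (j : Fin n) :
    HasSmoothLocalFourier (dOp j T) := by
  intro χ hχ
  set e : E n := EuclideanSpace.single j (1 : ℝ) with he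
  let η : E n → ℝ := fun x => fderiv ℝ χ x e
  have hη : ContDiff ℝ ∞ η := (hχ.smooth.fderiv_right (m := ∞) le_rfl).clm_apply contDiff_const
  have hηc : HasCompactSupport η := hχ.compact.fderiv_apply (𝕜 := ℝ) e
  have hη0 : ∀ᶠ x in nhds (0 : E n), η x = 0 := by
    have h1 : χ =ᶠ[nhds 0] fun _ => (1 : ℝ) := hχ.eq_one
    filter_upwards [h1.fderiv (𝕜 := ℝ)] with x hx
    simp only [η, hx]
    simp
  have hηt : (fun x => (η x : ℂ)).HasTemperateGrowth :=
    (hηc.comp_left (g := fun r : ℝ => (r : ℂ)) Complex.ofReal_zero).hasTemperateGrowth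
      (Complex.ofRealCLM.contDiff.comp hη)
  obtain ⟨g, hg⟩ := hTw.mulDist_compact hw hη hηc hη0
  have key : mulDist χ (HomogDistr.dOp j T) =
      Complex.I • ofSchwartz g + HomogDistr.dOp j (mulDist χ T) := by
    refine dist_ext fun φ => ?_
    rw [← hg, dist_add_apply, dist_smul_apply, dOp_apply, mulDist_apply, mulDist_apply, dOp_apply,
      mulDist_apply, ← mul_add, ← map_add]
    congr 2
    ext x
    rw [add_apply, mulS_apply hηt, mulS_apply hχ.temperate, lineDerivOp_apply_eq_fderiv,
      lineDerivOp_apply_eq_fderiv, coe_mulS hχ.temperate]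
    have h1 : HasFDerivAt (fun y => (χ y : ℂ)) (Complex.ofRealCLM.comp (fderiv ℝ χ x)) x :=
      Complex.ofRealCLM.hasFDerivAt.comp x (hχ.smooth.differentiable (by simp) x).hasFDerivAt
    rw [(h1.fun_mul (φ.differentiableAt (x := x)).hasFDerivAt).fderiv]
    simp [η, he]
    ring
  rw [key]
  exact ((hasSmoothFourier_ofSchwartz g).smul _).add ((hT χ hχ).dOp j)

/-! ### Localizations of functions -/

/-- The bilinear form `(2 π)⁻¹ x · ξ`. -/
def scaledInner (n : ℕ) : E n →L[ℝ] E n →L[ℝ] ℝ := (2 * Real.pi)⁻¹ • innerSL ℝ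

theorem fourierS_eq_fourierIntegral (φ : 𝓢(E n, ℂ)) (x : E n) :
    fourierS φ x =
      VectorFourier.fourierIntegral Real.fourierChar volume (scaledInner n).toLinearMap₁₂.flip φ x := by
  rw [fourierS_apply, VectorFourier.fourierIntegral]
  refine integral_congr_ae (.of_forall fun y => ?_)
  have hpi : (Real.pi : ℂ) ≠ 0 := by exact_mod_cast Real.pi_ne_zero
  have : (scaledInner n).toLinearMap₁₂.flip y x = (2 * Real.pi)⁻¹ * inner ℝ x y := rfl
  simp only [this, Circle.smul_def, Real.fourierChar_apply, smul_eq_mul]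
  rw [mul_comm, real_inner_comm]
  congr 2
  push_cast
  field_simp

/-- The function χw is integrable with compact support, so all its moments are finite and its
Fourier integral can be differentiated arbitrarily often. -/
theorem hasSmoothLocalFourier_ofFun {w : E n → ℂ} (hw : IsTemperedFun w) :
    HasSmoothLocalFourier (ofFun w hw) := by
  intro χ hχ
  have hf : Integrable (fun x => w x * hχ.toS x) := hw.integrable_mul hχ.toS
  obtain ⟨R, hR⟩ := hχ.compact.isCompact.isBounded.exists_norm_le
  refine ⟨VectorFourier.fourierIntegral Real.fourierChar volume (scaledInner n).toLinearMap₁₂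
    (fun x => w x * hχ.toS x), ?_, fun φ _ => ?_⟩
  · refine VectorFourier.contDiff_fourierIntegral (N := ⊤) (scaledInner n) fun k _ => ?_
    refine (hf.norm.const_mul (R ^ k)).mono' ?_ (.of_forall fun x => ?_)
    · exact ((continuous_norm.pow k).aestronglyMeasurable).mul hf.aestronglyMeasurable.norm
    · by_cases hx : x ∈ tsupport χ
      · rw [norm_mul, norm_norm, norm_pow, norm_norm]
        have := hR x hx
        gcongr
      · have : hχ.toS x = 0 := by
          rw [hχ.toS_apply, image_eq_zero_of_notMem_tsupport hx, Complex.ofReal_zero]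
        simp [this]
  · rw [fourierD_apply, mulDist_apply, ofFun_apply]
    have h := VectorFourier.integral_fourierIntegral_smul_eq_flip (f := fun x => w x * hχ.toS x)
      (g := φ) (μ := volume) (ν := volume) (L := (scaledInner n).toLinearMap₁₂)
      Real.continuous_fourierChar (scaledInner n).continuous₂ hf φ.integrable
    simp only [smul_eq_mul] at h
    rw [h]
    refine integral_congr_ae (.of_forall fun x => ?_)
    simp only [mulS_apply hχ.temperate, ← fourierS_eq_fourierIntegral, hχ.toS_apply]
    ring

/-! ### Homogeneous distributions supported at the origin -/

theorem exists_iteratedLineDerivOp_fourierS (j : ℕ) (m : Fin j → Fin n) :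
    ∃ p : E n → ℂ, ContDiff ℝ ∞ p ∧ ∀ φ : 𝓢(E n, ℂ),
      (∂^{fun i => (EuclideanSpace.single (m i) (1 : ℝ) : E n)} (fourierS φ)) 0 =
        ∫ x, p x * φ x := by
  induction j with
  | zero =>
    refine ⟨fun _ => 1, contDiff_const, fun φ => ?_⟩
    rw [iteratedLineDerivOp_fin_zero, fourierS_apply]
    simp
  | succ j ih =>
    obtain ⟨p, hp, h⟩ := ih (Fin.init m)
    refine ⟨fun x => -Complex.I * (p x * (x (m (Fin.last j)) : ℂ)),
      contDiff_const.mul (hp.mul (contDiff_coord _)), fun φ => ?_⟩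
    rw [iteratedLineDerivOp_succ_right, lineDerivOp_fourierS, iteratedLineDerivOp_smul, smul_apply]
    have := h (mulS (fun x => (x (m (Fin.last j)) : ℂ)) φ)
    refine (congrArg (fun z => -Complex.I • z) this).trans ?_
    rw [smul_eq_mul, ← integral_const_mul]
    refine integral_congr_ae (.of_forall fun x => ?_)
    simp only [mulS_apply (hasTemperateGrowth_coord _)]
    ring

/-- The localisation χT equals T, and T depends only on finitely many derivatives at 0, so it is a
combination of them; derivatives of φ̂ at 0 are integrals of φ against smooth functions. -/
theorem hasSmoothLocalFourier_of_supported_zero {T : 𝓢'(E n, ℂ)} {s : ℝ}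
    (hT : AgreesOffZero T 0) (hs : IsHomogDist s T) : HasSmoothLocalFourier T := by
  intro χ hχ
  have hloc : mulDist χ T = T := by
    refine dist_ext fun φ => ?_
    have h2 : T (φ - mulS (fun x => (χ x : ℂ)) φ) =
        ∫ x, (0 : E n → ℂ) x * (φ - mulS (fun x => (χ x : ℂ)) φ) x := by
      refine hT.apply_eq ?_ (by simp)
      filter_upwards [hχ.eq_one] with x hx
      rw [sub_apply, mulS_apply hχ.temperate, hx]
      simp
    rw [map_sub] at h2
    simp only [Pi.zero_apply, zero_mul, integral_zero] at h2
    exact (sub_eq_zero.1 h2).symm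
  rw [hloc]
  obtain ⟨N, hN⟩ := exists_nat_gt (-(n : ℝ) - s)
  let L : (Σ j : Fin N, Fin j → Fin n) → 𝓢(E n, ℂ) →ₗ[ℂ] ℂ := fun i =>
    { toFun := fun φ => (∂^{fun k => (EuclideanSpace.single (i.2 k) (1 : ℝ) : E n)} φ) 0
      map_add' := fun φ ψ => by rw [iteratedLineDerivOp_add]; rfl
      map_smul' := fun c φ => by rw [iteratedLineDerivOp_smul]; rfl }
  let K : 𝓢(E n, ℂ) →ₗ[ℂ] ℂ :=
    { toFun := fun φ => T φ
      map_add' := map_add T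
      map_smul' := map_smul T }
  have hK : K ∈ Submodule.span ℂ (Set.range L) := by
    -- A functional vanishing on the common kernel of finitely many functionals is a combination of
    -- them. The family `L` runs over the derivatives at 0 along coordinate directions of order less
    -- than N.
    refine mem_span_of_iInf_ker_le_ker fun φ hφ => ?_
    rw [LinearMap.mem_ker]
    refine apply_eq_zero_of_isHomogDist hT hs N hN φ fun j hj => ?_
    refine ContinuousMultilinearMap.toMultilinearMap_injective ?_
    refine Module.Basis.ext_multilinear (fun _ => (EuclideanSpace.basisFun (Fin n) ℝ).toBasis)
      fun v => ?_
    have h1 : L ⟨⟨j, hj⟩, v⟩ φ = 0 := by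
      have := (Submodule.mem_iInf _).1 hφ ⟨⟨j, hj⟩, v⟩
      rwa [LinearMap.mem_ker] at this
    have h2 : (∂^{fun k => (EuclideanSpace.single (v k) (1 : ℝ) : E n)} φ) 0 = 0 := h1
    rw [iteratedLineDerivOp_eq_iteratedFDeriv] at h2
    simpa using h2
  obtain ⟨c, hc⟩ := (Submodule.mem_span_range_iff_exists_fun ℂ).1 hK
  choose p hp hpe using fun i : (Σ j : Fin N, Fin j → Fin n) =>
    exists_iteratedLineDerivOp_fourierS (i.1 : ℕ) i.2
  refine ⟨fun x => ∑ i, c i * p i x, ContDiff.sum fun i _ => contDiff_const.mul (hp i),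
    fun φ hφ => ?_⟩
  have h1 : fourierD T φ = ∑ i, c i * ∫ x, p i x * φ x := by
    have := congrArg (fun l : 𝓢(E n, ℂ) →ₗ[ℂ] ℂ => l (fourierS φ)) hc
    simp only [LinearMap.sum_apply, LinearMap.smul_apply, smul_eq_mul] at this
    rw [fourierD_apply]
    refine this.symm.trans (Finset.sum_congr rfl fun i _ => ?_)
    rw [← hpe i φ]
    rfl
  rw [h1]
  simp only [← integral_const_mul]
  rw [← integral_finsetSum _ fun i _ => (integrable_smooth_mul (hp i) hφ).const_mul (c i)]
  refine integral_congr_ae (.of_forall fun x => ?_)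
  simp only [Finset.sum_mul, mul_assoc]

/-! ### Restrictions to the complement of the origin -/

theorem AgreesOffZero.congr {T : 𝓢'(E n, ℂ)} {v w : E n → ℂ} (hT : AgreesOffZero T v)
    (h : ∀ x, x ≠ 0 → v x = w x) : AgreesOffZero T w := by
  intro φ hc h0
  rw [hT φ hc h0]
  refine integral_congr_ae (.of_forall fun x => ?_)
  by_cases hx : x = 0
  · simp [hx, image_eq_zero_of_notMem_tsupport h0]
  · simp [h x hx]

theorem AgreesOffZero.add {S T : 𝓢'(E n, ℂ)} {v w : E n → ℂ} (hS : AgreesOffZero S v)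
    (hT : AgreesOffZero T w) (hv : SmoothOffZero v) (hw : SmoothOffZero w) :
    AgreesOffZero (S + T) (fun x => v x + w x) := by
  intro φ hc h0
  rw [dist_add_apply, hS φ hc h0, hT φ hc h0, ← integral_add (hv.integrable_mul (φ.smooth ⊤) hc h0)
    (hw.integrable_mul (φ.smooth ⊤) hc h0)]
  simp only [add_mul]

theorem AgreesOffZero.smul {T : 𝓢'(E n, ℂ)} {w : E n → ℂ} (hT : AgreesOffZero T w) (c : ℂ) :
    AgreesOffZero (c • T) (fun x => c * w x) := by
  intro φ hc h0
  rw [dist_smul_apply, hT φ hc h0, ← integral_const_mul]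
  simp only [mul_assoc]

theorem AgreesOffZero.sub {S T : 𝓢'(E n, ℂ)} {v w : E n → ℂ} (hS : AgreesOffZero S v)
    (hT : AgreesOffZero T w) (hv : SmoothOffZero v) (hw : SmoothOffZero w) :
    AgreesOffZero (S - T) (fun x => v x - w x) := by
  intro φ hc h0
  rw [dist_sub_apply, hS φ hc h0, hT φ hc h0, ← integral_sub (hv.integrable_mul (φ.smooth ⊤) hc h0)
    (hw.integrable_mul (φ.smooth ⊤) hc h0)]
  simp only [sub_mul]

theorem smoothOffZero_zero : SmoothOffZero (0 : E n → ℂ) := contDiffOn_const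

theorem SmoothOffZero.const_mul {w : E n → ℂ} (hw : SmoothOffZero w) (c : ℂ) :
    SmoothOffZero (fun x => c * w x) := contDiffOn_const.mul hw

theorem SmoothOffZero.sum {ι : Type*} (s : Finset ι) {w : ι → E n → ℂ}
    (hw : ∀ i ∈ s, SmoothOffZero (w i)) : SmoothOffZero (fun x => ∑ i ∈ s, w i x) :=
  ContDiffOn.sum hw

theorem agreesOffZero_zero : AgreesOffZero (0 : 𝓢'(E n, ℂ)) 0 := fun φ _ _ => by simp

theorem agreesOffZero_sum {ι : Type*} (s : Finset ι) {T : ι → 𝓢'(E n, ℂ)} {w : ι → E n → ℂ}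
    (hT : ∀ i ∈ s, AgreesOffZero (T i) (w i)) (hw : ∀ i ∈ s, SmoothOffZero (w i)) :
    AgreesOffZero (∑ i ∈ s, T i) (fun x => ∑ i ∈ s, w i x) := by
  classical
  induction s using Finset.induction_on with
  | empty => simp only [Finset.sum_empty]; exact agreesOffZero_zero
  | insert a s ha ih =>
    simp only [Finset.sum_insert ha]
    exact (hT a (by simp)).add (ih (fun i hi => hT i (by simp [hi])) fun i hi => hw i (by simp [hi]))
      (hw a (by simp)) (SmoothOffZero.sum s fun i hi => hw i (by simp [hi]))

theorem AgreesOffZero.dOp {T : 𝓢'(E n, ℂ)} {w : E n → ℂ} (hT : AgreesOffZero T w)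
    (hw : SmoothOffZero w) (j : Fin n) : AgreesOffZero (dOp j T)
      (fun x => -Complex.I * fderiv ℝ w x (EuclideanSpace.single j (1 : ℝ))) :=
  (hT.lineDerivOp hw _).smul _

theorem AgreesOffZero.dOp_zero {T : 𝓢'(E n, ℂ)} (hT : AgreesOffZero T 0) (j : Fin n) :
    AgreesOffZero (HomogDistr.dOp j T) 0 :=
  (hT.dOp smoothOffZero_zero j).congr fun x _ => by simp

theorem agreesOffZero_delta : AgreesOffZero (TemperedDistribution.delta (0 : E n)) 0 := by
  intro φ _ h0
  simp [image_eq_zero_of_notMem_tsupport h0]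

theorem agreesOffZero_polyDelta (P : MvPolynomial (Fin n) ℂ) : AgreesOffZero (polyDelta P) 0 := by
  have h1 : ∀ α : Fin n →₀ ℕ,
      AgreesOffZero (dPow α (TemperedDistribution.delta (0 : E n))) 0 := by
    intro α
    rw [dPow]
    induction List.finRange n with
    | nil => exact agreesOffZero_delta
    | cons j l ih =>
      rw [List.foldr_cons]
      induction α j with
      | zero => exact ih
      | succ m ihm => rw [Function.iterate_succ_apply']; exact ihm.dOp_zero j
  refine (agreesOffZero_sum P.support (fun α _ => (h1 α).smul (P.coeff α)) fun α _ => ?_).congr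
    fun x _ => by simp
  exact smoothOffZero_zero.const_mul _

theorem agreesOffZero_ofFun {w : E n → ℂ} (hw : IsTemperedFun w) : AgreesOffZero (ofFun w hw) w :=
  fun φ _ _ => ofFun_apply w hw φ

theorem agreesOffZero_polyLog (Q : MvPolynomial (Fin n) ℂ) :
    AgreesOffZero (polyLog Q) (fun x => polyEval Q x * (Real.log ‖x‖ : ℂ)) :=
  fun φ _ _ => polyLog_apply Q φ

theorem dil_dOp (t : ℝ) (ht : 0 < t) (j : Fin n) (T : 𝓢'(E n, ℂ)) :
    dil t ht (dOp j T) = ((t⁻¹ : ℝ) : ℂ) • dOp j (dil t ht T) := by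
  refine dist_ext fun φ => ?_
  rw [dil_apply, dOp_apply, dist_smul_apply, dOp_apply, dil_apply]
  have h : ∂_{(EuclideanSpace.single j (1 : ℝ) : E n)} (dilS t⁻¹ (inv_ne_zero ht.ne') φ) =
      ((t⁻¹ : ℝ) : ℂ) • dilS t⁻¹ (inv_ne_zero ht.ne')
        (∂_{(EuclideanSpace.single j (1 : ℝ) : E n)} φ) := by
    ext x
    rw [smul_apply, dilS_apply, lineDerivOp_apply_eq_fderiv, lineDerivOp_apply_eq_fderiv]
    have : (dilS t⁻¹ (inv_ne_zero ht.ne') φ : E n → ℂ) = fun x => φ (t⁻¹ • x) := rfl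
    rw [this, fderiv_comp_smul]
    simp
  rw [h, map_smul, smul_eq_mul]
  ring

theorem dil_ofFun (hn : 1 ≤ n) {s : ℝ} {w q : E n → ℂ} (h : IsLogHomogFun s w q)
    (hw : IsTemperedFun w) (hq : IsTemperedFun q) (t : ℝ) (ht : 0 < t) :
    dil t ht (ofFun w hw) =
      ((t ^ s : ℝ) : ℂ) • (ofFun w hw + ((Real.log t : ℝ) : ℂ) • ofFun q hq) := by
  refine dist_ext fun φ => ?_
  rw [dil_apply, dist_smul_apply, dist_add_apply, dist_smul_apply]
  simp only [ofFun_apply]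
  have h1 := integral_comp_smul_E (fun x => w x * dilS t⁻¹ (inv_ne_zero ht.ne') φ x) ht
  rw [Complex.real_smul, Complex.ofReal_inv] at h1
  rw [← h1, ← integral_const_mul, ← integral_add (hw.integrable_mul φ)
    ((hq.integrable_mul φ).const_mul _), ← integral_const_mul]
  refine integral_congr_ae ?_
  filter_upwards [ae_ne_zero hn] with x hx
  simp only [dilS_apply, h x hx t ht, smul_smul, inv_mul_cancel₀ ht.ne', one_smul]
  ring

/-! ### Divergences -/

/-- The divergence `∑ⱼ ∂ⱼ Vⱼ`. -/
def divD (V : Fin n → 𝓢'(E n, ℂ)) : 𝓢'(E n, ℂ) := ∑ j, Complex.I • dOp j (V j)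

theorem dOp_add (j : Fin n) (S T : 𝓢'(E n, ℂ)) : dOp j (S + T) = dOp j S + dOp j T := by
  refine dist_ext fun φ => ?_
  simp only [dOp_apply, dist_add_apply, mul_add]

theorem dOp_smul (j : Fin n) (c : ℂ) (T : 𝓢'(E n, ℂ)) : dOp j (c • T) = c • dOp j T := by
  refine dist_ext fun φ => ?_
  simp only [dOp_apply, dist_smul_apply]
  ring

theorem divD_add (V W : Fin n → 𝓢'(E n, ℂ)) :
    divD (fun j => V j + W j) = divD V + divD W := by
  simp only [divD, dOp_add, smul_add, Finset.sum_add_distrib]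

theorem divD_smul (c : ℂ) (V : Fin n → 𝓢'(E n, ℂ)) : divD (fun j => c • V j) = c • divD V := by
  simp only [divD, dOp_smul, Finset.smul_sum, smul_comm c]

theorem dil_divD (t : ℝ) (ht : 0 < t) (V : Fin n → 𝓢'(E n, ℂ)) :
    dil t ht (divD V) = ((t⁻¹ : ℝ) : ℂ) • divD (fun j => dil t ht (V j)) := by
  simp only [divD, dil_sum, dil_smul, dil_dOp, Finset.smul_sum, smul_comm Complex.I]

theorem divD_polyDelta (P : Fin n → MvPolynomial (Fin n) ℂ) :
    divD (fun j => polyDelta (P j)) = polyDelta (∑ j, Complex.I • (MvPolynomial.X j * P j)) := by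
  simp only [divD, polyDelta_sum, polyDelta_smul, dOp_polyDelta]

/-- Recovers a function from the less singular fields x_j w: through the first term if n + s ≠ 0,
and through q if n + s = 0. -/
theorem agreesOffZero_divD {s : ℝ} {w q : E n → ℂ} (h : IsLogHomogFun s w q)
    (hw : SmoothOffZero w) {V : Fin n → 𝓢'(E n, ℂ)}
    (hV : ∀ j, AgreesOffZero (V j) (fun x => (x j : ℂ) * w x)) :
    AgreesOffZero (divD V) (fun x => (n + s : ℝ) * w x + q x) := by
  have hs : ∀ j, SmoothOffZero (fun x : E n => (x j : ℂ) * w x) := fun j =>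
    (smoothOffZero_of_contDiff (contDiff_coord j)).mul hw
  refine (agreesOffZero_sum Finset.univ (fun j _ => ((hV j).dOp (hs j) j).smul Complex.I)
    fun j _ => (((hs j).fderiv_apply _).const_mul _).const_mul _).congr fun x hx => ?_
  rw [← h.sum_fderiv_coord_mul hw hx]
  refine Finset.sum_congr rfl fun j _ => ?_
  rw [← mul_assoc]
  simp

theorem hasSmoothLocalFourier_divD {w : E n → ℂ} (hw : SmoothOffZero w)
    {V : Fin n → 𝓢'(E n, ℂ)} (hV : ∀ j, AgreesOffZero (V j) (fun x => (x j : ℂ) * w x))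
    (hF : ∀ j, HasSmoothLocalFourier (V j)) : HasSmoothLocalFourier (divD V) :=
  hasSmoothLocalFourier_sum _ fun j _ =>
    ((hF j).dOp ((smoothOffZero_of_contDiff (contDiff_coord j)).mul hw) (hV j) j).smul _

/-! ### Existence of prolongations -/

theorem rpow_add_one_mul_inv {t : ℝ} (ht : 0 < t) (s : ℝ) :
    ((t⁻¹ : ℝ) : ℂ) * ((t ^ (s + 1) : ℝ) : ℂ) = ((t ^ s : ℝ) : ℂ) := by
  rw [← Complex.ofReal_mul, Real.rpow_add ht, Real.rpow_one]
  congr 1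
  field_simp

theorem isTemperedFun_zero : IsTemperedFun (0 : E n → ℂ) :=
  ⟨0, by simp⟩

theorem isProlongation_ofFun (hn : 1 ≤ n) {s : ℝ} {u : E n → ℂ} (hu' : IsHomogFun s u)
    (ht : IsTemperedFun u) : IsProlongation s u (ofFun u ht) := by
  refine ⟨agreesOffZero_ofFun ht, fun t ht0 => ⟨0, IsHomogPoly.zero _, ?_⟩⟩
  rw [dil_ofFun hn hu'.isLogHomogFun ht isTemperedFun_zero, polyDelta_zero]
  refine dist_ext fun φ => ?_
  simp only [dist_sub_apply, dist_smul_apply, dist_add_apply, ofFun_apply, dist_zero_apply]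
  simp

/-- At the critical degree the prolongation is div(x u log|x|). Its defect is t^(-n) log t times S =
div(xu), which is homogeneous of degree -n and vanishes off the origin, hence is a multiple of δ₀.
-/
theorem exists_isProlongation_neg (hn : 1 ≤ n) {u : E n → ℂ} (hu : SmoothOffZero u)
    (hu' : IsHomogFun (-(n : ℝ)) u) :
    ∃ T : 𝓢'(E n, ℂ), IsProlongation (-(n : ℝ)) u T ∧ HasSmoothLocalFourier T := by
  have hc : ∀ j, SmoothOffZero (fun x : E n => (x j : ℂ) * u x) := fun j =>
    (smoothOffZero_of_contDiff (contDiff_coord j)).mul hu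
  have hul : SmoothOffZero (fun x : E n => u x * (Real.log ‖x‖ : ℂ)) := hu.mul smoothOffZero_log
  have hdeg : -(n : ℝ) < -(n : ℝ) + 1 := by linarith
  have hq : ∀ j, IsTemperedFun (fun x : E n => (x j : ℂ) * u x) := fun j =>
    (hu'.coord_mul j).isLogHomogFun.isTemperedFun hn hdeg (hc j) smoothOffZero_zero
  have hlog : ∀ j, IsLogHomogFun (-(n : ℝ) + 1) (fun x : E n => (x j : ℂ) * (u x * (Real.log ‖x‖ : ℂ)))
      (fun x => (x j : ℂ) * u x) := by
    intro j
    simpa only [mul_assoc] using (hu'.coord_mul j).mul_log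
  have hw : ∀ j, IsTemperedFun (fun x : E n => (x j : ℂ) * (u x * (Real.log ‖x‖ : ℂ))) := fun j =>
    (hlog j).isTemperedFun hn hdeg ((smoothOffZero_of_contDiff (contDiff_coord j)).mul hul) (hc j)
  set T := divD fun j => ofFun _ (hw j) with hT
  set S := divD fun j => ofFun _ (hq j) with hS
  have hSa : AgreesOffZero S 0 :=
    (agreesOffZero_divD hu'.isLogHomogFun hu fun j => agreesOffZero_ofFun (hq j)).congr
      fun x _ => by simp
  have hSh : IsHomogDist (-(n : ℝ)) S := by
    intro t ht
    have h1 : ∀ j, dil t ht (ofFun _ (hq j)) =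
        ((t ^ (-(n : ℝ) + 1) : ℝ) : ℂ) • ofFun _ (hq j) := by
      intro j
      rw [dil_ofFun hn (hu'.coord_mul j).isLogHomogFun (hq j) isTemperedFun_zero]
      refine dist_ext fun φ => ?_
      simp only [dist_smul_apply, dist_add_apply, ofFun_apply]
      simp
    rw [hS, dil_divD]
    simp only [h1]
    rw [divD_smul, smul_smul, rpow_add_one_mul_inv ht]
  obtain ⟨c, hc'⟩ := eq_smul_delta_of_isHomogDist hSa hSh
  have hTd : ∀ (t : ℝ) (ht : 0 < t), dil t ht T =
      ((t ^ (-(n : ℝ)) : ℝ) : ℂ) • (T + ((Real.log t : ℝ) : ℂ) • S) := by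
    intro t ht
    rw [hT, dil_divD]
    simp only [fun j => dil_ofFun hn (hlog j) (hw j) (hq j) t ht]
    rw [divD_smul, divD_add, divD_smul, smul_smul, rpow_add_one_mul_inv ht]
  refine ⟨T, ⟨?_, fun t ht => ?_⟩, ?_⟩
  · exact (agreesOffZero_divD hu'.mul_log hul fun j => agreesOffZero_ofFun (hw j)).congr
      fun x _ => by simp
  · refine ⟨MvPolynomial.C (((t ^ (-(n : ℝ)) : ℝ) : ℂ) * ((Real.log t : ℝ) : ℂ) * c), ?_, ?_⟩
    · rw [sub_self]; exact IsHomogPoly.C _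
    · rw [hTd, hc', polyDelta_C]
      refine dist_ext fun φ => ?_
      simp only [dist_sub_apply, dist_smul_apply, dist_add_apply]
      ring
  · exact hasSmoothLocalFourier_divD hul (fun j => agreesOffZero_ofFun (hw j))
      fun j => hasSmoothLocalFourier_ofFun (hw j)

/-- The prolongation is (n+s)⁻¹ div V. The divergence raises the degree of the defect polynomials by
one, exactly as -n-(s+1) passes to -n-s. -/
theorem exists_isProlongation_of_add_one {s : ℝ} (hs : (n : ℝ) + s ≠ 0) {u : E n → ℂ}
    (hu : SmoothOffZero u) (hu' : IsHomogFun s u) {V : Fin n → 𝓢'(E n, ℂ)}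
    (hV : ∀ j, IsProlongation (s + 1) (fun x => (x j : ℂ) * u x) (V j))
    (hF : ∀ j, HasSmoothLocalFourier (V j)) :
    ∃ T : 𝓢'(E n, ℂ), IsProlongation s u T ∧ HasSmoothLocalFourier T := by
  have hs' : (((n : ℝ) + s : ℝ) : ℂ) ≠ 0 := by exact_mod_cast hs
  refine ⟨(((n : ℝ) + s : ℝ) : ℂ)⁻¹ • divD V, ⟨?_, fun t ht => ?_⟩,
    (hasSmoothLocalFourier_divD hu (fun j => (hV j).agrees) hF).smul _⟩
  · refine ((agreesOffZero_divD hu'.isLogHomogFun hu fun j => (hV j).agrees).smul _).congr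
      fun x _ => ?_
    rw [Pi.zero_apply, add_zero, ← mul_assoc, inv_mul_cancel₀ hs', one_mul]
  · choose P hP hPe using fun j => (hV j).homog t ht
    refine ⟨(((n : ℝ) + s : ℝ) : ℂ)⁻¹ • (((t⁻¹ : ℝ) : ℂ) •
      ∑ j, Complex.I • (MvPolynomial.X j * P j)), ?_, ?_⟩
    · refine IsHomogPoly.smul (IsHomogPoly.smul (IsHomogPoly.sum _ fun j _ => ?_) _) _
      have h1 := ((hP j).X_mul j).smul Complex.I
      rwa [show -(n : ℝ) - (s + 1) + 1 = -(n : ℝ) - s by ring] at h1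
    · have h2 : ∀ j, dil t ht (V j) = polyDelta (P j) + ((t ^ (s + 1) : ℝ) : ℂ) • V j := fun j => by
        rw [← hPe j]
        exact (sub_add_cancel _ _).symm
      rw [polyDelta_smul, polyDelta_smul, ← divD_polyDelta, dil_smul, dil_divD]
      simp only [h2]
      rw [divD_add, divD_smul, smul_add, smul_smul, rpow_add_one_mul_inv ht]
      refine dist_ext fun φ => ?_
      simp only [dist_sub_apply, dist_smul_apply, dist_add_apply]
      ring

theorem exists_isProlongation (hn : 1 ≤ n) (s : ℝ) {u : E n → ℂ} (hu : SmoothOffZero u)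
    (hu' : IsHomogFun s u) :
    ∃ T : 𝓢'(E n, ℂ), IsProlongation s u T ∧ HasSmoothLocalFourier T := by
  -- The number m bounds how often the degree must be raised by one before it exceeds -n, where u is
  -- locally integrable; the chain stops earlier if it meets -n.
  obtain ⟨m, hm⟩ := exists_nat_gt (-(n : ℝ) - s)
  induction m generalizing s u with
  | zero =>
    have ht := hu'.isLogHomogFun.isTemperedFun hn (by push_cast at hm; linarith) hu smoothOffZero_zero
    exact ⟨ofFun u ht, isProlongation_ofFun hn hu' ht, hasSmoothLocalFourier_ofFun ht⟩
  | succ m ih =>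
    by_cases hs : (n : ℝ) + s = 0
    · obtain rfl : s = -(n : ℝ) := by linarith
      exact exists_isProlongation_neg hn hu hu'
    · choose V hV hF using fun j => ih (s + 1)
        ((smoothOffZero_of_contDiff (contDiff_coord j)).mul hu) (hu'.coord_mul j)
        (by push_cast at hm; linarith)
      exact exists_isProlongation_of_add_one hs hu hu' hV hF

/-! ### Polar coordinates -/

theorem integral_polar (hn : 1 ≤ n) {F : E n → ℂ} (hF : Integrable F) :
    ∫ x, F x = ∫ y : Metric.sphere (0 : E n) 1,
      (∫ r in Set.Ioi (0 : ℝ), ((r ^ (n - 1) : ℝ) : ℂ) * F (r • (y : E n)))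
        ∂(volume : Measure (E n)).toSphere := by
  have : Nonempty (Fin n) := ⟨⟨0, hn⟩⟩
  have : Nontrivial (E n) := inferInstance
  set e := homeomorphUnitSphereProd (E n) with he
  have hmp := (volume : Measure (E n)).measurePreserving_homeomorphUnitSphereProd
  have hmp' := hmp.symm e.toMeasurableEquiv
  have h0 : ∫ x, F x = ∫ x : ({0}ᶜ : Set (E n)), F x ∂((volume : Measure (E n)).comap (↑)) := by
    rw [integral_subtype_comap (measurableSet_singleton _).compl F,
      restrict_compl_singleton]
  have hFi : Integrable (fun x : ({0}ᶜ : Set (E n)) => F x) ((volume : Measure (E n)).comap (↑)) := by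
    have := (integrableOn_iff_comap_subtypeVal (s := ({0}ᶜ : Set (E n)))
      (measurableSet_singleton _).compl (f := F) (μ := volume)).1 hF.integrableOn
    exact this
  have h1 := hmp'.integral_comp e.symm.measurableEmbedding (fun x : ({0}ᶜ : Set (E n)) => F x)
  have h2 := (hmp'.integrable_comp_emb e.symm.measurableEmbedding
    (g := fun x : ({0}ᶜ : Set (E n)) => F x)).2 hFi
  rw [h0, ← h1]
  refine (integral_prod _ h2).trans ?_
  refine integral_congr_ae (.of_forall fun y => ?_)
  simp only [Measure.volumeIoiPow, ENNReal.ofReal]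
  rw [integral_withDensity_eq_integral_smul]
  · rw [← integral_subtype_comap measurableSet_Ioi
      fun r : ℝ => ((r ^ (n - 1) : ℝ) : ℂ) * F (r • (y : E n))]
    refine integral_congr_ae (.of_forall fun r => ?_)
    have hr : (0 : ℝ) < r := r.2
    have h3 : ((e.toMeasurableEquiv.symm (y, r) : ({0}ᶜ : Set (E n))) : E n) = (r : ℝ) • (y : E n) :=
      homeomorphUnitSphereProd_symm_apply_coe _ (y, r)
    simp only [Function.comp_apply, h3, NNReal.smul_def, finrank_euclideanSpace, Fintype.card_fin]
    rw [Real.coe_toNNReal _ (pow_nonneg hr.le _), Complex.real_smul]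
  · exact (measurable_subtype_coe.pow_const _).real_toNNReal

/-- A Frullani integral. -/
theorem integral_frullani {g : ℝ → ℝ} (hg : Continuous g) {a b t : ℝ} (ha : 0 < a) (hab : a ≤ b)
    (ht : 0 < t) (h1 : ∀ r, 0 ≤ r → r ≤ a → g r = 1) (h0 : ∀ r, b ≤ r → g r = 0) :
    ∫ r in Set.Ioi (0 : ℝ), r⁻¹ * (g (t⁻¹ * r) - g r) = Real.log t := by
  -- Below A both values of g are 1 and above B both are 0, so the integrand lives on (A, B].
  set A := min a (a * t) with hA
  set B := max b (b * t) with hB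
  have hb : 0 < b := ha.trans_le hab
  have hA0 : 0 < A := lt_min ha (mul_pos ha ht)
  have hAB : A ≤ B := (min_le_left _ _).trans (hab.trans (le_max_left _ _))
  have hAt : A / t ≤ a := by rw [div_le_iff₀ ht]; exact min_le_right _ _
  have hBt : b ≤ B / t := by rw [le_div_iff₀ ht]; exact le_max_right _ _
  have hB0 : 0 < B := hA0.trans_le hAB
  set f : ℝ → ℝ := fun r => r⁻¹ * g r with hf
  have hfi : ∀ x y : ℝ, 0 < x → 0 < y → IntervalIntegrable f volume x y := by
    intro x y hx hy
    refine ContinuousOn.intervalIntegrable (ContinuousOn.mul ?_ hg.continuousOn)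
    refine continuousOn_inv₀.mono fun r hr => ?_
    have := (lt_min hx hy).trans_le hr.1
    exact this.ne'
  have hsupp : ∀ r, r ∈ Set.Ioi (0 : ℝ) → r ∉ Set.Ioc A B → r⁻¹ * (g (t⁻¹ * r) - g r) = 0 := by
    intro r hr hnot
    have hr0 : 0 < r := hr
    rcases le_or_gt r A with h | h
    · rw [h1 r hr0.le (h.trans (min_le_left _ _)), h1 (t⁻¹ * r) (by positivity), sub_self, mul_zero]
      rw [inv_mul_eq_div]
      exact (div_le_div_of_nonneg_right h ht.le).trans hAt
    · have hrB : B < r := by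
        by_contra hle
        exact hnot ⟨h, not_lt.1 hle⟩
      rw [h0 r ((le_max_left _ _).trans hrB.le), h0 (t⁻¹ * r), sub_self, mul_zero]
      rw [inv_mul_eq_div]
      exact hBt.trans (div_le_div_of_nonneg_right hrB.le ht.le)
  have hsub : Set.Ioc A B ⊆ Set.Ioi (0 : ℝ) := fun r hr => hA0.trans hr.1
  have e0 : ∫ r in Set.Ioi (0 : ℝ), r⁻¹ * (g (t⁻¹ * r) - g r) =
      ∫ r in Set.Ioc A B, r⁻¹ * (g (t⁻¹ * r) - g r) :=
    setIntegral_eq_of_subset_of_forall_sdiff_eq_zero measurableSet_Ioi hsub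
      fun r hr => hsupp r hr.1 hr.2
  rw [e0, ← intervalIntegral.integral_of_le hAB]
  -- Substituting r/t in the first term shifts its interval to [A/t, B/t]. The parts near B vanish,
  -- and near A, where g = 1, there remains the integral of 1/r from A/t to A, which is log t.
  have e1 : ∫ r in A..B, r⁻¹ * (g (t⁻¹ * r) - g r) =
      (∫ r in A..B, t⁻¹ * f (r / t)) - ∫ r in A..B, f r := by
    rw [← intervalIntegral.integral_sub _ (hfi A B hA0 hB0)]
    · refine intervalIntegral.integral_congr fun r hr => ?_
      simp only [hf, inv_mul_eq_div]
      have hr0 : 0 < r := (lt_min hA0 hB0).trans_le hr.1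
      field_simp
    · refine IntervalIntegrable.const_mul ?_ _
      refine ContinuousOn.intervalIntegrable (ContinuousOn.mul ?_ (by fun_prop))
      refine ContinuousOn.inv₀ (by fun_prop) fun r hr => ?_
      have hr0 : 0 < r := (lt_min hA0 hB0).trans_le hr.1
      positivity
  rw [e1, intervalIntegral.integral_const_mul, intervalIntegral.integral_comp_div _ ht.ne',
    smul_eq_mul, ← mul_assoc, inv_mul_cancel₀ ht.ne', one_mul,
    intervalIntegral.integral_interval_sub_interval_comm
      (hfi _ _ (div_pos hA0 ht) (div_pos hB0 ht)) (hfi _ _ hA0 hB0) (hfi _ _ (div_pos hA0 ht) hA0)]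
  have e2 : ∫ r in B / t..B, f r = 0 := by
    rw [intervalIntegral.integral_congr (g := fun _ => (0 : ℝ)), intervalIntegral.integral_zero]
    intro r hr
    have hbr : b ≤ r := (le_min hBt (le_max_left _ _)).trans hr.1
    simp [hf, h0 r hbr]
  have e3 : ∫ r in A / t..A, f r = Real.log t := by
    rw [intervalIntegral.integral_congr (g := fun r => r⁻¹),
      integral_inv_of_pos (div_pos hA0 ht) hA0]
    · congr 1
      field_simp
    · intro r hr
      have hra : r ≤ a := hr.2.trans (max_le hAt (min_le_left _ _))
      have hr0 : 0 < r := (lt_min (div_pos hA0 ht) hA0).trans_le hr.1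
      simp [hf, h1 r hr0.le hra]
  rw [e2, e3, sub_zero]

theorem IsCutoff.integral_ray {χ : E n → ℝ} (hχ : IsCutoff χ) {y : E n} (hy : ‖y‖ = 1) {t : ℝ}
    (ht : 0 < t) :
    ∫ r in Set.Ioi (0 : ℝ), r⁻¹ * (χ (t⁻¹ • r • y) - χ (r • y)) = Real.log t := by
  obtain ⟨δ, hδ, hball⟩ := Metric.eventually_nhds_iff.1 hχ.eq_one
  obtain ⟨R, hR⟩ := hχ.compact.isCompact.isBounded.exists_norm_le
  have h := integral_frullani (g := fun r => χ (r • y)) (a := δ / 2) (b := max (δ / 2) (R + 1))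
    (hχ.smooth.continuous.comp (by fun_prop)) (half_pos hδ) (le_max_left _ _) ht ?_ ?_
  · simpa only [mul_smul] using h
  · intro r hr hr'
    refine hball ?_
    rw [dist_zero_right, norm_smul, hy, mul_one, Real.norm_of_nonneg hr]
    linarith
  · intro r hr
    refine image_eq_zero_of_notMem_tsupport fun hmem => ?_
    have h1 := hR _ hmem
    have h2 : R + 1 ≤ r := (le_max_right _ _).trans hr
    have h3 : 0 ≤ r := (half_pos hδ).le.trans ((le_max_left _ _).trans hr)
    rw [norm_smul, hy, mul_one, Real.norm_of_nonneg h3] at h1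
    linarith

/-! ### The logarithmic defect of homogeneity -/

/-- `(-i x·ξ)^m / m!`. -/
def expTerm (ξ : E n) (m : ℕ) (x : E n) : ℂ :=
  (-Complex.I * (inner ℝ x ξ : ℝ)) ^ m / (m.factorial : ℂ)

theorem hasTemperateGrowth_expTerm (ξ : E n) (m : ℕ) : (expTerm ξ m).HasTemperateGrowth := by
  have h1 : (fun x : E n => ((inner ℝ x ξ : ℝ) : ℂ)).HasTemperateGrowth :=
    (Complex.ofRealCLM.comp ((innerSL ℝ).flip ξ)).hasTemperateGrowth
  have h2 := (((Function.HasTemperateGrowth.const (-Complex.I)).mul h1).pow m).mul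
    (Function.HasTemperateGrowth.const ((m.factorial : ℂ)⁻¹))
  exact h2

theorem expTerm_smul (ξ : E n) (m : ℕ) (t : ℝ) (x : E n) :
    expTerm ξ m (t • x) = ((t ^ m : ℝ) : ℂ) * expTerm ξ m x := by
  simp only [expTerm, inner_smul_left]
  push_cast
  simp
  ring

theorem expTerm_zero_right (ξ : E n) (m : ℕ) : expTerm ξ m 0 = if m = 0 then 1 else 0 := by
  rcases m with _ | m <;> simp [expTerm]

theorem hasFDerivAt_expTerm (ξ : E n) (m : ℕ) (x : E n) :
    HasFDerivAt (expTerm ξ (m + 1))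
      ((-Complex.I * expTerm ξ m x) • Complex.ofRealCLM.comp ((innerSL ℝ).flip ξ)) x := by
  have h1 : HasFDerivAt (fun x : E n => ((inner ℝ x ξ : ℝ) : ℂ))
      (Complex.ofRealCLM.comp ((innerSL ℝ).flip ξ)) x :=
    (Complex.ofRealCLM.comp ((innerSL ℝ).flip ξ)).hasFDerivAt
  have h2 := ((h1.const_mul (-Complex.I)).pow (m + 1)).mul_const (((m + 1).factorial : ℂ)⁻¹)
  refine h2.congr_fderiv ?_
  ext v
  have : (m.factorial : ℂ) ≠ 0 := by exact_mod_cast m.factorial_ne_zero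
  have : (m : ℂ) + 1 ≠ 0 := by exact_mod_cast m.succ_ne_zero
  simp [expTerm, Nat.factorial_succ]
  field_simp

/-- `T` maps every Schwartz function with germ `c' (-i x·ξ)^m / m!` at the origin to `c c'` if
`m = d`, and to `0` otherwise. -/
def ActsOnExpTerm (ξ : E n) (T : 𝓢'(E n, ℂ)) (c : ℂ) (d : ℕ) : Prop :=
  ∀ (m : ℕ) (c' : ℂ) (ψ : 𝓢(E n, ℂ)), (∀ᶠ x in nhds (0 : E n), ψ x = c' * expTerm ξ m x) →
    T ψ = if m = d then c' * c else 0

theorem actsOnExpTerm_delta (ξ : E n) :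
    ActsOnExpTerm ξ (TemperedDistribution.delta (0 : E n)) 1 0 := by
  intro m c' ψ h
  rw [TemperedDistribution.delta_apply, h.self_of_nhds, expTerm_zero_right]
  simp

/-- The transpose of D_j is i∂_j, which maps the term of order m + 1 to ξ_j times the term of order
m and kills constants. Working with germs lets the induction pass to derivatives of the test
function. -/
theorem ActsOnExpTerm.dOp {ξ : E n} {T : 𝓢'(E n, ℂ)} {c : ℂ} {d : ℕ} (h : ActsOnExpTerm ξ T c d)
    (j : Fin n) : ActsOnExpTerm ξ (dOp j T) ((ξ j : ℂ) * c) (d + 1) := by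
  intro m c' ψ hψ
  have hψ' : (ψ : E n → ℂ) =ᶠ[nhds 0] fun x => c' * expTerm ξ m x := hψ
  have hd := hψ'.fderiv (𝕜 := ℝ)
  rw [dOp_apply]
  rcases m with _ | m
  · rw [h 0 0]
    · simp
    · filter_upwards [hd] with x hx
      rw [lineDerivOp_apply_eq_fderiv, hx]
      have : (fun x : E n => c' * expTerm ξ 0 x) = fun _ => c' := by ext; simp [expTerm]
      rw [this]
      simp
  · rw [h m (c' * (-Complex.I * ξ j))]
    · simp only [add_left_inj]
      split_ifs
      · linear_combination (-c' * ξ j * c) * Complex.I_mul_I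
      · simp
    · filter_upwards [hd] with x hx
      have hj : innerSL ℝ ξ (EuclideanSpace.single j 1) = ξ j := by
        rw [innerSL_apply_apply, EuclideanSpace.inner_single_right]; simp
      rw [lineDerivOp_apply_eq_fderiv, hx, ((hasFDerivAt_expTerm ξ m x).const_mul c').fderiv]
      simp [hj]
      ring

theorem ActsOnExpTerm.dOp_iterate {ξ : E n} {T : 𝓢'(E n, ℂ)} {c : ℂ} {d : ℕ}
    (h : ActsOnExpTerm ξ T c d) (j : Fin n) (m : ℕ) :
    ActsOnExpTerm ξ ((HomogDistr.dOp j)^[m] T) ((ξ j : ℂ) ^ m * c) (m + d) := by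
  induction m with
  | zero => simpa using h
  | succ m ih =>
    rw [Function.iterate_succ_apply', pow_succ', mul_assoc, add_right_comm]
    exact ih.dOp j

theorem actsOnExpTerm_dPow (ξ : E n) (α : Fin n →₀ ℕ) :
    ActsOnExpTerm ξ (dPow α (TemperedDistribution.delta (0 : E n))) (∏ i, (ξ i : ℂ) ^ α i)
      α.degree := by
  have key : ∀ l : List (Fin n),
      ActsOnExpTerm ξ (l.foldr (fun j S => (dOp j)^[α j] S) (TemperedDistribution.delta (0 : E n)))
        (l.map fun i => (ξ i : ℂ) ^ α i).prod (l.map fun i => α i).sum := by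
    intro l
    induction l with
    | nil => exact actsOnExpTerm_delta ξ
    | cons j l ih =>
      rw [List.foldr_cons, List.map_cons, List.map_cons, List.prod_cons, List.sum_cons]
      exact ih.dOp_iterate j _
  have h := key (List.finRange n)
  rw [dPow]
  rw [← List.ofFn_eq_map, ← List.ofFn_eq_map, List.prod_ofFn, List.sum_ofFn] at h
  rwa [Finsupp.degree_eq_sum]

theorem IsHomogPoly.polyDelta_apply {k : ℕ} {P : MvPolynomial (Fin n) ℂ} (hP : IsHomogPoly k P)
    (ξ : E n) {ψ : 𝓢(E n, ℂ)} (hψ : ∀ᶠ x in nhds (0 : E n), ψ x = expTerm ξ k x) :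
    polyDelta P ψ = polyEval P ξ := by
  rw [polyDelta, dist_sum_apply, polyEval, MvPolynomial.eval_eq']
  refine Finset.sum_congr rfl fun α hα => ?_
  have h : α.degree = k := by exact_mod_cast hP α (MvPolynomial.mem_support_iff.1 hα)
  rw [dist_smul_apply, actsOnExpTerm_dPow ξ α k 1 ψ (by simpa using hψ), if_pos h.symm, one_mul]

/-- The value P(ξ) is P(D)δ₀ tested on the cut-off Taylor term of exp(-ix·ξ) of order k. Dilation
changes only the cutoff, so this pairing sees u alone, whose radial integral is of Frullani type. -/
theorem IsProlongation.polyEval_eq (hn : 1 ≤ n) {s : ℝ} {u : E n → ℂ} (hu : SmoothOffZero u)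
    (hu' : IsHomogFun s u) {T : 𝓢'(E n, ℂ)} (hT : IsProlongation s u T) {k : ℕ}
    (hk : (k : ℝ) = -(n : ℝ) - s) {t : ℝ} (ht : 0 < t) {P : MvPolynomial (Fin n) ℂ}
    (hP : IsHomogPoly (-(n : ℝ) - s) P)
    (hPe : dil t ht T - ((t ^ s : ℝ) : ℂ) • T = polyDelta P) (ξ : E n) :
    polyEval P ξ = ((t ^ s : ℝ) : ℂ) * (Real.log t : ℂ) * sphereInt k u ξ := by
  obtain ⟨χ, hχ⟩ := exists_isCutoff n
  have hp := hasTemperateGrowth_expTerm ξ k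
  set φ : 𝓢(E n, ℂ) := mulS (expTerm ξ k) hχ.toS with hφ
  have hφx : ∀ x, φ x = expTerm ξ k x * χ x := fun x => by
    rw [hφ, mulS_apply hp, hχ.toS_apply]
  have htk : ((t ^ k : ℝ) : ℂ) ≠ 0 := by exact_mod_cast (pow_pos ht k).ne'
  -- Since -n = s + k, the defect tested on φ equals t^s T(Φ). The function Φ vanishes near 0, where
  -- both cutoffs are 1.
  set Φ : 𝓢(E n, ℂ) := ((t ^ k : ℝ) : ℂ) • dilS t⁻¹ (inv_ne_zero ht.ne') φ - φ with hΦ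
  have hΦx : ∀ x, Φ x = ((χ (t⁻¹ • x) - χ x : ℝ) : ℂ) * expTerm ξ k x := by
    intro x
    rw [hΦ, sub_apply, smul_apply, dilS_apply, hφx, hφx, expTerm_smul, smul_eq_mul, inv_pow]
    push_cast at htk ⊢
    field_simp
  have hΦ0 : ∀ᶠ x in nhds (0 : E n), Φ x = 0 := by
    have h1 : Filter.Tendsto (fun x : E n => t⁻¹ • x) (nhds 0) (nhds 0) := by
      have := (continuous_const_smul t⁻¹).tendsto (0 : E n)
      rwa [smul_zero] at this
    filter_upwards [hχ.eq_one, h1.eventually hχ.eq_one] with x h2 h3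
    rw [hΦx, h2, h3]; simp
  have hΦc : HasCompactSupport Φ := by
    have h1 : (Φ : E n → ℂ) = fun x => ((χ (t⁻¹ • x) : ℂ) - χ x) * expTerm ξ k x := by
      ext x; rw [hΦx]; push_cast; rfl
    rw [h1]
    exact ((hχ.ofReal_compact.comp_smul (inv_ne_zero ht.ne')).sub hχ.ofReal_compact).mul_right
  have hsupp := (zero_notMem_tsupport_iff Φ).2 hΦ0
  have hTΦ := hT.agrees Φ hΦc hsupp
  have hint := hu.integrable_mul (Φ.smooth ⊤) hΦc hsupp
  have h1 := hP
  rw [← hk] at h1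
  have h2 := h1.polyDelta_apply ξ (ψ := φ) (by
    filter_upwards [hχ.eq_one] with x hx
    rw [hφx, hx]; simp)
  have hts : ((t ^ n : ℝ) : ℂ)⁻¹ = ((t ^ s : ℝ) : ℂ) * ((t ^ k : ℝ) : ℂ) := by
    rw [← Complex.ofReal_inv, ← Complex.ofReal_mul, ← Real.rpow_natCast, ← Real.rpow_natCast,
      ← Real.rpow_neg ht.le, ← Real.rpow_add ht]
    congr 2
    rw [hk]; ring
  have h3 : polyEval P ξ = ((t ^ s : ℝ) : ℂ) * T Φ := by
    rw [← h2, ← hPe, dist_sub_apply, dil_apply, dist_smul_apply, hΦ, map_sub, map_smul, hts,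
      smul_eq_mul]
    ring
  rw [h3, hTΦ, mul_assoc]
  congr 1
  rw [integral_polar hn hint, sphereInt, ← integral_const_mul]
  refine integral_congr_ae (.of_forall fun y => ?_)
  have hy : ‖(y : E n)‖ = 1 := norm_eq_of_mem_sphere y
  have hy0 : (y : E n) ≠ 0 := norm_pos_iff.1 (by rw [hy]; exact one_pos)
  have h4 : ∀ r ∈ Set.Ioi (0 : ℝ), ((r ^ (n - 1) : ℝ) : ℂ) * (u (r • (y : E n)) * Φ (r • (y : E n))) =
      (u y * expTerm ξ k y) *
        ((r⁻¹ * (χ (t⁻¹ • r • (y : E n)) - χ (r • (y : E n))) : ℝ) : ℂ) := by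
    intro r hr
    have hr0 : 0 < r := hr
    rw [hΦx, hu' y hy0 r hr0, expTerm_smul]
    have h5 : r ^ (n - 1) * r ^ s * r ^ k = r⁻¹ := by
      rw [← Real.rpow_natCast, ← Real.rpow_natCast, ← Real.rpow_add hr0, ← Real.rpow_add hr0,
        Nat.cast_sub hn, hk, ← Real.rpow_neg_one]
      congr 1
      push_cast; ring
    rw [Complex.ofReal_mul (r⁻¹), ← h5]
    push_cast
    ring
  simp only
  rw [setIntegral_congr_fun measurableSet_Ioi h4, integral_const_mul, integral_complex_ofReal,
    hχ.integral_ray hy ht, expTerm]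
  ring

/-- The defect of homogeneity of the prolongations of `u` is `log t` times a fixed polynomial in
`D` applied to `δ₀`. -/
theorem exists_isHomogPoly_dil_eq (hn : 1 ≤ n) (s : ℝ) {u : E n → ℂ} (hu : SmoothOffZero u)
    (hu' : IsHomogFun s u) :
    ∃ Q : MvPolynomial (Fin n) ℂ, IsHomogPoly (-(n : ℝ) - s) Q ∧
      (∀ k : ℕ, (k : ℝ) = -(n : ℝ) - s → ∀ ξ : E n, polyEval Q ξ = sphereInt k u ξ) ∧
      ∀ T : 𝓢'(E n, ℂ), IsProlongation s u T → ∀ (t : ℝ) (ht : 0 < t),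
        dil t ht T = ((t ^ s : ℝ) : ℂ) • (T + ((Real.log t : ℝ) : ℂ) • polyDelta Q) := by
  by_cases hk : ∃ k : ℕ, (k : ℝ) = -(n : ℝ) - s
  · obtain ⟨k, hk⟩ := hk
    obtain ⟨T₀, hT₀, -⟩ := exists_isProlongation hn s hu hu'
    -- At t = e the logarithm is 1, so e^(-s) P is a polynomial equal to the spherical integral;
    -- this single prolongation shows that the integral is polynomial in ξ.
    have he : 0 < Real.exp 1 := Real.exp_pos 1
    obtain ⟨P, hP, hPe⟩ := hT₀.homog (Real.exp 1) he
    have hes : (((Real.exp 1) ^ s : ℝ) : ℂ) ≠ 0 := by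
      exact_mod_cast (Real.rpow_pos_of_pos he s).ne'
    have hQ : ∀ ξ : E n, polyEval ((((Real.exp 1) ^ s : ℝ) : ℂ)⁻¹ • P) ξ = sphereInt k u ξ := by
      intro ξ
      have h1 := hT₀.polyEval_eq hn hu hu' hk he hP hPe ξ
      rw [Real.log_exp, Complex.ofReal_one, mul_one] at h1
      have h2 : polyEval ((((Real.exp 1) ^ s : ℝ) : ℂ)⁻¹ • P) ξ =
          (((Real.exp 1) ^ s : ℝ) : ℂ)⁻¹ * polyEval P ξ := MvPolynomial.smul_eval _ _ _
      rw [h2, h1, ← mul_assoc, inv_mul_cancel₀ hes, one_mul]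
    refine ⟨(((Real.exp 1) ^ s : ℝ) : ℂ)⁻¹ • P, hP.smul _, fun k' hk' ξ => ?_, fun T hT t ht => ?_⟩
    · have : k' = k := by exact_mod_cast hk'.trans hk.symm
      rw [this, hQ]
    · obtain ⟨P', hP', hPe'⟩ := hT.homog t ht
      have h1 : polyDelta P' = polyDelta ((((t ^ s : ℝ) : ℂ) * ((Real.log t : ℝ) : ℂ)) •
          ((((Real.exp 1) ^ s : ℝ) : ℂ)⁻¹ • P)) := by
        refine polyDelta_congr fun ξ => ?_
        rw [hT.polyEval_eq hn hu hu' hk ht hP' hPe' ξ, ← hQ ξ]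
        exact (MvPolynomial.smul_eval _ _ _).symm
      rw [polyDelta_smul] at h1
      rw [smul_add, smul_smul, ← h1, ← hPe']
      exact (add_sub_cancel _ _).symm
  · push Not at hk
    refine ⟨0, IsHomogPoly.zero _, fun k hk' => absurd hk' (hk k), fun T hT t ht => ?_⟩
    obtain ⟨P', hP', hPe'⟩ := hT.homog t ht
    rw [hP'.eq_zero hk, polyDelta_zero] at hPe'
    rw [polyDelta_zero]
    refine dist_ext fun φ => ?_
    have := congrArg (fun S : 𝓢'(E n, ℂ) => S φ) hPe'
    simp only [dist_sub_apply, dist_smul_apply, dist_zero_apply] at this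
    simp only [dist_smul_apply, dist_add_apply, dist_zero_apply]
    linear_combination this

/-! ### Distributions off the origin -/

theorem AgreesOffZero.eq_of_ne_zero {T : 𝓢'(E n, ℂ)} {v w : E n → ℂ} (hv : AgreesOffZero T v)
    (hw : AgreesOffZero T w) (hv' : SmoothOffZero v) (hw' : SmoothOffZero w) {x : E n}
    (hx : x ≠ 0) : v x = w x := by
  have hd := hv'.sub hw'
  have hU : IsOpen ({0}ᶜ : Set (E n)) := isOpen_compl_singleton
  have h1 : ∀ᵐ x : E n, x ∈ ({0}ᶜ : Set (E n)) → v x - w x = 0 := by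
    refine hU.ae_eq_zero_of_integral_contDiff_smul_eq_zero
      (hd.continuousOn.locallyIntegrableOn hU.measurableSet) fun g hg hc hs => ?_
    have hcs : HasCompactSupport (fun x => (g x : ℂ)) :=
      hc.comp_left (g := fun r : ℝ => (r : ℂ)) Complex.ofReal_zero
    let φ : 𝓢(E n, ℂ) := HasCompactSupport.toSchwartzMap (f := fun x => (g x : ℂ)) hcs
      (Complex.ofRealCLM.contDiff.comp hg)
    have hφ : ∀ x, φ x = g x := fun x => rfl
    have hφc : HasCompactSupport φ := hcs
    have hφ0 : (0 : E n) ∉ tsupport φ := by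
      rw [zero_notMem_tsupport_iff]
      have : (0 : E n) ∉ tsupport g := fun h => hs h rfl
      filter_upwards [notMem_tsupport_iff_eventuallyEq.1 this] with x hx
      rw [hφ, hx]; simp
    have h2 := (hv φ hφc hφ0).symm.trans (hw φ hφc hφ0)
    have h3 : ∀ x, g x • (v x - w x) = v x * φ x - w x * φ x := fun x => by
      rw [hφ, Complex.real_smul]; ring
    simp only [h3]
    rw [integral_sub (hv'.integrable_mul (φ.smooth ⊤) hφc hφ0)
      (hw'.integrable_mul (φ.smooth ⊤) hφc hφ0), h2, sub_self]
  have h4 := Measure.eqOn_open_of_ae_eq (μ := (volume : Measure (E n)))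
    ((ae_restrict_iff' hU.measurableSet).2 h1) hU hd.continuousOn continuousOn_const
  exact sub_eq_zero.1 (h4 hx)

theorem AgreesOffZero.dil {T : 𝓢'(E n, ℂ)} {w : E n → ℂ} (hT : AgreesOffZero T w) (t : ℝ)
    (ht : 0 < t) : AgreesOffZero (dil t ht T) (fun x => w (t • x)) := by
  intro φ hc h0
  rw [dil_apply, hT]
  · have h1 := integral_comp_smul_E (fun x => w x * φ (t⁻¹ • x)) ht
    rw [Complex.real_smul, Complex.ofReal_inv] at h1
    simp only [inv_smul_smul₀ ht.ne'] at h1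
    exact h1.symm
  · have h1 : (dilS t⁻¹ (inv_ne_zero ht.ne') φ : E n → ℂ) = fun x => φ (t⁻¹ • x) := rfl
    rw [h1]
    exact HasCompactSupport.comp_smul (f := (φ : E n → ℂ)) hc (inv_ne_zero ht.ne')
  · rw [zero_notMem_tsupport_iff]
    exact dilS_eventually_zero ((zero_notMem_tsupport_iff φ).1 h0) _ _

theorem SmoothOffZero.comp_smul {w : E n → ℂ} (hw : SmoothOffZero w) {t : ℝ} (ht : t ≠ 0) :
    SmoothOffZero (fun x => w (t • x)) :=
  ContDiffOn.comp (g := w) hw (contDiff_const_smul t).contDiffOn fun _ hx =>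
    smul_ne_zero ht hx

theorem contDiff_polyEval (Q : MvPolynomial (Fin n) ℂ) : ContDiff ℝ ∞ (polyEval Q) :=
  (hasTemperateGrowth_polyEval Q).1

theorem agreesOffZero_polyDist (Q : MvPolynomial (Fin n) ℂ) :
    AgreesOffZero (polyDist Q) (polyEval Q) :=
  fun φ _ _ => polyDist_apply Q φ

/-! ### Log-homogeneous distributions -/

/-- `T` is smooth off the origin, where it equals `w`, and
`T(t ·) = t ^ s (T + log t (Q + P(D) δ₀))`. -/
structure IsLogHomogDist (s : ℝ) (T : 𝓢'(E n, ℂ)) (w : E n → ℂ)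
    (Q P : MvPolynomial (Fin n) ℂ) : Prop where
  smooth : SmoothOffZero w
  agrees : AgreesOffZero T w
  left : IsHomogPoly s Q
  right : IsHomogPoly (-(n : ℝ) - s) P
  dil_eq : ∀ (t : ℝ) (ht : 0 < t), dil t ht T =
    ((t ^ s : ℝ) : ℂ) • (T + ((Real.log t : ℝ) : ℂ) • (polyDist Q + polyDelta P))

theorem IsLogHomogDist.add {s : ℝ} {T T' : 𝓢'(E n, ℂ)} {w w' : E n → ℂ}
    {Q P Q' P' : MvPolynomial (Fin n) ℂ} (h : IsLogHomogDist s T w Q P)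
    (h' : IsLogHomogDist s T' w' Q' P') :
    IsLogHomogDist s (T + T') (fun x => w x + w' x) (Q + Q') (P + P') where
  smooth := h.smooth.add h'.smooth
  agrees := h.agrees.add h'.agrees h.smooth h'.smooth
  left := h.left.add h'.left
  right := h.right.add h'.right
  dil_eq t ht := by
    rw [dil_add, h.dil_eq, h'.dil_eq, polyDist_add, polyDelta_add]
    module

theorem IsLogHomogDist.smul {s : ℝ} {T : 𝓢'(E n, ℂ)} {w : E n → ℂ}
    {Q P : MvPolynomial (Fin n) ℂ} (h : IsLogHomogDist s T w Q P) (c : ℂ) :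
    IsLogHomogDist s (c • T) (fun x => c * w x) (c • Q) (c • P) where
  smooth := h.smooth.const_mul c
  agrees := h.agrees.smul c
  left := h.left.smul c
  right := h.right.smul c
  dil_eq t ht := by
    rw [dil_smul, h.dil_eq, polyDist_smul, polyDelta_smul]
    module

theorem polyDist_zero : polyDist (0 : MvPolynomial (Fin n) ℂ) = 0 := by
  rw [polyDist, polyDelta_zero, fourierD_zero]

theorem isLogHomogDist_polyDelta {s : ℝ} {P : MvPolynomial (Fin n) ℂ}
    (hP : IsHomogPoly (-(n : ℝ) - s) P) : IsLogHomogDist s (polyDelta P) 0 0 0 where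
  smooth := smoothOffZero_zero
  agrees := agreesOffZero_polyDelta P
  left := IsHomogPoly.zero _
  right := IsHomogPoly.zero _
  dil_eq t ht := by
    rw [dil_polyDelta hP, polyDist_zero, polyDelta_zero]
    module

theorem isLogHomogDist_polyLog (hn : 1 ≤ n) {s : ℝ} {Q : MvPolynomial (Fin n) ℂ}
    (hQ : IsHomogPoly s Q) :
    IsLogHomogDist s (polyLog Q) (fun x => polyEval Q x * (Real.log ‖x‖ : ℂ)) Q 0 where
  smooth := (smoothOffZero_of_contDiff (contDiff_polyEval Q)).mul smoothOffZero_log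
  agrees := agreesOffZero_polyLog Q
  left := hQ
  right := IsHomogPoly.zero _
  dil_eq t ht := by
    rw [dil_polyLog hn hQ, polyDelta_zero, add_zero]

theorem IsProlongation.exists_isLogHomogDist (hn : 1 ≤ n) {s : ℝ} {u : E n → ℂ}
    (hu : SmoothOffZero u) (hu' : IsHomogFun s u) {T : 𝓢'(E n, ℂ)} (hT : IsProlongation s u T) :
    ∃ P, IsLogHomogDist s T u 0 P := by
  obtain ⟨P, hP, -, h⟩ := exists_isHomogPoly_dil_eq hn s hu hu'
  exact ⟨P, hu, hT.agrees, IsHomogPoly.zero _, hP, fun t ht => by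
    rw [polyDist_zero, zero_add]; exact h T hT t ht⟩

/-- The dilation law is restricted to the complement of the origin, where P(D)δ₀ disappears and
smooth representatives are unique. -/
theorem IsLogHomogDist.isLogHomogFun {s : ℝ} {T : 𝓢'(E n, ℂ)} {w : E n → ℂ}
    {Q P : MvPolynomial (Fin n) ℂ} (h : IsLogHomogDist s T w Q P) :
    IsLogHomogFun s w (polyEval Q) := by
  intro x hx t ht
  have hQ := smoothOffZero_of_contDiff (contDiff_polyEval Q)
  have h1 := h.agrees.dil t ht
  rw [h.dil_eq] at h1
  have h2 := (h.agrees.add (((agreesOffZero_polyDist Q).add (agreesOffZero_polyDelta P) hQ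
    smoothOffZero_zero).smul ((Real.log t : ℝ) : ℂ)) h.smooth
    ((hQ.add smoothOffZero_zero).const_mul _)).smul ((t ^ s : ℝ) : ℂ)
  have h3 := h1.eq_of_ne_zero h2 (h.smooth.comp_smul ht.ne')
    ((h.smooth.add ((hQ.add smoothOffZero_zero).const_mul _)).const_mul _) hx
  simpa using h3

theorem IsHomogPoly.isHomogFun {s : ℝ} {Q : MvPolynomial (Fin n) ℂ} (hQ : IsHomogPoly s Q) :
    IsHomogFun s (polyEval Q) := fun x _ t _ => hQ.polyEval_smul t x

/-- Removing the logarithmic term of a log-homogeneous distribution. -/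
theorem IsLogHomogDist.isProlongation_sub_polyLog (hn : 1 ≤ n) {s : ℝ} {T : 𝓢'(E n, ℂ)}
    {w : E n → ℂ} {Q P : MvPolynomial (Fin n) ℂ} (h : IsLogHomogDist s T w Q P) :
    ∃ U : E n → ℂ, SmoothOffZero U ∧ IsHomogFun s U ∧ IsProlongation s U (T - polyLog Q) ∧
      IsLogHomogDist s (T - polyLog Q) U 0 P := by
  have h1 := h.add ((isLogHomogDist_polyLog hn h.left).smul (-1))
  have e1 : T + (-1 : ℂ) • polyLog Q = T - polyLog Q := by module
  have e2 : Q + (-1 : ℂ) • Q = 0 := by module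
  have e3 : P + (-1 : ℂ) • (0 : MvPolynomial (Fin n) ℂ) = P := by module
  rw [e1, e2, e3] at h1
  refine ⟨_, h1.smooth, fun x hx t ht => ?_, ⟨h1.agrees, fun t ht => ?_⟩, h1⟩
  · have h2 := h1.isLogHomogFun x hx t ht
    have h3 : polyEval 0 x = 0 := map_zero _
    rwa [h3, mul_zero, add_zero] at h2
  · refine ⟨(((t ^ s : ℝ) : ℂ) * ((Real.log t : ℝ) : ℂ)) • P, h1.right.smul _, ?_⟩
    rw [h1.dil_eq, polyDist_zero, polyDelta_smul]
    module

/-- Forwards, the three kinds of summands each satisfy a dilation law. Backwards, subtracting Q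
log|·| leaves a prolongation. -/
theorem mem_homogSpace_iff (hn : 1 ≤ n) {s : ℝ} {T : 𝓢'(E n, ℂ)} :
    T ∈ homogSpace n s ↔ ∃ w Q P, IsLogHomogDist s T w Q P := by
  constructor
  · rintro ⟨U, V, Q, P, hU, hU', hV, hQ, hP, rfl⟩
    obtain ⟨P', hP'⟩ := hV.exists_isLogHomogDist hn hU hU'
    exact ⟨_, _, _, (hP'.add (isLogHomogDist_polyLog hn hQ)).add (isLogHomogDist_polyDelta hP)⟩
  · rintro ⟨w, Q, P, h⟩
    obtain ⟨U, hU, hU', hV, -⟩ := h.isProlongation_sub_polyLog hn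
    -- No separate term P(D)δ₀ is needed: it is absorbed into the prolongation.
    refine ⟨U, _, Q, 0, hU, hU', hV, h.left, IsHomogPoly.zero _, ?_⟩
    rw [polyDelta_zero]
    module

theorem hasSmoothLocalFourier_polyLog (hn : 1 ≤ n) {s : ℝ} {Q : MvPolynomial (Fin n) ℂ}
    (hQ : IsHomogPoly s Q) : HasSmoothLocalFourier (polyLog Q) := by
  by_cases hk : ∃ k : ℕ, (k : ℝ) = s
  · obtain ⟨k, rfl⟩ := hk
    have hn' : (0 : ℝ) < n := by exact_mod_cast hn
    have hs : -(n : ℝ) < k := (neg_lt_zero.2 hn').trans_le k.cast_nonneg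
    have hsm := smoothOffZero_of_contDiff (contDiff_polyEval Q)
    have ht := hQ.isHomogFun.mul_log.isTemperedFun hn hs (hsm.mul smoothOffZero_log) hsm
    have : polyLog Q = ofFun _ ht := dist_ext fun φ => polyLog_apply Q φ
    rw [this]
    exact hasSmoothLocalFourier_ofFun ht
  · push Not at hk
    have : polyLog Q = 0 := dist_ext fun φ => by
      rw [polyLog_apply, hQ.eq_zero hk]
      simp [polyEval]
    rw [this]
    exact hasSmoothLocalFourier_zero

/-- After removal of Q log|·|, T is compared with the constructed prolongation of the same function.
Both have the same defect, so the difference is exactly homogeneous and supported at 0. -/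
theorem IsLogHomogDist.hasSmoothLocalFourier (hn : 1 ≤ n) {s : ℝ} {T : 𝓢'(E n, ℂ)}
    {w : E n → ℂ} {Q P : MvPolynomial (Fin n) ℂ} (h : IsLogHomogDist s T w Q P) :
    HasSmoothLocalFourier T := by
  obtain ⟨U, hU, hU', hV, -⟩ := h.isProlongation_sub_polyLog hn
  obtain ⟨V₀, hV₀, hF⟩ := exists_isProlongation hn s hU hU'
  obtain ⟨P', -, -, hP'⟩ := exists_isHomogPoly_dil_eq hn s hU hU'
  have h1 : IsHomogDist s (T - polyLog Q - V₀) := fun t ht => by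
    rw [dil_sub, hP' _ hV t ht, hP' _ hV₀ t ht]
    module
  have h2 : AgreesOffZero (T - polyLog Q - V₀) 0 :=
    (hV.agrees.sub hV₀.agrees hU hU).congr fun x _ => sub_self _
  have e : T = (T - polyLog Q - V₀) + V₀ + polyLog Q := by module
  rw [e]
  exact ((hasSmoothLocalFourier_of_supported_zero h2 h1).add hF).add
    (hasSmoothLocalFourier_polyLog hn h.left)

theorem mulDist_add_mulDist {χ θ : E n → ℝ} (hχ : (fun x => (χ x : ℂ)).HasTemperateGrowth)
    (hθ : (fun x => (θ x : ℂ)).HasTemperateGrowth) (h : ∀ x, θ x = 1 - χ x) (T : 𝓢'(E n, ℂ)) :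
    mulDist χ T + mulDist θ T = T := by
  refine dist_ext fun φ => ?_
  rw [dist_add_apply, mulDist_apply, mulDist_apply, ← map_add]
  congr 1
  ext x
  rw [add_apply, mulS_apply hχ, mulS_apply hθ, h]
  push_cast; ring

/-- The Fourier transforms of the two parts of a log-homogeneous distribution. -/
theorem IsLogHomogDist.exists_fourierD_mulDist (hn : 1 ≤ n) {s : ℝ} {T : 𝓢'(E n, ℂ)}
    {w : E n → ℂ} {Q P : MvPolynomial (Fin n) ℂ} (h : IsLogHomogDist s T w Q P) {θ : E n → ℝ}
    (hθ : IsPatch θ) :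
    ∃ v : E n → ℂ, SmoothOffZero v ∧
      (∀ η : E n → ℝ, IsPatch η → ∃ g : 𝓢(E n, ℂ), ∀ ξ, g ξ = η ξ * v ξ) ∧
      ∀ ψ : 𝓢(E n, ℂ), (∀ᶠ x in nhds (0 : E n), ψ x = 0) →
        fourierD (mulDist θ T) ψ = ∫ ξ, v ξ * ψ ξ := by
  have hq := smoothOffZero_of_contDiff (contDiff_polyEval Q)
  have ht := hθ.isTemperedFun_mul hn h.isLogHomogFun h.smooth hq
  obtain ⟨v, hv, hg, hψ⟩ :=
    hθ.exists_fourierD_eq hn h.isLogHomogFun h.left.isHomogFun h.smooth hq ht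
  rw [h.agrees.mulDist_patch hθ ht]
  exact ⟨v, hv, hg, fun ψ h0 => (hψ ψ h0).2⟩

theorem IsLogHomogDist.exists_agreesOffZero_fourierD (hn : 1 ≤ n) {s : ℝ} {T : 𝓢'(E n, ℂ)}
    {w : E n → ℂ} {Q P : MvPolynomial (Fin n) ℂ} (h : IsLogHomogDist s T w Q P) :
    ∃ v : E n → ℂ, SmoothOffZero v ∧ AgreesOffZero (fourierD T) v := by
  obtain ⟨χ, hχ⟩ := exists_isCutoff n
  have hθ : IsPatch (fun x => 1 - χ x) := ⟨χ, hχ, fun _ => rfl⟩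
  obtain ⟨v, hv, -, hψ⟩ := h.exists_fourierD_mulDist hn hθ
  obtain ⟨v₀, hv₀, hψ₀⟩ := h.hasSmoothLocalFourier hn χ hχ
  have h1 := AgreesOffZero.add (S := fourierD (mulDist χ T))
    (T := fourierD (mulDist (fun x => 1 - χ x) T)) (fun φ hc _ => hψ₀ φ hc)
    (fun φ _ h0 => hψ φ ((zero_notMem_tsupport_iff φ).1 h0)) (smoothOffZero_of_contDiff hv₀) hv
  rw [← fourierD_add, mulDist_add_mulDist hχ.temperate hθ.temperate fun _ => rfl] at h1
  exact ⟨_, (smoothOffZero_of_contDiff hv₀).add hv, h1⟩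

/-- Dilating T̂ by t is transforming T(·/t), up to t^(-n). Hence the logarithm changes sign, P(D)δ₀
becomes the polynomial P, and Q becomes a multiple of Q(D)δ₀. -/
theorem IsLogHomogDist.exists_fourierD (hn : 1 ≤ n) {s : ℝ} {T : 𝓢'(E n, ℂ)}
    {w : E n → ℂ} {Q P : MvPolynomial (Fin n) ℂ} (h : IsLogHomogDist s T w Q P) :
    ∃ (v : E n → ℂ) (c : ℂ),
      IsLogHomogDist (-(n : ℝ) - s) (fourierD T) v ((-1 : ℂ) • P) (c • Q) := by
  obtain ⟨v, hv, hv'⟩ := h.exists_agreesOffZero_fourierD hn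
  obtain ⟨c, hc⟩ := fourierD_polyDist h.left
  refine ⟨v, -c, hv, hv', h.right.smul _, ?_, fun t ht => ?_⟩
  · have e : -(n : ℝ) - (-(n : ℝ) - s) = s := by ring
    rw [e]
    exact h.left.smul _
  · have e : fourierD (polyDelta P) = polyDist P := rfl
    rw [dil_fourierD, h.dil_eq, fourierD_smul, fourierD_add, fourierD_smul, fourierD_add, hc, e,
      smul_smul, rpow_neg_sub_mul ht, Real.log_inv, polyDist_smul, polyDelta_smul]
    push_cast
    module

theorem ofSchwartz_add (f g : 𝓢(E n, ℂ)) : ofSchwartz (f + g) = ofSchwartz f + ofSchwartz g :=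
  map_add (toTemperedDistributionCLM (E n) ℂ volume) f g

theorem ofSchwartz_sub (f g : 𝓢(E n, ℂ)) : ofSchwartz (f - g) = ofSchwartz f - ofSchwartz g :=
  map_sub (toTemperedDistributionCLM (E n) ℂ volume) f g

theorem ofSchwartz_smul (c : ℂ) (g : 𝓢(E n, ℂ)) : ofSchwartz (c • g) = c • ofSchwartz g :=
  map_smul (toTemperedDistributionCLM (E n) ℂ volume) c g

theorem HasSmoothFourier.exists_mulDist_fourierD_eq {T : 𝓢'(E n, ℂ)} (hT : HasSmoothFourier T)
    {χ : E n → ℝ} (hχ : IsCutoff χ) :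
    ∃ g : 𝓢(E n, ℂ), mulDist χ (fourierD T) = ofSchwartz g := by
  obtain ⟨v, hv, h⟩ := hT
  let g : 𝓢(E n, ℂ) := HasCompactSupport.toSchwartzMap (f := fun x => (χ x : ℂ) * v x)
    hχ.ofReal_compact.mul_right (hχ.ofReal_smooth.mul hv)
  have hg : ∀ x, g x = χ x * v x := fun x => rfl
  refine ⟨g, dist_ext fun φ => ?_⟩
  rw [mulDist_apply, ofSchwartz_apply, h]
  · refine integral_congr_ae (.of_forall fun x => ?_)
    simp only [mulS_apply hχ.temperate, hg]
    ring
  · rw [coe_mulS hχ.temperate]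
    exact hχ.ofReal_compact.mul_right

/-- Writing θ = 1 - χ', the error is the transform of θT times 1 - χ, minus the transform of χ'T
times χ. The first is Schwartz by decay off the origin, the second by smoothness. -/
theorem IsLogHomogDist.exists_fourierD_mulDist_eq (hn : 1 ≤ n) {s : ℝ} {T : 𝓢'(E n, ℂ)}
    {w : E n → ℂ} {Q P : MvPolynomial (Fin n) ℂ} (h : IsLogHomogDist s T w Q P)
    {θ χ : E n → ℝ} (hθ : IsPatch θ) (hχ : IsCutoff χ) :
    ∃ g : 𝓢(E n, ℂ),
      fourierD (mulDist θ T) = mulDist χ (fourierD T) + ofSchwartz g := by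
  obtain ⟨χ', hχ', hθχ⟩ := id hθ
  have hη : IsPatch (fun x => 1 - χ x) := ⟨χ, hχ, fun _ => rfl⟩
  obtain ⟨v, hv, hg, hψ⟩ := h.exists_fourierD_mulDist hn hθ
  obtain ⟨g₁, hg₁⟩ := hg _ hη
  obtain ⟨g₂, hg₂⟩ := (h.hasSmoothLocalFourier hn χ' hχ').exists_mulDist_fourierD_eq hχ
  have h1 : mulDist (fun x => 1 - χ x) (fourierD (mulDist θ T)) = ofSchwartz g₁ := by
    refine dist_ext fun φ => ?_
    rw [mulDist_apply, ofSchwartz_apply, hψ]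
    · refine integral_congr_ae (.of_forall fun x => ?_)
      simp only [mulS_apply hη.temperate, hg₁]
      ring
    · filter_upwards [hη.eventually_zero] with x hx
      rw [mulS_apply hη.temperate, hx]; simp
  have h2 := mulDist_add_mulDist hχ'.temperate hθ.temperate hθχ T
  have h3 : mulDist χ (fourierD T) = ofSchwartz g₂ + mulDist χ (fourierD (mulDist θ T)) := by
    rw [← hg₂, ← mulDist_add, ← fourierD_add, h2]
  have h4 := mulDist_add_mulDist hχ.temperate hη.temperate (fun _ => rfl)
    (fourierD (mulDist θ T))
  refine ⟨g₁ - g₂, ?_⟩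
  rw [ofSchwartz_sub, h3, ← h1]
  nth_rewrite 1 [← h4]
  module

/-! ### The spaces `χ ℋ_s + 𝒮` -/

theorem mulHomogSpace_subset (hn : 1 ≤ n) (s : ℝ) {θ θ' : E n → ℝ}
    (hθ : (fun x => (θ x : ℂ)).HasTemperateGrowth)
    (hθ' : (fun x => (θ' x : ℂ)).HasTemperateGrowth) (hs : ContDiff ℝ ∞ (fun x => θ x - θ' x))
    (hc : HasCompactSupport (fun x => θ x - θ' x))
    (h0 : ∀ᶠ x in nhds (0 : E n), θ x - θ' x = 0) :
    mulHomogSpace n θ s ⊆ mulHomogSpace n θ' s := by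
  rintro _ ⟨T, hT, g, rfl⟩
  obtain ⟨w, Q, P, h⟩ := (mem_homogSpace_iff hn).1 hT
  obtain ⟨g', hg'⟩ := h.agrees.mulDist_compact h.smooth hs hc h0
  refine ⟨T, hT, g' + g, ?_⟩
  have hd : (fun x => ((θ x - θ' x : ℝ) : ℂ)).HasTemperateGrowth := by
    have := hθ.sub hθ'
    simp only [Complex.ofReal_sub]
    exact this
  have : mulDist θ T = mulDist θ' T + mulDist (fun x => θ x - θ' x) T := by
    refine dist_ext fun φ => ?_
    rw [dist_add_apply, mulDist_apply, mulDist_apply, mulDist_apply, ← map_add]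
    congr 1
    ext x
    rw [add_apply, mulS_apply hθ, mulS_apply hθ', mulS_apply hd]
    push_cast; ring
  rw [ofSchwartz_add, ← hg', this, add_assoc]

theorem IsCutoff.mulHomogSpace_subset (hn : 1 ≤ n) (s : ℝ) {χ χ' : E n → ℝ} (hχ : IsCutoff χ)
    (hχ' : IsCutoff χ') : mulHomogSpace n χ s ⊆ mulHomogSpace n χ' s := by
  refine HomogDistr.mulHomogSpace_subset hn s hχ.temperate hχ'.temperate
    (hχ.smooth.sub hχ'.smooth) (hχ.compact.sub hχ'.compact) ?_
  filter_upwards [hχ.eq_one, hχ'.eq_one] with x h h'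
  rw [h, h', sub_self]

theorem IsPatch.mulHomogSpace_subset (hn : 1 ≤ n) (s : ℝ) {θ θ' : E n → ℝ} (hθ : IsPatch θ)
    (hθ' : IsPatch θ') : mulHomogSpace n θ s ⊆ mulHomogSpace n θ' s := by
  obtain ⟨χ, hχ, h⟩ := id hθ
  obtain ⟨χ', hχ', h'⟩ := id hθ'
  have e : (fun x => θ x - θ' x) = fun x => χ' x - χ x := by
    ext x; rw [h, h']; ring
  refine HomogDistr.mulHomogSpace_subset hn s hθ.temperate hθ'.temperate
    (hθ.smooth.sub hθ'.smooth) ?_ ?_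
  · rw [e]
    exact hχ'.compact.sub hχ.compact
  · filter_upwards [hθ.eventually_zero, hθ'.eventually_zero] with x h h'
    rw [h, h', sub_self]

theorem fourierD_mem_homogSpace (hn : 1 ≤ n) {s : ℝ} {T : 𝓢'(E n, ℂ)} (hT : T ∈ homogSpace n s) :
    fourierD T ∈ homogSpace n (-(n : ℝ) - s) := by
  obtain ⟨w, Q, P, h⟩ := (mem_homogSpace_iff hn).1 hT
  obtain ⟨v, c, h'⟩ := h.exists_fourierD hn
  exact (mem_homogSpace_iff hn).2 ⟨_, _, _, h'⟩

theorem smul_mem_homogSpace (hn : 1 ≤ n) {s : ℝ} {T : 𝓢'(E n, ℂ)} (hT : T ∈ homogSpace n s)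
    (c : ℂ) : c • T ∈ homogSpace n s := by
  obtain ⟨w, Q, P, h⟩ := (mem_homogSpace_iff hn).1 hT
  exact (mem_homogSpace_iff hn).2 ⟨_, _, _, h.smul c⟩

theorem fourierD_inv_smul (T : 𝓢'(E n, ℂ)) :
    fourierD (((((2 * Real.pi) ^ n : ℝ) : ℂ) ^ 2)⁻¹ • fourierD (fourierD (fourierD T))) = T := by
  rw [fourierD_smul, fourierD_four, inv_smul_smul₀ (pow_ne_zero 2 two_pi_pow_ne_zero)]

/-- The inverse of the Fourier transform is a multiple of its cube, which maps ℋ_{-n-s} to ℋ_s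
because s ↦ -n-s is an involution. -/
theorem bijOn_fourierD (hn : 1 ≤ n) (s : ℝ) {θ χ : E n → ℝ} (hθ : IsPatch θ) (hχ : IsCutoff χ) :
    Set.BijOn fourierD (mulHomogSpace n θ s) (mulHomogSpace n χ (-(n : ℝ) - s)) := by
  refine ⟨?_, fourierD_injective.injOn, ?_⟩
  · rintro _ ⟨T, hT, g, rfl⟩
    obtain ⟨w, Q, P, h⟩ := (mem_homogSpace_iff hn).1 hT
    obtain ⟨g', hg'⟩ := h.exists_fourierD_mulDist_eq hn hθ hχ
    refine ⟨_, fourierD_mem_homogSpace hn hT, g' + fourierS g, ?_⟩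
    rw [fourierD_add, hg', fourierD_ofSchwartz, ofSchwartz_add, add_assoc]
  · rintro _ ⟨T', hT', g', rfl⟩
    set c : ℂ := ((((2 * Real.pi) ^ n : ℝ) : ℂ) ^ 2)⁻¹ with hc
    have hT : c • fourierD (fourierD (fourierD T')) ∈ homogSpace n s := by
      have e : -(n : ℝ) - (-(n : ℝ) - s) = s := by ring
      have h1 := fourierD_mem_homogSpace hn
        (fourierD_mem_homogSpace hn (fourierD_mem_homogSpace hn hT'))
      rw [e, e] at h1
      exact smul_mem_homogSpace hn h1 c
    obtain ⟨w, Q, P, h⟩ := (mem_homogSpace_iff hn).1 hT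
    obtain ⟨g, hg⟩ := h.exists_fourierD_mulDist_eq hn hθ hχ
    rw [fourierD_inv_smul] at hg
    -- The Schwartz term is the inverse transform of g' - g: it cancels the error g and supplies g'.
    refine ⟨_, ⟨_, hT, c • fourierS (fourierS (fourierS (g' - g))), rfl⟩, ?_⟩
    rw [ofSchwartz_smul, ← fourierD_ofSchwartz, ← fourierD_ofSchwartz, ← fourierD_ofSchwartz,
      fourierD_add, hg, fourierD_inv_smul, ofSchwartz_sub]
    module

/-! ### Fourier transforms of prolongations -/

/-- The transform has polynomial part -P, which P log|·| compensates; its delta part is a multiple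
of the polynomial part of T, here 0. -/
theorem IsLogHomogDist.isHomogDist_fourierD_add_polyLog (hn : 1 ≤ n) {s : ℝ} {T : 𝓢'(E n, ℂ)}
    {w : E n → ℂ} {P : MvPolynomial (Fin n) ℂ} (h : IsLogHomogDist s T w 0 P) :
    IsHomogDist (-(n : ℝ) - s) (fourierD T + polyLog P) ∧
      ∃ v : E n → ℂ, SmoothOffZero v ∧ AgreesOffZero (fourierD T + polyLog P) v := by
  obtain ⟨v, c, h'⟩ := h.exists_fourierD hn
  have h1 := h'.add (isLogHomogDist_polyLog hn h.right)
  refine ⟨fun t ht => ?_, _, h1.smooth, h1.agrees⟩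
  have e1 : (-1 : ℂ) • P + P = 0 := by module
  rw [h1.dil_eq, e1, smul_zero, add_zero, polyDist_zero, polyDelta_zero]
  module

end HomogDistr

end

open HomogDistr

theorem proposition4 (n : ℕ) (hn : 1 ≤ n) (s : ℝ) :
    -- part (i)
    (∀ u : E n → ℂ, SmoothOffZero u → IsHomogFun s u →
      (∃ T : 𝓢'(E n, ℂ), IsProlongation s u T) ∧
      ∃ Q : MvPolynomial (Fin n) ℂ, IsHomogPoly (-(n : ℝ) - s) Q ∧
        (∀ k : ℕ, (k : ℝ) = -(n : ℝ) - s → ∀ ξ : E n, polyEval Q ξ = sphereInt k u ξ) ∧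
        ∀ T : 𝓢'(E n, ℂ), IsProlongation s u T →
          ∃ U : 𝓢'(E n, ℂ), fourierD T = U - polyLog Q ∧
            IsHomogDist (-(n : ℝ) - s) U ∧
            (∃ v : E n → ℂ, SmoothOffZero v ∧ AgreesOffZero U v) ∧
            ∀ θ χ : E n → ℝ, IsPatch θ → IsCutoff χ →
              ∃ (hθ : IsTemperedFun (fun x => (θ x : ℂ) * u x)) (g : 𝓢(E n, ℂ)),
                fourierD (ofFun (fun x => (θ x : ℂ) * u x) hθ) =
                  mulDist χ (U - polyLog Q) + ofSchwartz g) ∧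
    -- part (ii)
    (∀ θ χ : E n → ℝ, IsPatch θ → IsCutoff χ →
      Set.BijOn fourierD (mulHomogSpace n θ s) (mulHomogSpace n χ (-(n : ℝ) - s))) ∧
    -- the spaces do not depend on the choice of the patch function and of the cutoff function
    (∀ θ θ' : E n → ℝ, IsPatch θ → IsPatch θ' → mulHomogSpace n θ s = mulHomogSpace n θ' s) ∧
    (∀ χ χ' : E n → ℝ, IsCutoff χ → IsCutoff χ' →
      mulHomogSpace n χ s = mulHomogSpace n χ' s) := by
  refine ⟨fun u hu hu' => ?_, fun θ χ hθ hχ => bijOn_fourierD hn s hθ hχ,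
    fun θ θ' hθ hθ' => (hθ.mulHomogSpace_subset hn s hθ').antisymm
      (hθ'.mulHomogSpace_subset hn s hθ),
    fun χ χ' hχ hχ' => (hχ.mulHomogSpace_subset hn s hχ').antisymm
      (hχ'.mulHomogSpace_subset hn s hχ)⟩
  obtain ⟨T₀, hT₀, -⟩ := exists_isProlongation hn s hu hu'
  obtain ⟨Q, hQ, hQ', hdil⟩ := exists_isHomogPoly_dil_eq hn s hu hu'
  refine ⟨⟨T₀, hT₀⟩, Q, hQ, hQ', fun T hT => ?_⟩
  have h : IsLogHomogDist s T u 0 Q := ⟨hu, hT.agrees, IsHomogPoly.zero _, hQ, fun t ht => by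
    rw [polyDist_zero, zero_add]; exact hdil T hT t ht⟩
  obtain ⟨hU, hv⟩ := h.isHomogDist_fourierD_add_polyLog hn
  have e : fourierD T + polyLog Q - polyLog Q = fourierD T := by module
  refine ⟨fourierD T + polyLog Q, e.symm, hU, hv, fun θ χ hθ hχ => ?_⟩
  have ht := hθ.isTemperedFun_mul hn hu'.isLogHomogFun hu smoothOffZero_zero
  obtain ⟨g, hg⟩ := h.exists_fourierD_mulDist_eq hn hθ hχ
  refine ⟨ht, g, ?_⟩
  -- The function θu is θ times the prolongation T, whichever prolongation is chosen, since θ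
  -- vanishes near 0.
  rw [e, ← hT.agrees.mulDist_patch hθ ht, hg]
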